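/- Let $\mathcal{E}$ and $\mathcal{E}_c$ be two nondegenerate ellipses in the plane (circles allowed), with $\mathcal{E}_c$ contained in the open region bounded by $\mathcal{E}$, and suppose that there is at least one triangle inscribed in $\mathcal{E}$ whose three side lines are tangent to $\mathcal{E}_c$. Let $\mathcal{T}$ be the family of all such (Poncelet) triangles, and let $\mathcal{R}$ be the set of points lying on the circumcircle of at least one triangle in $\mathcal{T}$. For a point $P$, the isogonal conjugate of $P$ with respect to a triangle (of which $P$ is not a vertex) is the common point, when it exists, of the reflections of the lines joining $P$ to the vertices in the angle bisectors at these vertices; let $\mathcal{L}^\dagger$ be the locus of the isogonal conjugates of $P$ with respect to the triangles of $\mathcal{T}$. 1. If $P\notin\mathcal{R}$ and $P$ is not a focus of $\mathcal{E}_c$, then $\mathcal{L}^\dagger$ is a nondegenerate ellipse (possibly a circle). 2. If $P$ is in the interior of $\mathcal{R}$ and $P\notin\mathcal{E}$, then $\mathcal{L}^\dagger$ is a nondegenerate hyperbola. 3. In both cases ($P\notin\mathcal{R}$, or $P$ in the interior of $\mathcal{R}$ and not on $\mathcal{E}$), if moreover $P$ lies outside $\mathcal{E}_c$, then there are exactly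 two tangent lines $\ell_1\ne\ell_2$ from $P$ to $\mathcal{E}_c$, and there are two distinct points $Z_1,Z_2$ of $\mathcal{L}^\dagger\cap\mathcal{E}$ such that, for $i=1,2$, $Z_i$ is the apex, and the only apex, of Poncelet triangles whose base lies along $\ell_i$. If in addition $P$ lies strictly inside the circumcircle of every triangle of $\mathcal{T}$, then $\mathcal{L}^\dagger\cap\mathcal{E}=\{Z_1,Z_2\}$. -/

import Mathlib

open scoped ComplexConjugate Affine

noncomputable section

namespace PonceletIsogonal

/-- The data of a nondegenerate ellipse of the plane (identified with `ℂ`): its center, a unit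
vector `u` along the major axis, and the semiaxes `a ≥ b > 0`. Circles are included (`a = b`). -/
structure Ellipse where
  center : ℂ
  u : ℂ
  a : ℝ
  b : ℝ
  norm_u : ‖u‖ = 1
  b_pos : 0 < b
  b_le_a : b ≤ a

namespace Ellipse

/-- `(x / a) ^ 2 + (y / b) ^ 2`, where `x`, `y` are the coordinates of `X` along the axes. -/
def form (e : Ellipse) (X : ℂ) : ℝ :=
  ((conj e.u * (X - e.center)).re / e.a) ^ 2 + ((conj e.u * (X - e.center)).im / e.b) ^ 2

/-- The curve. -/
def carrier (e : Ellipse) : Set ℂ := {X | e.form X = 1}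

/-- The open region bounded by the curve. -/
def inside (e : Ellipse) : Set ℂ := {X | e.form X < 1}

/-- The complement of the closed region bounded by the curve. -/
def outside (e : Ellipse) : Set ℂ := {X | 1 < e.form X}

/-- The two foci (they coincide with the center for a circle). -/
def foci (e : Ellipse) : Set ℂ :=
  {e.center + (Real.sqrt (e.a ^ 2 - e.b ^ 2) : ℂ) * e.u,
    e.center - (Real.sqrt (e.a ^ 2 - e.b ^ 2) : ℂ) * e.u}

/-- The line `ℓ` is tangent to the ellipse: it meets the curve in exactly one point. -/
def IsTangentLine (e : Ellipse) (ℓ : AffineSubspace ℝ ℂ) : Prop :=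
  Module.finrank ℝ ℓ.direction = 1 ∧ ∃ X, (ℓ : Set ℂ) ∩ e.carrier = {X}

/-- The tangent lines to the ellipse that pass through `P`. -/
def tangentsFrom (e : Ellipse) (P : ℂ) : Set (AffineSubspace ℝ ℂ) :=
  {ℓ | e.IsTangentLine ℓ ∧ P ∈ ℓ}

end Ellipse

/-- `S` is a nondegenerate ellipse, possibly a circle. -/
def IsEllipse (S : Set ℂ) : Prop := ∃ e : Ellipse, S = e.carrier

/-- `S` is a nondegenerate hyperbola (both branches): in orthonormal coordinates `x`, `y` with
origin `m`, it is given by `(x / a) ^ 2 - (y / b) ^ 2 = 1`. -/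
def IsHyperbola (S : Set ℂ) : Prop :=
  ∃ (m u : ℂ) (a b : ℝ), ‖u‖ = 1 ∧ 0 < a ∧ 0 < b ∧
    S = {X | ((conj u * (X - m)).re / a) ^ 2 - ((conj u * (X - m)).im / b) ^ 2 = 1}

/-- The line containing the side of `T` opposite to its `i`-th vertex (indices modulo 3). -/
def side (T : Affine.Triangle ℝ ℂ) (i : Fin 3) : AffineSubspace ℝ ℂ :=
  line[ℝ, T.points (i + 1), T.points (i + 2)]

/-- The (internal) bisector of the angle of `T` at its `i`-th vertex: the line through the vertex
in the direction of the sum of the unit vectors along the two sides. -/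
def bisector (T : Affine.Triangle ℝ ℂ) (i : Fin 3) : AffineSubspace ℝ ℂ :=
  line[ℝ, T.points i, T.points i +
    ((‖T.points (i + 1) - T.points i‖⁻¹ : ℝ) • (T.points (i + 1) - T.points i) +
      (‖T.points (i + 2) - T.points i‖⁻¹ : ℝ) • (T.points (i + 2) - T.points i))]

instance (T : Affine.Triangle ℝ ℂ) (i : Fin 3) : Nonempty (bisector T i) :=
  ⟨⟨T.points i, left_mem_affineSpan_pair ℝ _ _⟩⟩

/-- `Q` is the isogonal conjugate of `P` with respect to the triangle `T`: `P` is not a vertex (so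
its three cevians are lines), and `Q` lies on the reflection of each cevian of `P` in the angle
bisector at the corresponding vertex. -/
def IsIsogonalConjugate (T : Affine.Triangle ℝ ℂ) (P Q : ℂ) : Prop :=
  ∀ i : Fin 3, P ≠ T.points i ∧
    Q ∈ line[ℝ, T.points i, EuclideanGeometry.reflection (bisector T i) P]

/-- The triangles inscribed in `E` whose three side lines are tangent to `Ec`. -/
def ponceletFamily (E Ec : Ellipse) : Set (Affine.Triangle ℝ ℂ) :=
  {T | ∀ i : Fin 3, T.points i ∈ E.carrier ∧ Ec.IsTangentLine (side T i)}

/-- The region swept by the circumcircle over the Poncelet family. -/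
def sweptRegion (E Ec : Ellipse) : Set ℂ :=
  ⋃ T ∈ ponceletFamily E Ec, (T.circumsphere : Set ℂ)

/-- The locus of the isogonal conjugate of `P` over the Poncelet family. -/
def isogonalLocus (E Ec : Ellipse) (P : ℂ) : Set ℂ :=
  {Q | ∃ T ∈ ponceletFamily E Ec, IsIsogonalConjugate T P Q}

/-- `Z` is the apex of a Poncelet triangle whose base lies along the line `ℓ`. -/
def IsApexOver (E Ec : Ellipse) (ℓ : AffineSubspace ℝ ℂ) (Z : ℂ) : Prop :=
  ∃ T ∈ ponceletFamily E Ec, ∃ i : Fin 3, T.points i = Z ∧ side T i = ℓ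

end PonceletIsogonal

end

noncomputable section

namespace PonceletIsogonal

/-! The chart `Ellipse.pt`, which is `z ↦ p z + q z̄` up to a rigid motion, turns `E` into the unit
circle and `Ec` into a conic with foci `f`, `g` in the open unit disc. Put `s = f + g` and `c = f
g`. The Poncelet triangles become the fibres of the Blaschke product `z (z - f) (z - g) / ((1 - f̄
z) (1 - ḡ z))` over the unit circle (`sym_of_tan`, `exists_sym`), so the family has a unimodular
parameter `l` in which the symmetric functions of the vertices are affine.

Write `P = pt w` and `Q = pt v`. They are isogonal conjugates when they are the foci of a conic
inscribed in the triangle, that is, when the products of their signed distances to the three sides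
agree. By `inscribed_iff` this amounts to two equations. One does not involve `l` and fixes the
common product `k` as a real-affine function of `v`; the other is `w + v - s + l * conj (w v - c + p
q k) = 0`. Eliminating `l` leaves `|w + v - s| = |w v - c + p q k|`, a conic in `v`: with `y = v -
(s - w)` it reads `|y|² = |L y + d|²` (`conic_iff`, `isogonalLocus_eq`).

The power of `P` in the circumcircle is `α - Re (l γ)` (`power_formula`), so `P` is swept exactly
when `|α| ≤ |γ|`. On the other hand `det (1 - LᵀL)` is a positive multiple of `α² - |γ|²`
(`gapDet_ent`), whence an ellipse off the swept region and a hyperbola where `|α| < |γ|`, which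
includes all interior points not on `E` (`abs_alp_lt_of_interior`). As for degeneracy, `d = 0` makes
`P` a focus of `Ec` (`off_eq_zero_imp_focus`), and in the hyperbolic case it contradicts uniqueness
of the isogonal conjugate (`offset_ne_zero`); `gap_nondeg` excludes a pair of lines.

The value `k = 0` occurs when `P` is on a side line and `Q` is the opposite vertex; the two tangents
from `P` to `Ec` thus yield `Z₁` and `Z₂`. If `Q` is on `E` and `k ≠ 0`, the power of `P` is
nonnegative (`power_nonneg_of_focal`), so no other intersection exists when `P` is inside all
circumcircles. -/

/-- A quadratic polynomial with three distinct roots vanishes identically. -/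
lemma quadratic_eq_zero {a b c x y z : ℂ} (hxy : x ≠ y) (hyz : y ≠ z) (hzx : z ≠ x)
    (hx : a * x ^ 2 + b * x + c = 0) (hy : a * y ^ 2 + b * y + c = 0)
    (hz : a * z ^ 2 + b * z + c = 0) : a = 0 ∧ b = 0 ∧ c = 0 := by
  have h1 : a * (x + y) + b = 0 :=
    mul_left_cancel₀ (sub_ne_zero.2 hxy) (by linear_combination hx - hy)
  have h2 : a * (y + z) + b = 0 :=
    mul_left_cancel₀ (sub_ne_zero.2 hyz) (by linear_combination hy - hz)
  have ha : a = 0 := mul_left_cancel₀ (sub_ne_zero.2 hzx) (by linear_combination h2 - h1)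
  have hb : b = 0 := by rw [ha] at h1; linear_combination h1
  exact ⟨ha, hb, by rw [ha, hb] at hx; linear_combination hx⟩

/-! ### Poncelet triangles of the unit circle as fibres of a Blaschke product -/

/-- The elementary symmetric functions of the (affinely normalised) vertices of the Poncelet
triangle with parameter `l`. -/
structure Sym (s c l z₁ z₂ z₃ : ℂ) : Prop where
  one : z₁ + z₂ + z₃ = s + l * conj c
  two : z₁ * z₂ + z₂ * z₃ + z₃ * z₁ = c + l * conj s
  three : z₁ * z₂ * z₃ = l

/-- The chord of the unit circle through `z₁` and `z₂` is tangent to a given ellipse. -/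
def Tan (s c W z₁ z₂ : ℂ) : Prop :=
  (z₁ + z₂) ^ 2 - (z₁ + z₂) * (s + z₁ * z₂ * conj s) + c + (z₁ * z₂) ^ 2 * conj c = W * (z₁ * z₂)

/-- The line functional whose zeros are the points of the chord of the unit circle through
`z₁` and `z₂`. -/
def chord (z₁ z₂ w : ℂ) : ℂ := z₁ + z₂ - w - z₁ * z₂ * conj w

lemma Tan.symm {s c W z₁ z₂ : ℂ} (h : Tan s c W z₁ z₂) : Tan s c W z₂ z₁ := by
  unfold Tan at *; linear_combination h

lemma chord_comm (z₁ z₂ w : ℂ) : chord z₁ z₂ w = chord z₂ z₁ w := by unfold chord; ring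

lemma mul_conj_one {z : ℂ} (h : ‖z‖ = 1) : z * conj z = 1 := by
  rw [Complex.mul_conj, Complex.normSq_eq_norm_sq, h]; simp

lemma ne_zero_of_norm_one {z : ℂ} (h : ‖z‖ = 1) : z ≠ 0 := by
  rintro rfl; simp at h

lemma Sym.rot {s c l z₁ z₂ z₃ : ℂ} (h : Sym s c l z₁ z₂ z₃) : Sym s c l z₂ z₃ z₁ :=
  ⟨by linear_combination h.one, by linear_combination h.two, by linear_combination h.three⟩

/-- Poncelet's closure condition, from two tangent chords at a common point. -/
lemma tan_pair {s c W z₁ z₂ z₃ : ℂ} (h₂₃ : z₂ ≠ z₃) (h12 : Tan s c W z₁ z₂)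
    (h13 : Tan s c W z₁ z₃) :
    (1 - conj s * z₁ + conj c * z₁ ^ 2) * (z₂ * z₃) = z₁ ^ 2 - s * z₁ + c ∧
    (1 - conj s * z₁ + conj c * z₁ ^ 2) * (z₂ + z₃) =
      s - 2 * z₁ + conj s * z₁ ^ 2 + W * z₁ := by
  unfold Tan at h12 h13
  have h := sub_ne_zero.2 h₂₃
  -- For fixed `z₁`, tangency is a quadratic equation in the other endpoint; both claims are Vieta's
  -- formulas for its roots `z₂`, `z₃`.
  have e2 : (1 - conj s * z₁ + conj c * z₁ ^ 2) * (z₂ + z₃) =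
      s - 2 * z₁ + conj s * z₁ ^ 2 + W * z₁ :=
    mul_left_cancel₀ h (by linear_combination h12 - h13)
  exact ⟨by linear_combination z₂ * e2 - h12, e2⟩

/-- By `tan_pair`, all three vertices are roots of `X (X² - s X + c) - σ₃ (1 - s̄ X + c̄ X²)`, where
`σ₃` is their product. Subtracting the monic cubic with these roots leaves a quadratic with no
constant term and three distinct zeros. The formula for the sum of two vertices then determines `W`.
-/
lemma sym_of_tan {s c W z₁ z₂ z₃ : ℂ} (n₁ : z₁ ≠ 0)
    (h₁₂ : z₁ ≠ z₂) (h₂₃ : z₂ ≠ z₃) (h₃₁ : z₃ ≠ z₁)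
    (t₁₂ : Tan s c W z₁ z₂) (t₂₃ : Tan s c W z₂ z₃) (t₃₁ : Tan s c W z₃ z₁) :
    Sym s c (z₁ * z₂ * z₃) z₁ z₂ z₃ ∧ W = 1 - s * conj s + c * conj c := by
  obtain ⟨a₁, b₁⟩ := tan_pair h₂₃ t₁₂ t₃₁.symm
  obtain ⟨a₂, -⟩ := tan_pair h₃₁ t₂₃ t₁₂.symm
  obtain ⟨a₃, -⟩ := tan_pair h₁₂ t₃₁ t₂₃.symm
  obtain ⟨h1, h2, -⟩ := quadratic_eq_zero (a := z₁ + z₂ + z₃ - s - z₁ * z₂ * z₃ * conj c)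
    (b := c + z₁ * z₂ * z₃ * conj s - (z₁ * z₂ + z₂ * z₃ + z₃ * z₁))
    (c := 0) h₁₂ h₂₃ h₃₁
    (by linear_combination - z₁ * a₁) (by linear_combination - z₂ * a₂)
    (by linear_combination - z₃ * a₃)
  refine ⟨⟨by linear_combination h1, by linear_combination -h2, rfl⟩, ?_⟩
  apply mul_left_cancel₀ n₁
  linear_combination -b₁ + (1 - conj s * z₁ + conj c * z₁ ^ 2) * h1 + z₁ * conj c * a₁

lemma Sym.tan {s c l z₁ z₂ z₃ : ℂ} (h : Sym s c l z₁ z₂ z₃) :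
    Tan s c (1 - s * conj s + c * conj c) z₁ z₂ := by
  obtain ⟨h1, h2, rfl⟩ := h
  have es : s = z₁ + z₂ + z₃ - z₁ * z₂ * z₃ * conj c := by linear_combination -h1
  have ec : c = z₁ * z₂ + z₂ * z₃ + z₃ * z₁ - z₁ * z₂ * z₃ * conj s := by linear_combination -h2
  unfold Tan
  -- After elimination of `s` and `c` the identity is polynomial with `conj s` and `conj c` as free
  -- variables.
  generalize conj s = s' at *
  generalize conj c = c' at *
  subst es
  subst ec
  ring

/-- Each vertex is a root of the cubic of the fibre: the Blaschke product takes the value `l` there,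
so one vertex determines `l`. -/
lemma Sym.param {s c l z₁ z₂ z₃ : ℂ} (h : Sym s c l z₁ z₂ z₃) :
    l * (1 - conj s * z₁ + conj c * z₁ ^ 2) = z₁ * (z₁ ^ 2 - s * z₁ + c) := by
  linear_combination z₁ * h.two - z₁ ^ 2 * h.one - h.three

lemma norm_blaschke {f z : ℂ} (hf : ‖f‖ < 1) :
    (‖z‖ < 1 → ‖z - f‖ < ‖1 - conj f * z‖) ∧ (1 < ‖z‖ → ‖1 - conj f * z‖ < ‖z - f‖) := by
  have key : ‖1 - conj f * z‖ ^ 2 - ‖z - f‖ ^ 2 = (1 - ‖f‖ ^ 2) * (1 - ‖z‖ ^ 2) := by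
    simp only [← Complex.normSq_eq_norm_sq, Complex.normSq_apply]
    simp
    ring
  have hf2 : 0 < 1 - ‖f‖ ^ 2 := by nlinarith [norm_nonneg f]
  constructor <;> intro hz
  · have : 0 < 1 - ‖z‖ ^ 2 := by nlinarith [norm_nonneg z]
    have := mul_pos hf2 this
    exact lt_of_pow_lt_pow_left₀ 2 (norm_nonneg _) (by linarith)
  · have : 0 < ‖z‖ ^ 2 - 1 := by nlinarith [norm_nonneg z]
    have := mul_pos hf2 this
    exact lt_of_pow_lt_pow_left₀ 2 (norm_nonneg _) (by linarith)

/-- The points mapped to the unit circle by a Blaschke product of degree three lie on the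
unit circle. -/
lemma norm_eq_one_of_blaschke {f g l z : ℂ} (hf : ‖f‖ < 1) (hg : ‖g‖ < 1) (hl : ‖l‖ = 1)
    (h : l * ((1 - conj f * z) * (1 - conj g * z)) = z * ((z - f) * (z - g))) : ‖z‖ = 1 := by
  have hn := congrArg norm h
  simp only [norm_mul, hl, one_mul] at hn
  rcases lt_trichotomy ‖z‖ 1 with hz | hz | hz
  · have h1 := (norm_blaschke hf).1 hz
    have h2 := (norm_blaschke hg).1 hz
    have h3 := mul_lt_mul'' h1 h2 (norm_nonneg _) (norm_nonneg _)
    have := mul_nonneg (norm_nonneg (z - f)) (norm_nonneg (z - g))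
    nlinarith
  · exact hz
  · have h1 := (norm_blaschke hf).2 hz
    have h2 := (norm_blaschke hg).2 hz
    have h3 := mul_lt_mul'' h1 h2 (norm_nonneg _) (norm_nonneg _)
    have := mul_nonneg (norm_nonneg (z - f)) (norm_nonneg (z - g))
    nlinarith

lemma one_sub_conj_mul_ne {f z : ℂ} (hf : ‖f‖ < 1) (hz : ‖z‖ = 1) : 1 - conj f * z ≠ 0 := by
  intro h
  have h1 : conj f * z = 1 := by linear_combination -h
  have := congrArg norm h1
  simp [hz] at this
  linarith

/-- The fibres of a Blaschke product of degree three over the unit circle have no double points. -/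
lemma no_double_root {f g l z y : ℂ} (hf : ‖f‖ < 1) (hg : ‖g‖ < 1) (hz : ‖z‖ = 1)
    (h : Sym (f + g) (f * g) l z z y) : False := by
  have hu := mul_conj_one hz
  have hz0 := ne_zero_of_norm_one hz
  have e0 := h.param
  obtain ⟨h1, h2, h3⟩ := h
  simp only [map_add, map_mul] at *
  have nf := one_sub_conj_mul_ne hf hz
  have ng := one_sub_conj_mul_ne hg hz
  -- derivative of the cubic at the double root
  have e1 : 3 * z ^ 2 - 2 * (f + g + l * (conj f * conj g)) * z +
      (f * g + l * (conj f + conj g)) = 0 := by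
    linear_combination 2 * z * h1 - h2
  -- On the unit circle the logarithmic derivative `z B' / B` of the Blaschke product is `1` plus
  -- two Poisson kernels, hence positive; a double root would make it vanish.
  have key : (1 - conj f * z) * (1 - conj g * z) * ((z - f) * (z - g)) *
      (1 + (1 - f * conj f) / ((z - f) * (conj z - conj f)) +
        (1 - g * conj g) / ((z - g) * (conj z - conj g))) = 0 := by
    have i1 : 1 - conj f * z = z * (conj z - conj f) := by linear_combination -hu
    have i2 : 1 - conj g * z = z * (conj z - conj g) := by linear_combination -hu
    have m1 : conj z - conj f ≠ 0 := fun h => nf (by rw [i1, h, mul_zero])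
    have m2 : conj z - conj g ≠ 0 := fun h => ng (by rw [i2, h, mul_zero])
    have m3 : z - f ≠ 0 := fun h => m1 (by rw [← map_sub, h, map_zero])
    have m4 : z - g ≠ 0 := fun h => m2 (by rw [← map_sub, h, map_zero])
    have k1 : (1 - f * conj f) / ((z - f) * (conj z - conj f)) =
        z / (z - f) + conj f * z / (1 - conj f * z) := by
      rw [i1]; field_simp; linear_combination -hu
    have k2 : (1 - g * conj g) / ((z - g) * (conj z - conj g)) =
        z / (z - g) + conj g * z / (1 - conj g * z) := by
      rw [i2]; field_simp; linear_combination -hu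
    have gen : ∀ a b c d u v w : ℂ, a ≠ 0 → b ≠ 0 → c ≠ 0 → d ≠ 0 →
        a * b * (c * d) * (1 + (w / c + u / a) + (w / d + v / b)) =
          a * b * (c * d) + b * d * (w * a + u * c) + a * c * (w * b + v * d) := by
      intro a b c d u v w ha hb hc hd
      field_simp
    rw [k1, k2, gen _ _ _ _ _ _ _ nf ng m3 m4]
    linear_combination (1 - conj f * z) * (1 - conj g * z) * e1 +
      (-conj f - conj g + 2 * conj f * conj g * z) * e0
  have p1 : ∀ w : ℂ, ‖w‖ < 1 → (1 - w * conj w) / ((z - w) * (conj z - conj w)) =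
      (((1 - ‖w‖ ^ 2) / ‖z - w‖ ^ 2 : ℝ) : ℂ) := by
    intro w _
    rw [← map_sub, Complex.mul_conj, Complex.mul_conj, Complex.normSq_eq_norm_sq,
      Complex.normSq_eq_norm_sq]
    push_cast; ring
  have pos : ∀ w : ℂ, ‖w‖ < 1 → 0 ≤ (1 - ‖w‖ ^ 2) / ‖z - w‖ ^ 2 := by
    intro w hw
    have : 0 < 1 - ‖w‖ ^ 2 := by nlinarith [norm_nonneg w]
    positivity
  have nzf : ∀ w : ℂ, ‖w‖ < 1 → z - w ≠ 0 := by
    intro w hw h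
    rw [sub_eq_zero.1 h] at hz; linarith
  rw [p1 f hf, p1 g hg] at key
  have key2 := (mul_eq_zero.1 key).resolve_left
    (mul_ne_zero (mul_ne_zero nf ng) (mul_ne_zero (nzf f hf) (nzf g hg)))
  have key3 : (1 + (1 - ‖f‖ ^ 2) / ‖z - f‖ ^ 2 + (1 - ‖g‖ ^ 2) / ‖z - g‖ ^ 2 : ℝ) = 0 := by
    exact_mod_cast key2
  linarith [pos f hf, pos g hg]

lemma exists_sq_eq (w : ℂ) : ∃ r : ℂ, r ^ 2 = w := IsAlgClosed.exists_pow_nat_eq w (by norm_num)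

/-- A monic complex cubic has three roots. -/
lemma exists_three_roots (a b c : ℂ) :
    ∃ x y z : ℂ, x + y + z = a ∧ x * y + y * z + z * x = b ∧ x * y * z = c := by
  obtain ⟨x, hx⟩ : ∃ x : ℂ, x ^ 3 - a * x ^ 2 + b * x - c = 0 := by
    have hd : (Cubic.toPoly ⟨(1 : ℂ), -a, b, -c⟩).degree ≠ 0 := by
      rw [Cubic.degree_of_a_ne_zero (by simp)]; decide
    obtain ⟨x, hx⟩ := IsAlgClosed.exists_root _ hd
    refine ⟨x, ?_⟩
    simp [Cubic.toPoly, Polynomial.IsRoot] at hx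
    linear_combination hx
  obtain ⟨r, hr⟩ := exists_sq_eq ((a - x) ^ 2 - 4 * (b - x * (a - x)))
  refine ⟨x, (a - x + r) / 2, (a - x - r) / 2, by ring, ?_, ?_⟩
  · linear_combination -hr / 4
  · linear_combination hx - x * hr / 4

/-- Every unimodular parameter comes from a triple of distinct points of the unit circle. -/
lemma exists_sym {f g l : ℂ} (hf : ‖f‖ < 1) (hg : ‖g‖ < 1) (hl : ‖l‖ = 1) :
    ∃ z₁ z₂ z₃ : ℂ, Sym (f + g) (f * g) l z₁ z₂ z₃ ∧ ‖z₁‖ = 1 ∧ ‖z₂‖ = 1 ∧ ‖z₃‖ = 1 ∧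
      z₁ ≠ z₂ ∧ z₂ ≠ z₃ ∧ z₃ ≠ z₁ := by
  obtain ⟨x, y, z, h1, h2, h3⟩ :=
    exists_three_roots (f + g + l * conj (f * g)) (f * g + l * conj (f + g)) l
  have h : Sym (f + g) (f * g) l x y z := ⟨h1, h2, h3⟩
  have nrm : ∀ {x y z : ℂ}, Sym (f + g) (f * g) l x y z → ‖x‖ = 1 := by
    intro x y z h
    apply norm_eq_one_of_blaschke hf hg hl
    have := h.param
    simp only [map_add, map_mul] at this
    linear_combination this
  have nx := nrm h
  have ny := nrm h.rot
  have nz := nrm h.rot.rot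
  refine ⟨x, y, z, h, nx, ny, nz, ?_, ?_, ?_⟩
  · rintro rfl; exact no_double_root hf hg nx h
  · rintro rfl; exact no_double_root hf hg ny h.rot
  · rintro rfl; exact no_double_root hf hg nz h.rot.rot

/-! ### Inscribed conics and circumcircles in the chart -/

/-- The apolarity form: its value at the pair of foci `w`, `v` of an inscribed conic (in the affine
chart) is determined by the shape of the circles in that chart. -/
def apol (s c w v : ℂ) : ℂ :=
  1 + s * conj s - c * conj c - (conj s * (w + v) + s * (conj w + conj v)) +
    (conj c * (w * v) + c * (conj w * conj v)) + (w * conj v + conj w * v)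

/-- The (squared) normal, up to a scalar, of the image of the chord of the unit circle through
`z₁`, `z₂` under `z ↦ p z + q (conj z)`. -/
def nrm (p q : ℝ) (z₁ z₂ : ℂ) : ℂ := (p - z₁ * z₂ * q) * (z₁ * z₂ * p - q)

/-- Inscribed conics with foci `w`, `v` of the triangle `z₁ z₂ z₃` of the family. -/
lemma inscribed_iff {p q k : ℝ} {s c l z₁ z₂ z₃ w v : ℂ} (h : Sym s c l z₁ z₂ z₃)
    (n₁ : ‖z₁‖ = 1) (n₂ : ‖z₂‖ = 1) (n₃ : ‖z₃‖ = 1)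
    (h₁₂ : z₁ ≠ z₂) (h₂₃ : z₂ ≠ z₃) (h₃₁ : z₃ ≠ z₁) :
    (chord z₂ z₃ w * chord z₂ z₃ v = k * nrm p q z₂ z₃ ∧
      chord z₃ z₁ w * chord z₃ z₁ v = k * nrm p q z₃ z₁ ∧
      chord z₁ z₂ w * chord z₁ z₂ v = k * nrm p q z₁ z₂) ↔
    (w + v - s + l * conj (w * v - c + p * q * k) = 0 ∧
      apol s c w v = k * (p ^ 2 + q ^ 2 - p * q * (c + conj c))) := by
  have hl : ‖l‖ = 1 := by rw [← h.three]; simp [n₁, n₂, n₃]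
  have hl1 := mul_conj_one hl
  have z1 := ne_zero_of_norm_one n₁
  have z2 := ne_zero_of_norm_one n₂
  have z3 := ne_zero_of_norm_one n₃
  have l0 := ne_zero_of_norm_one hl
  have hσ1 := h.one
  have hσ2 := h.two
  have hσ3 := h.three
  simp only [map_add, map_sub, map_mul, Complex.conj_ofReal] at *
  -- the coefficients of the remainder modulo the cubic with roots `z₁`, `z₂`, `z₃`
  set A := w * v + l * (conj w + conj v) + p * q * k - (c + l * conj s) with hA
  set B := -l * (conj v * (s + l * conj c - w) + conj w * (s + l * conj c - v)) -
    k * l * (p ^ 2 + q ^ 2) + l + (c + l * conj s) * (s + l * conj c - w - v) with hB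
  set C := l ^ 2 * (conj w * conj v) + k * l ^ 2 * (p * q) - l * (s + l * conj c - w - v) with hC
  have r : ∀ x y z : ℂ, Sym s c l x y z → x ^ 2 * (chord y z w * chord y z v - k * nrm p q y z) =
      A * x ^ 2 + B * x + C := by
    intro x y z hs
    have s1 : s + l * conj c = x + y + z := by linear_combination -hs.one
    have s2 : c + l * conj s = x * y + y * z + z * x := by linear_combination -hs.two
    rw [hA, hB, hC, s1, s2, ← hs.three]
    unfold chord nrm
    ring
  have e1 := r _ _ _ h
  have e2 := r _ _ _ h.rot
  have e3 := r _ _ _ h.rot.rot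
  have step : (chord z₂ z₃ w * chord z₂ z₃ v = k * nrm p q z₂ z₃ ∧
      chord z₃ z₁ w * chord z₃ z₁ v = k * nrm p q z₃ z₁ ∧
      chord z₁ z₂ w * chord z₁ z₂ v = k * nrm p q z₁ z₂) ↔ (A = 0 ∧ B = 0 ∧ C = 0) := by
    constructor
    · rintro ⟨a, b, d⟩
      exact quadratic_eq_zero h₁₂ h₂₃ h₃₁ (by rw [← e1, a]; ring) (by rw [← e2, b]; ring)
        (by rw [← e3, d]; ring)
    · rintro ⟨a, b, d⟩
      simp only [a, b, d, zero_mul, add_zero, mul_eq_zero, pow_eq_zero_iff (two_ne_zero), z1, z2,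
        z3, false_or, sub_eq_zero] at e1 e2 e3
      exact ⟨e1, e2, e3⟩
  rw [step]
  -- Since `l` is unimodular, `C` is `l` times the first equation and `A` is `l` times its
  -- conjugate, so the three coefficients amount to that equation and `B = 0`.
  have hconj : w + v - s + l * (conj w * conj v - conj c + p * q * k) = 0 →
      conj w + conj v - conj s + conj l * (w * v - c + p * q * k) = 0 := by
    intro hh
    have := congrArg conj hh
    simpa using this
  constructor
  · rintro ⟨-, b, d⟩
    have I : w + v - s + l * (conj w * conj v - conj c + p * q * k) = 0 := by
      apply mul_left_cancel₀ l0
      linear_combination d - hC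
    have I' := hconj I
    refine ⟨I, ?_⟩
    apply mul_left_cancel₀ l0
    unfold apol
    linear_combination b - hB + c * I + (l ^ 2 * conj c) * I' -
      (l * conj c * (w * v - c + p * q * k)) * hl1
  · rintro ⟨I, II⟩
    have I' := hconj I
    unfold apol at II
    refine ⟨?_, ?_, ?_⟩
    · linear_combination hA + l * I' - (w * v - c + p * q * k) * hl1
    · linear_combination hB + l * II - (c * I + (l ^ 2 * conj c) * I' -
      (l * conj c * (w * v - c + p * q * k)) * hl1)
    · linear_combination hC + l * I

/-- The power of `p w + q (conj w)` in the circumcircle of a triangle of the family. -/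
lemma power_formula {p q R : ℝ} {m s c l z₁ z₂ z₃ : ℂ} (h : Sym s c l z₁ z₂ z₃)
    (n₁ : ‖z₁‖ = 1) (n₂ : ‖z₂‖ = 1) (n₃ : ‖z₃‖ = 1)
    (h₁₂ : z₁ ≠ z₂) (h₂₃ : z₂ ≠ z₃) (h₃₁ : z₃ ≠ z₁)
    (c₁ : ‖p * z₁ + q * conj z₁ - m‖ = R) (c₂ : ‖p * z₂ + q * conj z₂ - m‖ = R)
    (c₃ : ‖p * z₃ + q * conj z₃ - m‖ = R) (w : ℂ) :
    ‖p * w + q * conj w - m‖ ^ 2 - R ^ 2 =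
      (p ^ 2 + q ^ 2) * (‖w‖ ^ 2 - 1) + 2 * (p * q) *
        ((w ^ 2 - s * w + c) - l * (conj w + conj c * w - conj s)).re := by
  have hl : ‖l‖ = 1 := by rw [← h.three]; simp [n₁, n₂, n₃]
  have hl1 := mul_conj_one hl
  have l0 := ne_zero_of_norm_one hl
  set k : ℂ := p ^ 2 + q ^ 2 + m * conj m - R ^ 2 with hk
  set μ : ℂ := p * conj m + q * m with hμ
  set μ' : ℂ := p * m + q * conj m with hμ'
  have sq : ∀ {x : ℂ}, (‖x‖ : ℂ) ^ 2 = x * conj x := by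
    intro x; rw [Complex.mul_conj, Complex.normSq_eq_norm_sq]; push_cast; rfl
  -- The points common to a circle and the ellipse satisfy a quartic whose leading and constant
  -- coefficients are both `p q`. Three roots have product `l`, so the fourth should be `conj l`;
  -- subtracting `p q (x - conj l)` times the cubic of the vertices and dividing by `x` leaves this
  -- quadratic.
  have r : ∀ x y z : ℂ, Sym s c l x y z → ‖x‖ = 1 → ‖p * x + q * conj x - m‖ = R →
      (-μ + p * q * (s + l * conj c + conj l)) * x ^ 2 +
        (k - p * q * (c + l * conj s + conj l * (s + l * conj c))) * x +
        (-μ' + p * q * (1 * l + conj l * (c + l * conj s))) = 0 := by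
    intro x y z hs hx hc
    have hx1 := mul_conj_one hx
    have hx0 := ne_zero_of_norm_one hx
    have e : (p * x + q * conj x - m) * (p * conj x + q * x - conj m) = R ^ 2 := by
      rw [← hc, sq]; simp
    apply mul_left_cancel₀ hx0
    have s3 := hs.three
    have e2 : p * q * x ^ 4 - μ * x ^ 3 + k * x ^ 2 - μ' * x + p * q = 0 := by
      linear_combination x ^ 2 * e + (p * q * (-1 - x * conj x) - (p ^ 2 + q ^ 2) * x ^ 2 +
        x * (p * m + q * conj m)) * hx1 + hk * x ^ 2 - hμ * x ^ 3 - hμ' * x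
    have s1 := hs.one
    have s2 := hs.two
    linear_combination e2 + p * q * hl1 - p * q * (x - conj l) *
      (x ^ 2 * s1 - x * s2 + s3)
  obtain ⟨a, b, d⟩ := quadratic_eq_zero h₁₂ h₂₃ h₃₁ (r _ _ _ h n₁ c₁) (r _ _ _ h.rot n₂ c₂)
    (r _ _ _ h.rot.rot n₃ c₃)
  have a' := congrArg conj a
  have key : ((‖p * w + q * conj w - m‖ ^ 2 - R ^ 2 : ℝ) : ℂ) =
      (((p ^ 2 + q ^ 2) * (‖w‖ ^ 2 - 1) + 2 * (p * q) *
        ((w ^ 2 - s * w + c) - l * (conj w + conj c * w - conj s)).re : ℝ) : ℂ) := by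
    push_cast
    rw [sq, sq, Complex.re_eq_add_conj]
    simp only [map_add, map_sub, map_mul, Complex.conj_ofReal, map_pow, Complex.conj_conj,
      map_zero, map_neg, hμ] at *
    linear_combination a * w + a' * conj w + b + (p * q * (conj c)) * hl1
  exact_mod_cast key

/-! ### Recognition of ellipses and hyperbolas from quadratic equations -/

/-- A quadratic polynomial in two real variables. -/
def quad (A B C D E F x y : ℝ) : ℝ :=
  A * x ^ 2 + 2 * B * (x * y) + C * y ^ 2 + 2 * D * x + 2 * E * y + F

lemma exists_unit_mul_sq (w : ℂ) : ∃ u : ℂ, ‖u‖ = 1 ∧ w * u ^ 2 = ‖w‖ := by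
  by_cases hw : w = 0
  · exact ⟨1, by simp, by simp [hw]⟩
  obtain ⟨r, hr⟩ := exists_sq_eq w
  have hr0 : r ≠ 0 := by rintro rfl; exact hw (by rw [← hr]; simp)
  have hn : (‖r‖ : ℂ) ≠ 0 := by simpa using hr0
  refine ⟨conj r / ‖r‖, by simp [hr0], ?_⟩
  have h := Complex.mul_conj r
  rw [Complex.normSq_eq_norm_sq] at h
  push_cast at h
  rw [← hr, norm_pow]
  field_simp
  push_cast
  linear_combination (r * conj r + (‖r‖ : ℂ) ^ 2) * h

/-- The form equals `(A + C) / 2 * |X|² + Re (ζ X²)` with `ζ = (A - C) / 2 - B i`; a rotation that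
makes `ζ u²` equal to `|ζ|` diagonalises it. -/
lemma exists_axes (A B C : ℝ) : ∃ (u : ℂ) (n : ℝ), ‖u‖ = 1 ∧ 0 ≤ n ∧
    n ^ 2 = ((A - C) / 2) ^ 2 + B ^ 2 ∧
    ∀ X : ℂ, A * X.re ^ 2 + 2 * B * (X.re * X.im) + C * X.im ^ 2 =
      ((A + C) / 2 + n) * (conj u * X).re ^ 2 + ((A + C) / 2 - n) * (conj u * X).im ^ 2 := by
  obtain ⟨u, hu, h⟩ := exists_unit_mul_sq ⟨(A - C) / 2, -B⟩
  refine ⟨u, ‖(⟨(A - C) / 2, -B⟩ : ℂ)‖, hu, norm_nonneg _, ?_, fun X => ?_⟩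
  · rw [← Complex.normSq_eq_norm_sq, Complex.normSq_apply]; ring
  · set n := ‖(⟨(A - C) / 2, -B⟩ : ℂ)‖
    have hu1 := mul_conj_one hu
    have hX : X = u * (conj u * X) := by linear_combination -X * hu1
    have h2 : (⟨(A - C) / 2, -B⟩ : ℂ) * X ^ 2 = n * (conj u * X) ^ 2 := by
      rw [← h]; linear_combination (-⟨(A - C) / 2, -B⟩ * X ^ 2 * (1 + u * conj u)) * hu1
    have h3 : X * conj X = (conj u * X) * conj (conj u * X) := by
      simp only [map_mul, Complex.conj_conj]; linear_combination - X * conj X * hu1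
    rw [Complex.mul_conj, Complex.mul_conj] at h3
    have h3' : Complex.normSq X = Complex.normSq (conj u * X) := by exact_mod_cast h3
    have h4 := congrArg Complex.re h2
    generalize conj u * X = Y at *
    simp [Complex.normSq_apply, pow_two] at h3' h4
    linear_combination (A + C) / 2 * h3' + h4

lemma quad_center {A B C D E F : ℝ} (h : A * C - B ^ 2 ≠ 0) : ∃ x₀ y₀ : ℝ,
    A * x₀ + B * y₀ + D = 0 ∧ B * x₀ + C * y₀ + E = 0 ∧
    ∀ x y, quad A B C D E F x y = A * (x - x₀) ^ 2 + 2 * B * ((x - x₀) * (y - y₀)) +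
      C * (y - y₀) ^ 2 + (D * x₀ + E * y₀ + F) := by
  have hi := mul_inv_cancel₀ h
  have h1 : A * ((B * E - C * D) / (A * C - B ^ 2)) + B * ((B * D - A * E) / (A * C - B ^ 2)) + D
      = 0 := by simp only [div_eq_mul_inv]; linear_combination -D * hi
  have h2 : B * ((B * E - C * D) / (A * C - B ^ 2)) + C * ((B * D - A * E) / (A * C - B ^ 2)) + E
      = 0 := by simp only [div_eq_mul_inv]; linear_combination -E * hi
  refine ⟨_, _, h1, h2, fun x y => ?_⟩
  generalize (B * E - C * D) / (A * C - B ^ 2) = x₀ at *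
  generalize (B * D - A * E) / (A * C - B ^ 2) = y₀ at *
  unfold quad
  linear_combination (2 * x - x₀) * h1 + (2 * y - y₀) * h2

/-- The form is definite with the sign of `A`, so a point where `A * quad` is negative forces the
value at the centre to have the opposite sign; this excludes the empty set and a single point. -/
lemma isEllipse_quad {A B C D E F : ℝ} (h : 0 < A * C - B ^ 2)
    (hpt : ∃ x y, A * quad A B C D E F x y < 0) :
    IsEllipse {X | quad A B C D E F X.re X.im = 0} := by
  obtain ⟨x₀, y₀, -, -, hq⟩ := quad_center (D := D) (E := E) (F := F) h.ne'
  set G := D * x₀ + E * y₀ + F with hG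
  have hAG : A * G < 0 := by
    obtain ⟨x, y, hxy⟩ := hpt
    rw [hq] at hxy
    nlinarith [sq_nonneg (A * (x - x₀) + B * (y - y₀)), mul_nonneg h.le (sq_nonneg (y - y₀))]
  have hG0 : G ≠ 0 := by intro h; simp [h] at hAG
  obtain ⟨u, n, hu, hn0, hn, hax⟩ := exists_axes (A / -G) (B / -G) (C / -G)
  have hA1 : 0 < A / -G := by
    have : A / -G = -(A * G) / G ^ 2 := by field_simp
    rw [this]; exact div_pos (by linarith) (by positivity)
  have hdet : 0 < (A / -G) * (C / -G) - (B / -G) ^ 2 := by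
    have : (A / -G) * (C / -G) - (B / -G) ^ 2 = (A * C - B ^ 2) / G ^ 2 := by field_simp
    rw [this]; positivity
  have hC1 : 0 < C / -G := by
    by_contra hc
    nlinarith [sq_nonneg (B / -G)]
  have key : n < (A / -G + C / -G) / 2 := by
    refine lt_of_pow_lt_pow_left₀ 2 (by linarith) ?_
    rw [hn]; nlinarith
  set a₁ := (A / -G + C / -G) / 2 + n with ha₁
  set b₁ := (A / -G + C / -G) / 2 - n with hb₁
  have hb0 : 0 < b₁ := by linarith
  have hab : b₁ ≤ a₁ := by linarith
  have ha0 : 0 < a₁ := by linarith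
  have sa := Real.sq_sqrt ha0.le
  have sb := Real.sq_sqrt hb0.le
  -- The smaller coefficient `b₁` belongs to the imaginary coordinate, so the major axis points
  -- along `u * I`.
  refine ⟨⟨⟨x₀, y₀⟩, u * Complex.I, 1 / √b₁, 1 / √a₁, by simp [hu], by positivity,
    one_div_le_one_div_of_le (by positivity) (Real.sqrt_le_sqrt hab)⟩, ?_⟩
  ext X
  simp only [Set.mem_ofPred_eq, Ellipse.carrier, Ellipse.form, hq]
  have hX := hax (X - ⟨x₀, y₀⟩)
  have e : conj (u * Complex.I) * (X - ⟨x₀, y₀⟩) =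
      -Complex.I * (conj u * (X - ⟨x₀, y₀⟩)) := by simp; ring
  rw [e]
  generalize conj u * (X - ⟨x₀, y₀⟩) = Y at *
  simp only [Complex.sub_re, Complex.sub_im] at hX
  have e2 : ((-Complex.I * Y).re / (1 / √b₁)) ^ 2 + ((-Complex.I * Y).im / (1 / √a₁)) ^ 2 =
      a₁ * Y.re ^ 2 + b₁ * Y.im ^ 2 := by
    simp [mul_pow, sa, sb]; ring
  rw [e2, ← hX]
  constructor
  · intro h; field_simp; linear_combination -h
  · intro h; field_simp at h; linear_combination -h

/-- The hypothesis `hpt` says that the value at the centre is nonzero, which excludes a pair of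
lines. Division by minus that value normalises the equation whatever its sign. -/
lemma isHyperbola_quad {A B C D E F : ℝ} (h : A * C - B ^ 2 < 0)
    (hpt : ∀ x y, A * x + B * y + D = 0 → B * x + C * y + E = 0 → D * x + E * y + F ≠ 0) :
    IsHyperbola {X | quad A B C D E F X.re X.im = 0} := by
  obtain ⟨x₀, y₀, h1, h2, hq⟩ := quad_center (D := D) (E := E) (F := F) h.ne
  have hG0 := hpt _ _ h1 h2
  set G := D * x₀ + E * y₀ + F with hG
  obtain ⟨u, n, hu, hn0, hn, hax⟩ := exists_axes (A / -G) (B / -G) (C / -G)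
  have hdet : (A / -G) * (C / -G) - (B / -G) ^ 2 < 0 := by
    have : (A / -G) * (C / -G) - (B / -G) ^ 2 = (A * C - B ^ 2) / G ^ 2 := by field_simp
    rw [this]; exact div_neg_of_neg_of_pos h (by positivity)
  obtain ⟨k1, k2⟩ : -n < (A / -G + C / -G) / 2 ∧ (A / -G + C / -G) / 2 < n := by
    refine abs_lt_of_sq_lt_sq' ?_ hn0
    rw [hn]; nlinarith
  set a₁ := (A / -G + C / -G) / 2 + n with ha₁
  set b₁ := n - (A / -G + C / -G) / 2 with hb₁
  have hb0 : 0 < b₁ := by linarith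
  have ha0 : 0 < a₁ := by linarith
  have sa := Real.sq_sqrt ha0.le
  have sb := Real.sq_sqrt hb0.le
  refine ⟨⟨x₀, y₀⟩, u, 1 / √a₁, 1 / √b₁, hu, by positivity, by positivity, ?_⟩
  ext X
  simp only [Set.mem_ofPred_eq, hq]
  have hX := hax (X - ⟨x₀, y₀⟩)
  generalize conj u * (X - ⟨x₀, y₀⟩) = Y at *
  simp only [Complex.sub_re, Complex.sub_im] at hX
  have e2 : (Y.re / (1 / √a₁)) ^ 2 - (Y.im / (1 / √b₁)) ^ 2 =
      a₁ * Y.re ^ 2 + (A / -G / 2 + C / -G / 2 - n) * Y.im ^ 2 := by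
    simp [mul_pow, sa, sb]; ring
  rw [e2, show A / -G / 2 + C / -G / 2 - n = (A / -G + C / -G) / 2 - n by ring, ← hX]
  constructor
  · intro h; field_simp; linear_combination -h
  · intro h; field_simp at h; linear_combination -h

lemma IsEllipse.rigid {S : Set ℂ} (h : IsEllipse S) {u : ℂ} (hu : ‖u‖ = 1) (m : ℂ) :
    IsEllipse {X | conj u * (X - m) ∈ S} := by
  obtain ⟨e, rfl⟩ := h
  have hu1 := mul_conj_one hu
  refine ⟨⟨m + u * e.center, u * e.u, e.a, e.b, by simp [hu, e.norm_u], e.b_pos, e.b_le_a⟩, ?_⟩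
  ext X
  simp only [Ellipse.carrier, Ellipse.form, Set.mem_ofPred_eq]
  have : conj (u * e.u) * (X - (m + u * e.center)) =
      conj e.u * (conj u * (X - m) - e.center) := by
    rw [map_mul]; linear_combination (-conj e.u * e.center) * hu1
  rw [this]

lemma IsHyperbola.rigid {S : Set ℂ} (h : IsHyperbola S) {u : ℂ} (hu : ‖u‖ = 1) (m : ℂ) :
    IsHyperbola {X | conj u * (X - m) ∈ S} := by
  obtain ⟨m', u', a, b, hu', ha, hb, rfl⟩ := h
  have hu1 := mul_conj_one hu
  refine ⟨m + u * m', u * u', a, b, by simp [hu, hu'], ha, hb, ?_⟩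
  ext X
  simp only [Set.mem_ofPred_eq]
  have : conj (u * u') * (X - (m + u * m')) = conj u' * (conj u * (X - m) - m') := by
    rw [map_mul]; linear_combination (-conj u' * m') * hu1
  rw [this]

/-- `‖y‖ ^ 2 - ‖L y + d‖ ^ 2` for a real matrix `L` and a vector `d`. -/
def gap (a b c d e f x y : ℝ) : ℝ :=
  x ^ 2 + y ^ 2 - (a * x + b * y + e) ^ 2 - (c * x + d * y + f) ^ 2

/-- The determinant of `1 - Lᵀ L`. -/
def gapDet (a b c d : ℝ) : ℝ :=
  (1 - a ^ 2 - c ^ 2) * (1 - b ^ 2 - d ^ 2) - (a * b + c * d) ^ 2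

lemma gap_eq_quad (a b c d e f : ℝ) {r t : ℝ} (hr : r ≠ 0) (ht : t ≠ 0) (x y : ℝ) :
    gap a b c d e f (x / r) (y / t) =
      quad ((1 - a ^ 2 - c ^ 2) / r ^ 2) (-(a * b + c * d) / (r * t)) ((1 - b ^ 2 - d ^ 2) / t ^ 2)
        (-(a * e + c * f) / r) (-(b * e + d * f) / t) (-(e ^ 2 + f ^ 2)) x y := by
  unfold gap quad
  field_simp
  ring

lemma isEllipse_gap {a b c d e f r t : ℝ} (hr : 0 < r) (ht : 0 < t) (h : 0 < gapDet a b c d)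
    (hd : e ≠ 0 ∨ f ≠ 0) {u : ℂ} (hu : ‖u‖ = 1) (m : ℂ) :
    IsEllipse {X | gap a b c d e f ((conj u * (X - m)).re / r) ((conj u * (X - m)).im / t) = 0} := by
  have hd' : 0 < e ^ 2 + f ^ 2 := by rcases hd with hd | hd <;> positivity
  simp only [gap_eq_quad a b c d e f hr.ne' ht.ne']
  refine IsEllipse.rigid (isEllipse_quad ?_ ?_) hu m
  · have : (1 - a ^ 2 - c ^ 2) / r ^ 2 * ((1 - b ^ 2 - d ^ 2) / t ^ 2) -
        (-(a * b + c * d) / (r * t)) ^ 2 = gapDet a b c d / (r ^ 2 * t ^ 2) := by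
      unfold gapDet; field_simp
    rw [this]; positivity
  · rcases lt_trichotomy (1 - a ^ 2 - c ^ 2) 0 with hA | hA | hA
    -- Here `1 - LᵀL` is negative definite, so a point with positive gap is needed; the solution of
    -- `L y + d = 0` is one, since its gap is `|y|²`.
    · have hdet : a * d - b * c ≠ 0 := by
        intro h0
        unfold gapDet at h
        have hC : 1 - b ^ 2 - d ^ 2 < 0 := by
          by_contra hc
          nlinarith [sq_nonneg (a * b + c * d), mul_nonneg (neg_nonneg.2 hA.le) (not_lt.1 hc)]
        nlinarith [sq_nonneg (a * d - b * c)]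
      set x := (b * f - d * e) / (a * d - b * c) with hx
      set y := (c * e - a * f) / (a * d - b * c) with hy
      have hi := mul_inv_cancel₀ hdet
      have e1 : a * x + b * y + e = 0 := by
        rw [hx, hy]; simp only [div_eq_mul_inv]; linear_combination -e * hi
      have e2 : c * x + d * y + f = 0 := by
        rw [hx, hy]; simp only [div_eq_mul_inv]; linear_combination -f * hi
      refine ⟨r * x, t * y, ?_⟩
      rw [← gap_eq_quad a b c d e f hr.ne' ht.ne', mul_div_cancel_left₀ _ hr.ne',
        mul_div_cancel_left₀ _ ht.ne', gap, e1, e2]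
      have hxy : 0 < x ^ 2 + y ^ 2 := by
        by_contra hc
        have hx0 : x = 0 := by nlinarith [sq_nonneg x, sq_nonneg y]
        have hy0 : y = 0 := by nlinarith [sq_nonneg x, sq_nonneg y]
        rw [hx0, hy0] at e1 e2
        simp at e1 e2
        simp [e1, e2] at hd
      exact mul_neg_of_neg_of_pos (div_neg_of_neg_of_pos hA (by positivity)) (by linarith)
    · unfold gapDet at h; rw [hA] at h; nlinarith [sq_nonneg (a * b + c * d)]
    · refine ⟨0, 0, mul_neg_of_pos_of_neg (by positivity) ?_⟩
      unfold quad; nlinarith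

/-- With `d = (e, f)` and `J` the quarter turn, `hn` says `|J d|² ≠ |Lᵀ J d|²`. If the value at the
centre `y` were zero, `N = L y + d` would satisfy `y = LᵀN`, `N ⟂ d` and `|N| = |LᵀN|`; then `N` is
a multiple of `J d`, so `N = 0`, `y = 0` and `d = 0`. -/
lemma isHyperbola_gap {a b c d e f r t : ℝ} (hr : 0 < r) (ht : 0 < t) (h : gapDet a b c d < 0)
    (hd : e ≠ 0 ∨ f ≠ 0)
    (hn : e ^ 2 + f ^ 2 - (-(a * f) + c * e) ^ 2 - (-(b * f) + d * e) ^ 2 ≠ 0)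
    {u : ℂ} (hu : ‖u‖ = 1) (m : ℂ) :
    IsHyperbola
      {X | gap a b c d e f ((conj u * (X - m)).re / r) ((conj u * (X - m)).im / t) = 0} := by
  simp only [gap_eq_quad a b c d e f hr.ne' ht.ne']
  refine IsHyperbola.rigid (isHyperbola_quad ?_ ?_) hu m
  · have : (1 - a ^ 2 - c ^ 2) / r ^ 2 * ((1 - b ^ 2 - d ^ 2) / t ^ 2) -
        (-(a * b + c * d) / (r * t)) ^ 2 = gapDet a b c d / (r ^ 2 * t ^ 2) := by
      unfold gapDet; field_simp
    rw [this]; exact div_neg_of_neg_of_pos h (by positivity)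
  · intro x y h1 h2 h3
    obtain ⟨x, rfl⟩ : ∃ x', x = r * x' := ⟨x / r, by field_simp⟩
    obtain ⟨y, rfl⟩ : ∃ y', y = t * y' := ⟨y / t, by field_simp⟩
    field_simp at h1 h2 h3
    set Y := a * x + b * y + e with hY
    set Z := c * x + d * y + f with hZ
    have g1 : x = a * Y + c * Z := by rw [hY, hZ]; linear_combination h1
    have g2 : y = b * Y + d * Z := by rw [hY, hZ]; linear_combination h2
    have g3 : e * Y + f * Z = 0 := by rw [hY, hZ]; linear_combination -h3
    have g4 : Y ^ 2 + Z ^ 2 - (a * Y + c * Z) ^ 2 - (b * Y + d * Z) ^ 2 = 0 := by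
      rw [← g1, ← g2]; linear_combination g3 + Y * hY + Z * hZ - x * g1 - y * g2
    have e1 : (e ^ 2 + f ^ 2) * Y = -(f * (e * Z - f * Y)) := by linear_combination e * g3
    have e2 : (e ^ 2 + f ^ 2) * Z = e * (e * Z - f * Y) := by linear_combination f * g3
    have hd' : 0 < e ^ 2 + f ^ 2 := by rcases hd with hd | hd <;> positivity
    have e3 : (e * Z - f * Y) ^ 2 *
        (e ^ 2 + f ^ 2 - (-(a * f) + c * e) ^ 2 - (-(b * f) + d * e) ^ 2) = 0 := by
      have : (e ^ 2 + f ^ 2) ^ 2 * (Y ^ 2 + Z ^ 2 - (a * Y + c * Z) ^ 2 - (b * Y + d * Z) ^ 2) =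
          (e * Z - f * Y) ^ 2 *
            (e ^ 2 + f ^ 2 - (-(a * f) + c * e) ^ 2 - (-(b * f) + d * e) ^ 2) := by
        calc _ = ((e ^ 2 + f ^ 2) * Y) ^ 2 + ((e ^ 2 + f ^ 2) * Z) ^ 2 -
              (a * ((e ^ 2 + f ^ 2) * Y) + c * ((e ^ 2 + f ^ 2) * Z)) ^ 2 -
              (b * ((e ^ 2 + f ^ 2) * Y) + d * ((e ^ 2 + f ^ 2) * Z)) ^ 2 := by ring
          _ = _ := by rw [e1, e2]; ring
      rw [← this, g4, mul_zero]
    have e4 : e * Z - f * Y = 0 := by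
      rcases mul_eq_zero.1 e3 with h | h
      · exact pow_eq_zero_iff two_ne_zero |>.1 h
      · exact absurd h hn
    rw [e4] at e1 e2
    have y0 : Y = 0 := (mul_eq_zero.1 (by linarith : (e ^ 2 + f ^ 2) * Y = 0)).resolve_left hd'.ne'
    have z0 : Z = 0 := (mul_eq_zero.1 (by linarith : (e ^ 2 + f ^ 2) * Z = 0)).resolve_left hd'.ne'
    rw [y0, z0] at g1 g2
    have gx : x = 0 := by linarith
    have gy : y = 0 := by linarith
    rw [y0, gx, gy] at hY
    rw [z0, gx, gy] at hZ
    rcases hd with hd | hd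
    · exact hd (by linarith)
    · exact hd (by linarith)

/-! ### The equation of the locus and its discriminant -/

/-- By `power_formula`, the power of the point in the circumcircle with parameter `l` is `alpha - 2
p q Re (l beta)`. -/
def alpha (p q : ℝ) (s c w : ℂ) : ℝ :=
  (p ^ 2 + q ^ 2) * (‖w‖ ^ 2 - 1) + 2 * (p * q) * (w ^ 2 - s * w + c).re

def beta (s c w : ℂ) : ℂ := conj w + conj c * w - conj s

def den (p q : ℝ) (c : ℂ) : ℝ := p ^ 2 + q ^ 2 - 2 * (p * q) * c.re

/-- The value of `k` forced by the second equation of `inscribed_iff`; it is independent of `l` and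
real-affine in `v`. -/
def kap (p q : ℝ) (s c w v : ℂ) : ℝ := (apol s c w v).re / den p q c

/-- The value at `v = s - w` of `w v - c + p q (kap v)`; it vanishes when `w` is the preimage of a
focus of the inner ellipse. -/
def off (p q : ℝ) (s c w : ℂ) : ℂ := w * (s - w) - c + p * q * kap p q s c w (s - w)

lemma den_pos {p q : ℝ} {c : ℂ} (hq : 0 ≤ q) (hpq : q < p) (hc : ‖c‖ < 1) : 0 < den p q c := by
  have h1 := (Complex.abs_re_le_norm c).trans_lt hc
  have h2 := (abs_lt.1 h1).2
  unfold den
  nlinarith [mul_nonneg (hq.trans hpq.le) hq, sq_pos_of_pos (sub_pos.2 hpq)]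

lemma apol_real (s c w v : ℂ) : ((apol s c w v).re : ℂ) = apol s c w v := by
  have : conj (apol s c w v) = apol s c w v := by
    unfold apol; simp; ring
  exact Complex.conj_eq_iff_re.1 this

lemma apol_eq_iff {p q k : ℝ} {s c w v : ℂ} (hM : den p q c ≠ 0) :
    apol s c w v = k * (p ^ 2 + q ^ 2 - p * q * (c + conj c)) ↔ k = kap p q s c w v := by
  have e : ((p : ℂ) ^ 2 + q ^ 2 - p * q * (c + conj c)) = (den p q c : ℂ) := by
    unfold den; push_cast; rw [Complex.re_eq_add_conj]; ring
  rw [e, ← apol_real, kap, eq_div_iff hM]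
  norm_cast
  exact eq_comm

/-- The entries of the real matrix `L` attached to the locus. -/
def entA (p q : ℝ) (s c w : ℂ) : ℝ := w.re + 2 * (p * q) / den p q c * (beta s c w).re
def entB (p q : ℝ) (s c w : ℂ) : ℝ := -w.im - 2 * (p * q) / den p q c * (beta s c w).im

/-- Put `y = v - (s - w)`. The left-hand quantity is `y` itself, and the right-hand one is
real-affine in `y`, with constant term `off` and linear part `L` whose rows are `(entA, entB)` and
`(im w, re w)`. -/
lemma conic_iff {p q : ℝ} {s c w v : ℂ} (hM : den p q c ≠ 0) :
    ‖w + v - s‖ = ‖w * v - c + p * q * kap p q s c w v‖ ↔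
      gap (entA p q s c w) (entB p q s c w) w.im w.re (off p q s c w).re (off p q s c w).im
        (v - (s - w)).re (v - (s - w)).im = 0 := by
  have hN : w * v - c + p * q * kap p q s c w v =
      ⟨entA p q s c w * (v - (s - w)).re + entB p q s c w * (v - (s - w)).im +
          (off p q s c w).re,
        w.im * (v - (s - w)).re + w.re * (v - (s - w)).im + (off p q s c w).im⟩ := by
    apply Complex.ext
    · simp [entA, entB, off, kap, beta, apol]
      field_simp
      ring
    · simp [off, kap]
      ring
  rw [← sq_eq_sq₀ (norm_nonneg _) (norm_nonneg _), ← Complex.normSq_eq_norm_sq,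
    ← Complex.normSq_eq_norm_sq, hN, Complex.normSq_apply, Complex.normSq_mk]
  unfold gap
  rw [← sub_eq_zero]
  simp
  constructor <;> intro h <;> linear_combination h

/-- `L` is multiplication by `w` plus the rank-one map `y ↦ h Re (β y)` with `h = 2 p q / den`.
Hence `det (1 - LᵀL) = (1 - |w|² - h Re (w̄ β))² - h² |β|²`, and `den` times the bracket is
`-alpha`. -/
lemma gapDet_ent {p q : ℝ} {s c w : ℂ} (hM : den p q c ≠ 0) :
    den p q c ^ 2 * gapDet (entA p q s c w) (entB p q s c w) w.im w.re =
      alpha p q s c w ^ 2 - (2 * (p * q)) ^ 2 * ‖beta s c w‖ ^ 2 := by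
  have e : ∃ h : ℝ, h * den p q c = 2 * (p * q) ∧ entA p q s c w = w.re + h * (beta s c w).re ∧
      entB p q s c w = -w.im - h * (beta s c w).im :=
    ⟨2 * (p * q) / den p q c, by field_simp, rfl, rfl⟩
  obtain ⟨h, hh, hA, hB⟩ := e
  have key : den p q c * (1 - ‖w‖ ^ 2 - h * (conj w * beta s c w).re) = -alpha p q s c w := by
    rw [mul_sub, mul_comm (den p q c) (h * _), mul_right_comm h, hh]
    unfold alpha den beta
    rw [← Complex.normSq_eq_norm_sq, Complex.normSq_apply]
    simp [pow_two]
    ring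
  have k2 : alpha p q s c w ^ 2 = (den p q c * (1 - ‖w‖ ^ 2 - h * (conj w * beta s c w).re)) ^ 2 := by
    rw [key]; ring
  rw [k2, ← hh, hA, hB, ← Complex.normSq_eq_norm_sq, ← Complex.normSq_eq_norm_sq,
    Complex.normSq_apply, Complex.normSq_apply]
  unfold gapDet
  simp only [Complex.mul_re, Complex.conj_re, Complex.conj_im]
  ring

lemma gap_nondeg {p q : ℝ} {s c w : ℂ} (hq : 0 ≤ q) (hpq : q < p) (hc : ‖c‖ < 1)
    (hw : ‖w‖ ≠ 1) (hd : off p q s c w ≠ 0) :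
    (off p q s c w).re ^ 2 + (off p q s c w).im ^ 2 -
      (-(entA p q s c w * (off p q s c w).im) + w.im * (off p q s c w).re) ^ 2 -
      (-(entB p q s c w * (off p q s c w).im) + w.re * (off p q s c w).re) ^ 2 ≠ 0 := by
  have hM := den_pos hq hpq hc
  intro h0
  have hm : 1 - ‖w‖ ^ 2 ≠ 0 := by
    intro h
    apply hw
    nlinarith [norm_nonneg w]
  have e : ∃ h : ℝ, h * den p q c = p * q ∧ entA p q s c w = w.re + 2 * h * (beta s c w).re ∧
      entB p q s c w = -w.im - 2 * h * (beta s c w).im ∧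
      (off p q s c w).re = (w * (s - w) - c).re + h * (apol s c w (s - w)).re := by
    refine ⟨p * q / den p q c, by field_simp, ?_, ?_, ?_⟩
    · unfold entA; ring
    · unfold entB; ring
    · simp [off, kap]; ring
  obtain ⟨h, hh, hA, hB, hre⟩ := e
  have him : (off p q s c w).im = (w * (s - w) - c).im := by simp [off]
  -- Up to the factor `den²`, the quantity to be shown nonzero is `1 - |w|²` times a sum of two
  -- squares. As `q < p`, its vanishing kills first the imaginary and then the real part of `off`.
  have key : (1 - ‖w‖ ^ 2) * ((den p q c * (w * (s - w) - c).re + h * den p q c *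
        (apol s c w (s - w)).re + 2 * (h * den p q c) * c.im * (w * (s - w) - c).im * (-1)) ^ 2 +
      (w * (s - w) - c).im ^ 2 * (p ^ 2 - q ^ 2) ^ 2) = 0 := by
    have hden : den p q c + 2 * (h * den p q c) * c.re = p ^ 2 + q ^ 2 := by
      rw [hh]; unfold den; ring
    have hpq2 : (p ^ 2 - q ^ 2) ^ 2 = (den p q c + 2 * (h * den p q c) * c.re) ^ 2 -
        4 * (h * den p q c) ^ 2 := by
      rw [hden, hh]; ring
    rw [hpq2]
    rw [hA, hB, him, hre] at h0
    generalize den p q c = M at *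
    rw [← Complex.normSq_eq_norm_sq, Complex.normSq_apply]
    simp [beta, apol, -mul_eq_zero] at h0 ⊢
    linear_combination M ^ 2 * h0
  rcases mul_eq_zero.1 key with h | h
  · exact hm h
  have hpos : 0 < (p ^ 2 - q ^ 2) ^ 2 := by
    have : 0 < p ^ 2 - q ^ 2 := by nlinarith
    positivity
  have hy : (w * (s - w) - c).im = 0 := by
    by_contra hy
    have : 0 < (w * (s - w) - c).im ^ 2 := by positivity
    nlinarith [mul_pos this hpos]
  rw [hy] at h
  simp only [mul_zero, zero_mul, add_zero, ne_eq, OfNat.ofNat_ne_zero, not_false_eq_true,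
    pow_eq_zero_iff, zero_pow] at h
  apply hd
  apply Complex.ext
  · rw [hre]
    apply mul_left_cancel₀ hM.ne'
    simp only [Complex.zero_re, mul_zero]
    linear_combination h
  · rw [him, hy]; rfl

/-! ### The affine chart of an ellipse, its chords and tangent lines -/

lemma mem_line_iff {X Y Z : ℂ} : Z ∈ line[ℝ, X, Y] ↔ ∃ t : ℝ, Z = X + t * (Y - X) := by
  rw [← AffineSubspace.vsub_right_mem_direction_iff_mem (left_mem_affineSpan_pair ℝ X Y),
    direction_affineSpan, mem_vectorSpan_pair_rev]
  simp only [vsub_eq_sub, Complex.real_smul]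
  exact exists_congr fun t => ⟨fun h => by rw [h]; ring, fun h => by rw [h]; ring⟩

namespace Ellipse

variable (e : Ellipse)

lemma a_pos : 0 < e.a := e.b_pos.trans_le e.b_le_a

/-- Chosen so that `a x + i b y = p z + q z̄` for `z = x + i y`. -/
def p : ℝ := (e.a + e.b) / 2
def q : ℝ := (e.a - e.b) / 2

lemma q_nonneg : 0 ≤ e.q := by have := e.b_le_a; unfold q; linarith
lemma q_lt_p : e.q < e.p := by have := e.b_pos; unfold p q; linarith

/-- The affine map that sends the unit circle to the ellipse. -/
def pt (z : ℂ) : ℂ := e.center + e.u * (e.p * z + e.q * conj z)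

/-- The inverse of `pt`. -/
def co (X : ℂ) : ℂ :=
  ⟨(conj e.u * (X - e.center)).re / e.a, (conj e.u * (X - e.center)).im / e.b⟩

lemma pq_mk (z : ℂ) : e.p * z + e.q * conj z = ⟨e.a * z.re, e.b * z.im⟩ := by
  apply Complex.ext <;> simp [p, q] <;> ring

lemma pt_co (X : ℂ) : e.pt (e.co X) = X := by
  have ha := e.a_pos.ne'
  have hb := e.b_pos.ne'
  rw [pt, pq_mk]
  simp only [co, mul_div_cancel₀ _ ha, mul_div_cancel₀ _ hb, Complex.eta]
  linear_combination (X - e.center) * mul_conj_one e.norm_u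

lemma co_pt (z : ℂ) : e.co (e.pt z) = z := by
  have ha := e.a_pos.ne'
  have hb := e.b_pos.ne'
  have h : conj e.u * (e.pt z - e.center) = ⟨e.a * z.re, e.b * z.im⟩ := by
    rw [pt, pq_mk]
    linear_combination (⟨e.a * z.re, e.b * z.im⟩ : ℂ) * mul_conj_one e.norm_u
  rw [co, h]
  apply Complex.ext <;> simp <;> field_simp

lemma pt_injective : Function.Injective e.pt := Function.LeftInverse.injective e.co_pt
lemma co_injective : Function.Injective e.co := Function.LeftInverse.injective e.pt_co

lemma form_eq (X : ℂ) : e.form X = ‖e.co X‖ ^ 2 := by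
  rw [← Complex.normSq_eq_norm_sq, Complex.normSq_apply, form, co]; ring

lemma mem_carrier_iff {X : ℂ} : X ∈ e.carrier ↔ ‖e.co X‖ = 1 := by
  rw [carrier, Set.mem_ofPred_eq, form_eq]
  constructor
  · intro h; nlinarith [norm_nonneg (e.co X)]
  · intro h; rw [h]; norm_num

lemma pt_mem_carrier {z : ℂ} : e.pt z ∈ e.carrier ↔ ‖z‖ = 1 := by rw [mem_carrier_iff, co_pt]

lemma pt_line (z w : ℂ) (t : ℝ) :
    e.pt (z + t * (w - z)) = e.pt z + t * (e.pt w - e.pt z) := by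
  simp [pt]; ring

lemma pt_mem_line {z₁ z₂ w : ℂ} :
    e.pt w ∈ line[ℝ, e.pt z₁, e.pt z₂] ↔ ∃ t : ℝ, w = z₁ + t * (z₂ - z₁) := by
  rw [mem_line_iff]
  exact exists_congr fun t => by rw [← pt_line, e.pt_injective.eq_iff]

end Ellipse

lemma chord_eq_zero_iff {z₁ z₂ w : ℂ} (n₁ : ‖z₁‖ = 1) (n₂ : ‖z₂‖ = 1) (h : z₁ ≠ z₂) :
    (∃ t : ℝ, w = z₁ + t * (z₂ - z₁)) ↔ chord z₁ z₂ w = 0 := by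
  have u1 := mul_conj_one n₁
  have u2 := mul_conj_one n₂
  constructor
  · rintro ⟨t, rfl⟩
    simp only [chord, map_add, map_mul, map_sub, Complex.conj_ofReal]
    linear_combination (z₂ * (t - 1)) * u1 - (z₁ * t) * u2
  · intro hc
    unfold chord at hc
    have h0 : z₂ - z₁ ≠ 0 := sub_ne_zero.2 h.symm
    have h0' : conj (z₂ - z₁) ≠ 0 := (map_ne_zero _).2 h0
    have hr : conj ((w - z₁) / (z₂ - z₁)) = (w - z₁) / (z₂ - z₁) := by
      rw [map_div₀, div_eq_div_iff h0' h0]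
      simp only [map_sub] at *
      apply mul_left_cancel₀ (mul_ne_zero (ne_zero_of_norm_one n₁) (ne_zero_of_norm_one n₂))
      linear_combination (-(z₂ - z₁)) * hc - (z₂ * (z₂ - w)) * u1 + (z₁ * (z₁ - w)) * u2
    obtain ⟨t, ht⟩ := Complex.conj_eq_iff_real.1 hr
    refine ⟨t, ?_⟩
    rw [← ht]; field_simp; ring

lemma Ellipse.pt_mem_chord (e : Ellipse) {z₁ z₂ w : ℂ} (n₁ : ‖z₁‖ = 1) (n₂ : ‖z₂‖ = 1)
    (h : z₁ ≠ z₂) : e.pt w ∈ line[ℝ, e.pt z₁, e.pt z₂] ↔ chord z₁ z₂ w = 0 := by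
  rw [e.pt_mem_line, chord_eq_zero_iff n₁ n₂ h]

lemma existsUnique_quadratic_iff {α β δ : ℝ} (hα : 0 < α) :
    (∃! t : ℝ, α * t ^ 2 + 2 * β * t + δ = 0) ↔ β ^ 2 = α * δ := by
  constructor
  · rintro ⟨t, ht, hu⟩
    simp only at ht hu
    have h1 := hu (-2 * β / α - t) (by
      have hi := mul_inv_cancel₀ hα.ne'
      simp only [div_eq_mul_inv]
      linear_combination ht + (4 * β ^ 2 * α⁻¹ + 4 * β * t) * hi)
    have h2 : t = -β / α := by linear_combination -h1 / 2
    rw [h2] at ht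
    field_simp at ht
    linarith
  · intro h
    refine ⟨-β / α, by field_simp; linarith, fun t ht => ?_⟩
    have : (α * t + β) ^ 2 = 0 := by linear_combination α * ht + h
    have := pow_eq_zero_iff two_ne_zero |>.1 this
    field_simp; linarith

lemma finrank_direction_line {X Y : ℂ} (h : X ≠ Y) :
    Module.finrank ℝ (line[ℝ, X, Y]).direction = 1 := by
  rw [direction_affineSpan, vectorSpan_pair_rev]
  exact finrank_span_singleton (by simpa [sub_eq_zero] using h.symm)

/-- In the chart the ellipse is the unit circle, and `|Im (x̄ y)| / |x - y|` is the distance from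
the origin to the line. -/
lemma Ellipse.isTangentLine_iff (e : Ellipse) {x y : ℂ} (h : x ≠ y) :
    e.IsTangentLine line[ℝ, e.pt x, e.pt y] ↔ (conj x * y).im ^ 2 = ‖x - y‖ ^ 2 := by
  have hX : e.pt x ≠ e.pt y := fun h' => h (e.pt_injective h')
  have hα : 0 < ‖x - y‖ ^ 2 := by
    have := norm_pos_iff.2 (sub_ne_zero.2 h); positivity
  have e1 : ∀ t : ℝ, (e.pt (x + t * (y - x)) ∈ e.carrier ↔
      ‖x - y‖ ^ 2 * t ^ 2 + 2 * (conj x * (y - x)).re * t + (‖x‖ ^ 2 - 1) = 0) := by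
    intro t
    rw [pt_mem_carrier, ← sq_eq_sq₀ (norm_nonneg _) zero_le_one]
    simp only [← Complex.normSq_eq_norm_sq, Complex.normSq_apply]
    simp
    constructor <;> intro h <;> linear_combination h
  unfold IsTangentLine
  simp only [finrank_direction_line hX, true_and]
  have e2 : (∃ X, (line[ℝ, e.pt x, e.pt y] : Set ℂ) ∩ e.carrier = {X}) ↔
      ∃! t : ℝ, ‖x - y‖ ^ 2 * t ^ 2 + 2 * (conj x * (y - x)).re * t + (‖x‖ ^ 2 - 1) = 0 := by
    have inj : ∀ {t t' : ℝ}, e.pt (x + t * (y - x)) = e.pt (x + t' * (y - x)) → t = t' := by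
      intro t t' h'
      have := e.pt_injective h'
      have := mul_right_cancel₀ (sub_ne_zero.2 h.symm) (add_left_cancel this)
      exact_mod_cast this
    constructor
    · rintro ⟨X, hX⟩
      obtain ⟨hl, hc⟩ : X ∈ (line[ℝ, e.pt x, e.pt y] : Set ℂ) ∩ e.carrier := by rw [hX]; rfl
      obtain ⟨w, rfl⟩ : ∃ w, X = e.pt w := ⟨_, (e.pt_co X).symm⟩
      obtain ⟨t, rfl⟩ := (e.pt_mem_line).1 hl
      refine ⟨t, (e1 t).1 hc, fun t' ht' => inj ?_⟩
      have : e.pt (x + t' * (y - x)) ∈ (line[ℝ, e.pt x, e.pt y] : Set ℂ) ∩ e.carrier :=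
        ⟨(e.pt_mem_line).2 ⟨t', rfl⟩, (e1 t').2 ht'⟩
      rw [hX] at this; exact this
    · rintro ⟨t, ht, hu⟩
      refine ⟨e.pt (x + t * (y - x)), ?_⟩
      ext X
      constructor
      · rintro ⟨hl, hc⟩
        obtain ⟨w, rfl⟩ : ∃ w, X = e.pt w := ⟨_, (e.pt_co X).symm⟩
        obtain ⟨t', rfl⟩ := (e.pt_mem_line).1 hl
        rw [hu t' ((e1 t').1 hc)]; rfl
      · rintro rfl
        exact ⟨(e.pt_mem_line).2 ⟨t, rfl⟩, (e1 t).2 ht⟩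
  rw [e2, existsUnique_quadratic_iff hα]
  simp only [← Complex.normSq_eq_norm_sq, Complex.normSq_apply]
  simp
  constructor <;> intro h <;> linear_combination -h

/-! ### The inner ellipse in the chart of the outer one -/

section Pullback

variable (E Ec : Ellipse)

/-- The unit vector of the axis of `Ec` in the frame of `E`. -/
def rel : ℂ := conj E.u * Ec.u

/-- The inner ellipse in the affine chart in which `E` is the unit circle is the curve
`pullO + pullA x + pullB (conj x)`, `‖x‖ = 1`. -/
def pullO : ℂ := E.co Ec.center
def pullA : ℂ := (E.p * Ec.p * rel E Ec - E.q * Ec.q * conj (rel E Ec)) / (E.p ^ 2 - E.q ^ 2)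
def pullB : ℂ := (E.p * Ec.q * rel E Ec - E.q * Ec.p * conj (rel E Ec)) / (E.p ^ 2 - E.q ^ 2)

lemma Ellipse.sq_sub_sq_ne (e : Ellipse) : (e.p : ℂ) ^ 2 - e.q ^ 2 ≠ 0 := by
  have h : 0 < e.p ^ 2 - e.q ^ 2 := by nlinarith [e.q_nonneg, e.q_lt_p]
  exact_mod_cast h.ne'

lemma pull_rel_A : E.p * pullA E Ec + E.q * conj (pullB E Ec) = rel E Ec * Ec.p := by
  have := E.sq_sub_sq_ne
  simp only [pullA, pullB, map_div₀, map_sub, map_mul, map_pow, Complex.conj_ofReal,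
    Complex.conj_conj]
  field_simp; ring

lemma pull_rel_B : E.p * pullB E Ec + E.q * conj (pullA E Ec) = rel E Ec * Ec.q := by
  have := E.sq_sub_sq_ne
  simp only [pullA, pullB, map_div₀, map_sub, map_mul, map_pow, Complex.conj_ofReal,
    Complex.conj_conj]
  field_simp; ring

lemma norm_rel : ‖rel E Ec‖ = 1 := by simp [rel, E.norm_u, Ec.norm_u]

lemma u_mul_rel : E.u * rel E Ec = Ec.u := by
  unfold rel; linear_combination Ec.u * mul_conj_one E.norm_u

lemma pt_pull (x : ℂ) :
    E.pt (pullO E Ec + pullA E Ec * x + pullB E Ec * conj x) = Ec.pt x := by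
  have h0 := E.pt_co Ec.center
  change E.pt (pullO E Ec) = _ at h0
  have h1 := pull_rel_A E Ec
  have h2 := pull_rel_B E Ec
  have h3 := u_mul_rel E Ec
  unfold Ellipse.pt at *
  simp only [map_add, map_mul, Complex.conj_conj]
  linear_combination h0 + E.u * x * h1 + E.u * conj x * h2 + (Ec.p * x + Ec.q * conj x) * h3

lemma co_pt_pull (z : ℂ) :
    z = pullO E Ec + pullA E Ec * Ec.co (E.pt z) + pullB E Ec * conj (Ec.co (E.pt z)) := by
  apply E.pt_injective
  rw [pt_pull, Ec.pt_co]

lemma pull_jac_pos :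
    pullA E Ec * conj (pullA E Ec) - pullB E Ec * conj (pullB E Ec) ≠ 0 := by
  have h1 := E.sq_sub_sq_ne
  have h2 := Ec.sq_sub_sq_ne
  have hu := mul_conj_one (norm_rel E Ec)
  have : pullA E Ec * conj (pullA E Ec) - pullB E Ec * conj (pullB E Ec) =
      (Ec.p ^ 2 - Ec.q ^ 2) / (E.p ^ 2 - E.q ^ 2) := by
    simp only [pullA, pullB, map_div₀, map_sub, map_mul, map_pow, Complex.conj_ofReal,
      Complex.conj_conj]
    field_simp
    linear_combination (E.p ^ 2 - E.q ^ 2) * (Ec.p ^ 2 - Ec.q ^ 2) * hu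
  rw [this]
  exact div_ne_zero h2 h1

/-- The foci of the conic `o + m x + n x̄` are `o ± 2 √(m n)`; `parS` and `parC` are their sum and
product, and `parW` is the remaining coefficient of the tangency condition `Tan`. -/
def parS : ℂ := 2 * pullO E Ec
def parC : ℂ := pullO E Ec ^ 2 - 4 * (pullA E Ec * pullB E Ec)
def parW : ℂ := 4 * (pullA E Ec * conj (pullA E Ec) + pullB E Ec * conj (pullB E Ec)) -
  2 * (pullO E Ec * conj (pullO E Ec))

/-- Tangency is tested in the chart of `Ec`, where `Ec` is the unit circle. Up to the Jacobian `J`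
and the factor `z₁ - z₂`, the condition transfers to `(chord z₁ z₂ o)² = 4 (m̄ z₁ z₂ + n) (n̄ z₁ z₂
+ m)`, which expands to `Tan`. -/
lemma isTangentLine_chord {z₁ z₂ : ℂ} (n₁ : ‖z₁‖ = 1) (n₂ : ‖z₂‖ = 1) (h : z₁ ≠ z₂) :
    Ec.IsTangentLine line[ℝ, E.pt z₁, E.pt z₂] ↔
      Tan (parS E Ec) (parC E Ec) (parW E Ec) z₁ z₂ := by
  have hx : Ec.co (E.pt z₁) ≠ Ec.co (E.pt z₂) :=
    fun h' => h (E.pt_injective (Ec.co_injective h'))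
  have hT := Ec.isTangentLine_iff hx
  rw [Ec.pt_co, Ec.pt_co] at hT
  rw [hT]
  have k1 := co_pt_pull E Ec z₁
  have k2 := co_pt_pull E Ec z₂
  have hJ := pull_jac_pos E Ec
  have u1 := mul_conj_one n₁
  have u2 := mul_conj_one n₂
  have z1 := ne_zero_of_norm_one n₁
  have z2 := ne_zero_of_norm_one n₂
  have hd := sub_ne_zero.2 h
  unfold Tan parS parC parW
  generalize Ec.co (E.pt z₁) = x₁ at *
  generalize Ec.co (E.pt z₂) = x₂ at *
  generalize pullO E Ec = o at *
  generalize pullA E Ec = m at *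
  generalize pullB E Ec = n at *
  have k1' := congrArg conj k1
  have k2' := congrArg conj k2
  simp only [map_add, map_sub, map_mul, map_pow, Complex.conj_conj, Complex.conj_ofNat] at *
  set J := m * conj m - n * conj n with hJdef
  have d1 : J * (x₁ - x₂) * (z₁ * z₂) = (z₁ - z₂) * (conj m * (z₁ * z₂) + n) := by
    linear_combination (-conj m * (z₁ * z₂)) * (k1 - k2) + (n * z₁ * z₂) * (k1' - k2') -
      (n * z₂) * u1 + (n * z₁) * u2
  have d2 : J * (conj x₁ - conj x₂) * (z₁ * z₂) = -(z₁ - z₂) * (conj n * (z₁ * z₂) + m) := by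
    linear_combination (-m * (z₁ * z₂)) * (k1' - k2') + (conj n * z₁ * z₂) * (k1 - k2) +
      (m * z₂) * u1 - (m * z₁) * u2
  have d3 : J * (conj x₁ * x₂ - x₁ * conj x₂) * (z₁ * z₂) =
      (z₂ - z₁) * (z₁ + z₂ - o - z₁ * z₂ * conj o) := by
    have a1 : J * (conj x₁ * x₂ - x₁ * conj x₂) =
        (conj z₁ - conj o) * (z₂ - o) - (z₁ - o) * (conj z₂ - conj o) := by
      rw [k1, k2]
      simp only [map_add, map_mul, Complex.conj_conj]
      ring
    rw [a1]
    linear_combination (z₂ * (z₂ - o)) * u1 - (z₁ * (z₁ - o)) * u2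
  have r1 : ((conj x₁ * x₂).im : ℂ) = (conj x₁ * x₂ - x₁ * conj x₂) / (2 * Complex.I) := by
    rw [Complex.im_eq_sub_conj]; simp
  have r2 : ((‖x₁ - x₂‖ ^ 2 : ℝ) : ℂ) = (x₁ - x₂) * (conj x₁ - conj x₂) := by
    rw [← map_sub, Complex.mul_conj, Complex.normSq_eq_norm_sq]
  have r3 : ((conj x₁ * x₂).im : ℂ) ^ 2 * 4 = -(conj x₁ * x₂ - x₁ * conj x₂) ^ 2 := by
    rw [r1, div_pow, mul_pow, Complex.I_sq]; ring
  have key : 4 * (J * (z₁ * z₂)) ^ 2 *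
      (((conj x₁ * x₂).im : ℂ) ^ 2 - (x₁ - x₂) * (conj x₁ - conj x₂)) =
      -(z₁ - z₂) ^ 2 * ((z₁ + z₂ - o - z₁ * z₂ * conj o) ^ 2 -
        4 * (conj m * (z₁ * z₂) + n) * (conj n * (z₁ * z₂) + m)) := by
    have : 4 * (J * (z₁ * z₂)) ^ 2 *
      (((conj x₁ * x₂).im : ℂ) ^ 2 - (x₁ - x₂) * (conj x₁ - conj x₂)) =
      -(J * (conj x₁ * x₂ - x₁ * conj x₂) * (z₁ * z₂)) ^ 2 -
        4 * (J * (x₁ - x₂) * (z₁ * z₂)) * (J * (conj x₁ - conj x₂) * (z₁ * z₂)) := by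
      linear_combination (J * (z₁ * z₂)) ^ 2 * r3
    rw [this, d1, d2, d3]; ring
  have hl : (conj x₁ * x₂).im ^ 2 = ‖x₁ - x₂‖ ^ 2 ↔
      ((conj x₁ * x₂).im : ℂ) ^ 2 - (x₁ - x₂) * (conj x₁ - conj x₂) = 0 := by
    rw [← r2, sub_eq_zero]; norm_cast
  rw [hl]
  have c1 : 4 * (J * (z₁ * z₂)) ^ 2 ≠ 0 :=
    mul_ne_zero (by norm_num) (pow_ne_zero _ (mul_ne_zero hJ (mul_ne_zero z1 z2)))
  have c2 : -(z₁ - z₂) ^ 2 ≠ 0 := neg_ne_zero.2 (pow_ne_zero _ hd)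
  constructor
  · intro h0
    rw [h0, mul_zero] at key
    linear_combination (mul_eq_zero.1 key.symm).resolve_left c2
  · intro h0
    have : (z₁ + z₂ - o - z₁ * z₂ * conj o) ^ 2 -
        4 * (conj m * (z₁ * z₂) + n) * (conj n * (z₁ * z₂) + m) = 0 := by
      linear_combination h0
    rw [this, mul_zero] at key
    exact (mul_eq_zero.1 key).resolve_left c1

/-- With `w` the direction of the focus, the conic reaches height `Re (w̄ o) + |N|` in that
direction, where `N = w̄ m² + w n̄²`, and `|N| ≥ 2 Re (w̄ m n)`; so some point of the conic is at
least as high as the focus. Squares as coefficients make the focus polynomial in `m`, `n`. -/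
lemma norm_focus_lt {o m n : ℂ} (h : ∀ x : ℂ, ‖x‖ = 1 → ‖o + m ^ 2 * x + n ^ 2 * conj x‖ < 1) :
    ‖o + 2 * (m * n)‖ < 1 := by
  by_cases hf : o + 2 * (m * n) = 0
  · rw [hf]; simp
  set f := o + 2 * (m * n) with hfdef
  have hn : (‖f‖ : ℂ) ≠ 0 := by simpa using hf
  obtain ⟨r, hr⟩ := exists_sq_eq (f / ‖f‖)
  have hw1 : ‖f / ‖f‖‖ = 1 := by simp [hf]
  set w := f / ‖f‖ with hw
  have hre : (conj w * f).re = ‖f‖ := by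
    have : conj w * f = ‖f‖ := by
      have hff := Complex.mul_conj f
      rw [Complex.normSq_eq_norm_sq] at hff
      push_cast at hff
      rw [hw, map_div₀, Complex.conj_ofReal]; field_simp; linear_combination hff
    rw [this]; simp
  set N := conj w * m ^ 2 + w * conj n ^ 2 with hN
  obtain ⟨x, hx, hNx⟩ : ∃ x : ℂ, ‖x‖ = 1 ∧ N * x = ‖N‖ := by
    obtain ⟨y, hy, h⟩ := exists_unit_mul_sq N
    exact ⟨y ^ 2, by simp [hy], h⟩
  have h1 := h x hx
  have h2 : (conj w * (o + m ^ 2 * x + n ^ 2 * conj x)).re < 1 := by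
    refine (Complex.re_le_norm _).trans_lt ?_
    rw [norm_mul]; simpa [hw1] using h1
  have h3 : (conj w * (o + m ^ 2 * x + n ^ 2 * conj x)).re = (conj w * o).re + ‖N‖ := by
    have : (‖N‖ : ℝ) = (N * x).re := by rw [hNx]; simp
    rw [this, hN]
    simp [pow_two]; ring
  have h4 : 2 * (conj w * (m * n)).re ≤ ‖N‖ := by
    refine le_of_abs_le (abs_le_of_sq_le_sq ?_ (norm_nonneg _))
    have e1 : conj w = conj r ^ 2 := by rw [← hr]; simp
    rw [hN, e1, ← hr, ← Complex.normSq_eq_norm_sq, Complex.normSq_apply]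
    have e2 : conj r ^ 2 * (m * n) = (conj r * m) * conj (r * conj n) := by simp; ring
    have e3 : conj r ^ 2 * m ^ 2 + r ^ 2 * conj n ^ 2 = (conj r * m) ^ 2 + (r * conj n) ^ 2 := by
      ring
    rw [e2, e3]
    generalize conj r * m = X
    generalize r * conj n = Y
    simp [pow_two]
    nlinarith [sq_nonneg (X.re ^ 2 + X.im ^ 2 - Y.re ^ 2 - Y.im ^ 2)]
  have h5 : (conj w * f).re = (conj w * o).re + 2 * (conj w * (m * n)).re := by
    rw [hfdef]; simp; ring
  linarith

lemma exists_foci (hnested : Ec.carrier ⊆ E.inside) : ∃ f g : ℂ, ‖f‖ < 1 ∧ ‖g‖ < 1 ∧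
    parS E Ec = f + g ∧ parC E Ec = f * g := by
  obtain ⟨m, hm⟩ := exists_sq_eq (pullA E Ec)
  obtain ⟨n, hn⟩ := exists_sq_eq (pullB E Ec)
  have h : ∀ x : ℂ, ‖x‖ = 1 → ‖pullO E Ec + m ^ 2 * x + n ^ 2 * conj x‖ < 1 := by
    intro x hx
    have := hnested (Ec.pt_mem_carrier.2 hx)
    rw [← pt_pull E, Ellipse.inside, Set.mem_ofPred_eq, E.form_eq, E.co_pt, ← hm, ← hn] at this
    nlinarith [norm_nonneg (pullO E Ec + m ^ 2 * x + n ^ 2 * conj x)]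
  -- The other focus comes from the other square root, `-n`.
  refine ⟨_, _, norm_focus_lt h, norm_focus_lt (n := -n) (by simpa using h), ?_, ?_⟩
  · unfold parS; ring
  · unfold parC; rw [← hm, ← hn]; ring

end Pullback

/-! ### Isogonal conjugacy at one vertex -/

lemma reflection_line {s : AffineSubspace ℝ ℂ} [Nonempty s] {A v : ℂ} (hv : v ≠ 0)
    (hs : s = line[ℝ, A, A + v]) (P : ℂ) :
    EuclideanGeometry.reflection s P = A + v / conj v * conj (P - A) := by
  have hv' : conj v ≠ 0 := (map_ne_zero _).2 hv
  have hn : (Complex.normSq v : ℂ) = v * conj v := (Complex.mul_conj v).symm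
  have hnn : (Complex.normSq v : ℂ) ≠ 0 := by rw [hn]; exact mul_ne_zero hv hv'
  set d := P - A with hd
  have hm : A + (((d * conj v).re / Complex.normSq v : ℝ) : ℂ) * v ∈ s := by
    rw [hs, mem_line_iff]; exact ⟨(d * conj v).re / Complex.normSq v, by ring⟩
  have ho : (((d * conj v).im / Complex.normSq v : ℝ) : ℂ) * Complex.I * v ∈ s.directionᗮ := by
    rw [hs, direction_affineSpan, vectorSpan_pair_rev,
      Submodule.mem_orthogonal_singleton_iff_inner_right]
    simp [Complex.inner]
    ring
  have e1 : P = ((((d * conj v).im / Complex.normSq v : ℝ) : ℂ) * Complex.I * v) +ᵥ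
      (A + (((d * conj v).re / Complex.normSq v : ℝ) : ℂ) * v) := by
    have := Complex.re_add_im (d * conj v)
    push_cast
    rw [vadd_eq_add]
    field_simp
    rw [hn]
    linear_combination (-v) * this - v * conj v * hd
  rw [e1, EuclideanGeometry.reflection_orthogonal_vadd hm ho, vadd_eq_add]
  have h2 := Complex.re_add_im (d * conj v)
  have h3 := congrArg conj h2
  simp only [map_add, map_mul, Complex.conj_ofReal, Complex.conj_I, Complex.conj_conj] at h3
  push_cast
  field_simp
  rw [hn]
  linear_combination (v * conj v) * h3

/-- For the bisector vector `v` of the sides `b`, `c` one has `v / v̄ = b c / (|b| |c|)`, so `Q` is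
on the reflected cevian exactly when `(P - A) (Q - A) / (b c)` is real. -/
lemma mem_line_reflection_iff (T : Affine.Triangle ℝ ℂ) (i : Fin 3) {P Q : ℂ}
    (hP : P ≠ T.points i)
    (h : (conj (T.points (i + 1) - T.points i) * (T.points (i + 2) - T.points i)).im ≠ 0) :
    Q ∈ line[ℝ, T.points i, EuclideanGeometry.reflection (bisector T i) P] ↔
      ((T.points i - P) * (T.points i - Q) *
        conj ((T.points i - T.points (i + 1)) * (T.points i - T.points (i + 2)))).im = 0 := by
  set A := T.points i
  set b := T.points (i + 1) - A with hb
  set c := T.points (i + 2) - A with hc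
  have hb0 : b ≠ 0 := by intro h0; simp [h0] at h
  have hc0 : c ≠ 0 := by intro h0; simp [h0] at h
  have nb : ‖b‖ ≠ 0 := by simpa using hb0
  have nc : ‖c‖ ≠ 0 := by simpa using hc0
  have nb' : (‖b‖ : ℂ) ≠ 0 := by exact_mod_cast nb
  have nc' : (‖c‖ : ℂ) ≠ 0 := by exact_mod_cast nc
  set v : ℂ := (‖b‖⁻¹ : ℝ) • b + (‖c‖⁻¹ : ℝ) • c with hv
  have hv0 : v ≠ 0 := by
    intro h0
    rw [hv, Complex.real_smul, Complex.real_smul] at h0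
    push_cast at h0
    have : c = ((-(‖c‖ * ‖b‖⁻¹) : ℝ) : ℂ) * b := by
      push_cast
      field_simp at h0 ⊢
      linear_combination h0
    apply h
    rw [this]
    have : conj b * (((-(‖c‖ * ‖b‖⁻¹) : ℝ) : ℂ) * b) =
        (((-(‖c‖ * ‖b‖⁻¹) * Complex.normSq b : ℝ)) : ℂ) := by
      push_cast; rw [← Complex.mul_conj]; ring
    rw [this, Complex.ofReal_im]
  have hs : bisector T i = line[ℝ, A, A + v] := rfl
  rw [reflection_line hv0 hs, mem_line_iff]
  have sb : (‖b‖ : ℂ) ^ 2 = b * conj b := by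
    rw [Complex.mul_conj, Complex.normSq_eq_norm_sq]; push_cast; rfl
  have sc : (‖c‖ : ℂ) ^ 2 = c * conj c := by
    rw [Complex.mul_conj, Complex.normSq_eq_norm_sq]; push_cast; rfl
  have hvv : v / conj v = b * c / (‖b‖ * ‖c‖) := by
    rw [div_eq_div_iff ((map_ne_zero _).2 hv0) (mul_ne_zero nb' nc'), hv]
    simp only [Complex.real_smul, map_add, map_mul, Complex.conj_ofReal]
    push_cast
    field_simp
    linear_combination (c * ‖c‖) * sb + (b * ‖b‖) * sc
  rw [hvv]
  have hPA : P - A ≠ 0 := sub_ne_zero.2 hP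
  have hPA' : conj (P - A) ≠ 0 := (map_ne_zero _).2 hPA
  have e1 : (A - P) * (A - Q) * conj ((A - T.points (i + 1)) * (A - T.points (i + 2))) =
      (P - A) * (Q - A) * conj (b * c) := by
    rw [hb, hc]; simp only [map_mul, map_sub]; ring
  rw [e1, ← Complex.conj_eq_iff_im]
  have hbc : conj b * conj c ≠ 0 := mul_ne_zero ((map_ne_zero _).2 hb0) ((map_ne_zero _).2 hc0)
  constructor
  · rintro ⟨t, ht⟩
    have : Q - A = t * (b * c / (‖b‖ * ‖c‖) * conj (P - A)) := by rw [ht]; ring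
    rw [this]
    simp only [map_mul, map_div₀, Complex.conj_ofReal, Complex.conj_conj]
    field_simp
  · intro hr
    have h1 : conj ((Q - A) / (b * c / (‖b‖ * ‖c‖) * conj (P - A))) =
        (Q - A) / (b * c / (‖b‖ * ‖c‖) * conj (P - A)) := by
      have hr2 : conj (P - A) * conj (Q - A) * (b * c) = (P - A) * (Q - A) * (conj b * conj c) := by
        simpa using hr
      simp only [map_mul, map_div₀, Complex.conj_ofReal, Complex.conj_conj]
      have hb' : conj b ≠ 0 := (map_ne_zero _).2 hb0
      have hc' : conj c ≠ 0 := (map_ne_zero _).2 hc0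
      field_simp
      linear_combination hr2
    obtain ⟨t, ht⟩ := Complex.conj_eq_iff_real.1 h1
    refine ⟨t, ?_⟩
    rw [← ht]
    have : b * c / (‖b‖ * ‖c‖) * conj (P - A) ≠ 0 := by
      refine mul_ne_zero (div_ne_zero (mul_ne_zero hb0 hc0) (mul_ne_zero nb' nc')) hPA'
    rw [add_sub_cancel_left, div_mul_cancel₀ _ this]; ring

/-- Metric form of isogonality: `U` and `V` have equal products of signed distances to the lines
along `b` and along `c`. The difference of the two sides is the original condition times the area
factor `b c̄ - c b̄ ≠ 0`. -/
lemma im_mul_conj_eq_zero_iff {U V b c : ℂ} (h : (conj b * c).im ≠ 0) :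
    (U * V * conj (b * c)).im = 0 ↔
      (conj U * b - U * conj b) * (conj V * b - V * conj b) * (c * conj c) =
        (conj U * c - U * conj c) * (conj V * c - V * conj c) * (b * conj b) := by
  have h' : b * conj c - c * conj b ≠ 0 := by
    intro h0
    apply h
    rw [← Complex.conj_eq_iff_im]
    simp only [map_mul, Complex.conj_conj]
    linear_combination h0
  rw [← Complex.conj_eq_iff_im]
  simp only [map_mul, Complex.conj_conj]
  constructor
  · intro h1
    linear_combination (b * conj c - c * conj b) * h1
  · intro h1
    apply mul_left_cancel₀ h'
    linear_combination h1

lemma chord_vertex {z₁ z₂ z₃ : ℂ} (n₃ : ‖z₃‖ = 1) :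
    z₃ * chord z₁ z₂ z₃ = -((z₃ - z₁) * (z₃ - z₂)) := by
  unfold chord; linear_combination (-z₁ * z₂) * mul_conj_one n₃

lemma chord_vertex_ne {z₁ z₂ z₃ : ℂ} (n₃ : ‖z₃‖ = 1)
    (h₂₃ : z₂ ≠ z₃) (h₃₁ : z₃ ≠ z₁) : chord z₁ z₂ z₃ ≠ 0 := by
  intro h
  have := chord_vertex (z₁ := z₁) (z₂ := z₂) n₃
  rw [h, mul_zero, eq_comm, neg_eq_zero] at this
  exact (mul_ne_zero (sub_ne_zero.2 h₃₁) (sub_ne_zero.2 h₂₃.symm)) this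

lemma conj_chord {z₁ z₂ : ℂ} (n₁ : ‖z₁‖ = 1) (n₂ : ‖z₂‖ = 1) (w : ℂ) :
    z₁ * z₂ * conj (chord z₁ z₂ w) = chord z₁ z₂ w := by
  have u1 := mul_conj_one n₁
  have u2 := mul_conj_one n₂
  unfold chord
  simp only [map_sub, map_add, map_mul, Complex.conj_conj]
  linear_combination (z₂ - w * z₂ * conj z₂) * u1 + (z₁ - w) * u2

lemma conj_nrm {p q : ℝ} {z₁ z₂ : ℂ} (n₁ : ‖z₁‖ = 1) (n₂ : ‖z₂‖ = 1) :
    (z₁ * z₂) ^ 2 * conj (nrm p q z₁ z₂) = nrm p q z₁ z₂ := by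
  have u : (z₁ * z₂) * conj (z₁ * z₂) = 1 := by
    rw [map_mul]
    linear_combination (z₂ * conj z₂) * mul_conj_one n₁ + mul_conj_one n₂
  unfold nrm
  generalize z₁ * z₂ = e at *
  simp only [map_sub, map_mul, Complex.conj_ofReal]
  linear_combination (p ^ 2 * e + q ^ 2 * e - p * q * (e * conj e + 1)) * u

lemma nrm_ne_zero {p q : ℝ} {z₁ z₂ : ℂ} (hq : 0 ≤ q) (hpq : q < p) (n₁ : ‖z₁‖ = 1)
    (n₂ : ‖z₂‖ = 1) : nrm p q z₁ z₂ ≠ 0 := by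
  have hp : 0 ≤ p := hq.trans hpq.le
  have key : ∀ x y : ℂ, ‖x‖ = p → ‖y‖ = q → x - y ≠ 0 ∧ y - x ≠ 0 := by
    intro x y hx hy
    have : x ≠ y := by rintro rfl; linarith
    exact ⟨sub_ne_zero.2 this, sub_ne_zero.2 this.symm⟩
  unfold nrm
  refine mul_ne_zero (key _ _ ?_ ?_).1 (key _ _ ?_ ?_).1 <;> simp [n₁, n₂, abs_of_nonneg, hp, hq]

section vertex

variable (E : Ellipse)

lemma Ellipse.pt_sub_mul {z₁ z₂ : ℂ} (n₁ : ‖z₁‖ = 1) (n₂ : ‖z₂‖ = 1) :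
    z₁ * z₂ * (E.pt z₁ - E.pt z₂) = E.u * ((z₁ - z₂) * (z₁ * z₂ * E.p - E.q)) ∧
    z₁ * z₂ * conj (E.pt z₁ - E.pt z₂) = -(conj E.u * ((z₁ - z₂) * (E.p - z₁ * z₂ * E.q))) := by
  have u1 := mul_conj_one n₁
  have u2 := mul_conj_one n₂
  unfold Ellipse.pt
  simp only [map_sub, map_add, map_mul, Complex.conj_ofReal, Complex.conj_conj]
  constructor
  · linear_combination (E.u * E.q) * (z₂ * u1 - z₁ * u2)
  · linear_combination (conj E.u * E.p) * (z₂ * u1 - z₁ * u2)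

lemma Ellipse.pt_cross {z₁ z₂ : ℂ} (n₁ : ‖z₁‖ = 1) (n₂ : ‖z₂‖ = 1) (w : ℂ) :
    z₁ * z₂ * (conj (E.pt z₁ - E.pt w) * (E.pt z₁ - E.pt z₂) -
      (E.pt z₁ - E.pt w) * conj (E.pt z₁ - E.pt z₂)) =
      (z₁ - z₂) * (E.p ^ 2 - E.q ^ 2) * chord z₁ z₂ w := by
  obtain ⟨h1, h2⟩ := E.pt_sub_mul n₁ n₂
  have u1 := mul_conj_one n₁
  have hu := mul_conj_one E.norm_u
  have a1 : E.pt z₁ - E.pt w = E.u * (E.p * (z₁ - w) + E.q * (conj z₁ - conj w)) := by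
    unfold Ellipse.pt; ring
  have a2 : conj (E.pt z₁ - E.pt w) = conj E.u * (E.p * (conj z₁ - conj w) + E.q * (z₁ - w)) := by
    rw [a1]; simp only [map_sub, map_add, map_mul, Complex.conj_ofReal, Complex.conj_conj]
  have : z₁ * z₂ * (conj (E.pt z₁ - E.pt w) * (E.pt z₁ - E.pt z₂) -
      (E.pt z₁ - E.pt w) * conj (E.pt z₁ - E.pt z₂)) =
      conj (E.pt z₁ - E.pt w) * (z₁ * z₂ * (E.pt z₁ - E.pt z₂)) -
      (E.pt z₁ - E.pt w) * (z₁ * z₂ * conj (E.pt z₁ - E.pt z₂)) := by ring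
  rw [this, h1, h2, a2, a1]
  unfold chord
  have key : (E.p * (conj z₁ - conj w) + E.q * (z₁ - w)) * ((z₁ - z₂) * (z₁ * z₂ * E.p - E.q)) +
      (E.p * (z₁ - w) + E.q * (conj z₁ - conj w)) * ((z₁ - z₂) * (E.p - z₁ * z₂ * E.q)) =
      (z₁ - z₂) * (E.p ^ 2 - E.q ^ 2) * (z₁ + z₂ - w - z₁ * z₂ * conj w) := by
    linear_combination ((z₁ - z₂) * z₂ * (E.p ^ 2 - E.q ^ 2)) * u1
  linear_combination (E.u * conj E.u) * key +
    (z₁ - z₂) * (E.p ^ 2 - E.q ^ 2) * (z₁ + z₂ - w - z₁ * z₂ * conj w) * hu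

end vertex

lemma Ellipse.cross_ne (E : Ellipse) {z₁ z₂ z₃ : ℂ} (n₁ : ‖z₁‖ = 1) (n₂ : ‖z₂‖ = 1)
    (n₃ : ‖z₃‖ = 1) (h₁₂ : z₁ ≠ z₂) (h₂₃ : z₂ ≠ z₃) (h₃₁ : z₃ ≠ z₁) :
    (conj (E.pt z₂ - E.pt z₁) * (E.pt z₃ - E.pt z₁)).im ≠ 0 := by
  intro h0
  have h := E.pt_cross n₁ n₂ z₃
  have hne : (z₁ - z₂) * (E.p ^ 2 - E.q ^ 2) * chord z₁ z₂ z₃ ≠ 0 :=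
    mul_ne_zero (mul_ne_zero (sub_ne_zero.2 h₁₂) E.sq_sub_sq_ne) (chord_vertex_ne n₃ h₂₃ h₃₁)
  apply hne
  rw [← h]
  rw [← Complex.conj_eq_iff_im] at h0
  simp only [map_mul, map_sub, Complex.conj_conj] at h0 ⊢
  linear_combination z₁ * z₂ * h0

/-- Transfers the equality of distance products to the chart: `chord` carries the signed distance to
a side line, and `nrm` the squared side length. -/
lemma Ellipse.vertex_iff (E : Ellipse) {z₁ z₂ z₃ : ℂ} (n₁ : ‖z₁‖ = 1) (n₂ : ‖z₂‖ = 1)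
    (n₃ : ‖z₃‖ = 1) (h₁₂ : z₁ ≠ z₂) (h₂₃ : z₂ ≠ z₃) (h₃₁ : z₃ ≠ z₁) (w v : ℂ) :
    ((E.pt z₁ - E.pt w) * (E.pt z₁ - E.pt v) *
        conj ((E.pt z₁ - E.pt z₂) * (E.pt z₁ - E.pt z₃))).im = 0 ↔
      chord z₁ z₂ w * chord z₁ z₂ v * nrm E.p E.q z₃ z₁ =
        chord z₃ z₁ w * chord z₃ z₁ v * nrm E.p E.q z₁ z₂ := by
  have hc : (conj (E.pt z₁ - E.pt z₂) * (E.pt z₁ - E.pt z₃)).im ≠ 0 := by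
    have := E.cross_ne n₁ n₂ n₃ h₁₂ h₂₃ h₃₁
    have e : conj (E.pt z₁ - E.pt z₂) * (E.pt z₁ - E.pt z₃) =
        conj (E.pt z₂ - E.pt z₁) * (E.pt z₃ - E.pt z₁) := by simp only [map_sub]; ring
    rwa [e]
  rw [im_mul_conj_eq_zero_iff hc]
  have a1 := E.pt_cross n₁ n₂ w
  have a2 := E.pt_cross n₁ n₂ v
  have a3 := E.pt_cross n₁ n₃ w
  have a4 := E.pt_cross n₁ n₃ v
  obtain ⟨b1, b2⟩ := E.pt_sub_mul n₁ n₂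
  obtain ⟨b3, b4⟩ := E.pt_sub_mul n₁ n₃
  have hu := mul_conj_one E.norm_u
  rw [chord_comm z₃ z₁ w, chord_comm z₃ z₁ v]
  have b5 : (z₁ * z₂) ^ 2 * ((E.pt z₁ - E.pt z₂) * conj (E.pt z₁ - E.pt z₂)) =
      -(z₁ - z₂) ^ 2 * nrm E.p E.q z₁ z₂ := by
    calc _ = (z₁ * z₂ * (E.pt z₁ - E.pt z₂)) * (z₁ * z₂ * conj (E.pt z₁ - E.pt z₂)) := by ring
      _ = _ := by
        rw [b1, b2]; unfold nrm
        linear_combination (-(z₁ - z₂) ^ 2 * ((z₁ * z₂ * E.p - E.q) * (E.p - z₁ * z₂ * E.q))) * hu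
  have b6 : (z₁ * z₃) ^ 2 * ((E.pt z₁ - E.pt z₃) * conj (E.pt z₁ - E.pt z₃)) =
      -(z₁ - z₃) ^ 2 * nrm E.p E.q z₃ z₁ := by
    calc _ = (z₁ * z₃ * (E.pt z₁ - E.pt z₃)) * (z₁ * z₃ * conj (E.pt z₁ - E.pt z₃)) := by ring
      _ = _ := by
        rw [b3, b4]; unfold nrm
        linear_combination (-(z₁ - z₃) ^ 2 * ((z₁ * z₃ * E.p - E.q) * (E.p - z₁ * z₃ * E.q))) * hu
  have z1 := ne_zero_of_norm_one n₁
  have z2 := ne_zero_of_norm_one n₂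
  have z3 := ne_zero_of_norm_one n₃
  set r : ℂ := (E.p : ℂ) ^ 2 - E.q ^ 2 with hr
  have hr0 : r ≠ 0 := E.sq_sub_sq_ne
  generalize conj (E.pt z₁ - E.pt w) * (E.pt z₁ - E.pt z₂) -
    (E.pt z₁ - E.pt w) * conj (E.pt z₁ - E.pt z₂) = X₁ at *
  generalize conj (E.pt z₁ - E.pt v) * (E.pt z₁ - E.pt z₂) -
    (E.pt z₁ - E.pt v) * conj (E.pt z₁ - E.pt z₂) = X₂ at *
  generalize conj (E.pt z₁ - E.pt w) * (E.pt z₁ - E.pt z₃) -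
    (E.pt z₁ - E.pt w) * conj (E.pt z₁ - E.pt z₃) = X₃ at *
  generalize conj (E.pt z₁ - E.pt v) * (E.pt z₁ - E.pt z₃) -
    (E.pt z₁ - E.pt v) * conj (E.pt z₁ - E.pt z₃) = X₄ at *
  generalize (E.pt z₁ - E.pt z₂) * conj (E.pt z₁ - E.pt z₂) = Y₁ at *
  generalize (E.pt z₁ - E.pt z₃) * conj (E.pt z₁ - E.pt z₃) = Y₂ at *
  have key : ((z₁ * z₂) ^ 2 * (z₁ * z₃) ^ 2) * (X₁ * X₂ * Y₂ - X₃ * X₄ * Y₁) =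
      -((z₁ - z₂) ^ 2 * (z₁ - z₃) ^ 2 * r ^ 2) * (chord z₁ z₂ w * chord z₁ z₂ v * nrm E.p E.q z₃ z₁ -
        chord z₁ z₃ w * chord z₁ z₃ v * nrm E.p E.q z₁ z₂) := by
    calc _ = (z₁ * z₂ * X₁) * (z₁ * z₂ * X₂) * ((z₁ * z₃) ^ 2 * Y₂) -
          (z₁ * z₃ * X₃) * (z₁ * z₃ * X₄) * ((z₁ * z₂) ^ 2 * Y₁) := by ring
      _ = _ := by rw [a1, a2, a3, a4, b5, b6]; ring
  have c1 : (z₁ * z₂) ^ 2 * (z₁ * z₃) ^ 2 ≠ 0 := by simp [z1, z2, z3]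
  have c2 : -((z₁ - z₂) ^ 2 * (z₁ - z₃) ^ 2 * r ^ 2) ≠ 0 := by
    simp [sub_eq_zero, h₁₂, h₃₁.symm, hr0]
  constructor
  · intro h
    rw [h, sub_self, mul_zero] at key
    exact sub_eq_zero.1 ((mul_eq_zero.1 key.symm).resolve_left c2)
  · intro h
    rw [h, sub_self, mul_zero] at key
    exact sub_eq_zero.1 ((mul_eq_zero.1 key).resolve_left c1)

/-! ### Triangles of the Poncelet family and their isogonal conjugates -/

/-- `T` is the Poncelet triangle with parameter `l`, and its vertices are the images of
`z₁`, `z₂`, `z₃`. -/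
structure Inscribed (E Ec : Ellipse) (T : Affine.Triangle ℝ ℂ) (l z₁ z₂ z₃ : ℂ) : Prop where
  pt₀ : T.points 0 = E.pt z₁
  pt₁ : T.points 1 = E.pt z₂
  pt₂ : T.points 2 = E.pt z₃
  n₁ : ‖z₁‖ = 1
  n₂ : ‖z₂‖ = 1
  n₃ : ‖z₃‖ = 1
  h₁₂ : z₁ ≠ z₂
  h₂₃ : z₂ ≠ z₃
  h₃₁ : z₃ ≠ z₁
  sym : Sym (parS E Ec) (parC E Ec) l z₁ z₂ z₃

variable {E Ec : Ellipse} {T : Affine.Triangle ℝ ℂ} {l z₁ z₂ z₃ : ℂ}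

lemma side_zero (T : Affine.Triangle ℝ ℂ) : side T 0 = line[ℝ, T.points 1, T.points 2] := rfl
lemma side_one (T : Affine.Triangle ℝ ℂ) : side T 1 = line[ℝ, T.points 2, T.points 0] := rfl
lemma side_two (T : Affine.Triangle ℝ ℂ) : side T 2 = line[ℝ, T.points 0, T.points 1] := rfl

lemma Inscribed.norm_param (h : Inscribed E Ec T l z₁ z₂ z₃) : ‖l‖ = 1 := by
  rw [← h.sym.three]; simp [h.n₁, h.n₂, h.n₃]

/-- Cayley's condition for the closure of the Poncelet triangles. -/
def Closure (E Ec : Ellipse) : Prop :=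
  parW E Ec = 1 - parS E Ec * conj (parS E Ec) + parC E Ec * conj (parC E Ec)

lemma exists_inscribed (hT : T ∈ ponceletFamily E Ec) :
    Closure E Ec ∧ ∃ l z₁ z₂ z₃, Inscribed E Ec T l z₁ z₂ z₃ := by
  have inj := T.independent.injective
  have key : ∀ i, T.points i = E.pt (E.co (T.points i)) := fun i => (E.pt_co _).symm
  have nn : ∀ i, ‖E.co (T.points i)‖ = 1 := fun i => E.mem_carrier_iff.1 (hT i).1
  have hne : ∀ {i j}, i ≠ j → E.co (T.points i) ≠ E.co (T.points j) :=
    fun h h' => h (inj (E.co_injective h'))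
  have tan : ∀ {i j}, i ≠ j → Ec.IsTangentLine line[ℝ, T.points i, T.points j] →
      Tan (parS E Ec) (parC E Ec) (parW E Ec) (E.co (T.points i)) (E.co (T.points j)) := by
    intro i j hij h
    rw [key i, key j] at h
    exact (isTangentLine_chord E Ec (nn i) (nn j) (hne hij)).1 h
  obtain ⟨hs, hW⟩ := sym_of_tan (ne_zero_of_norm_one (nn 0)) (hne (by decide : (0 : Fin 3) ≠ 1))
    (hne (by decide : (1 : Fin 3) ≠ 2)) (hne (by decide : (2 : Fin 3) ≠ 0))
    (tan (by decide) (hT 2).2) (tan (by decide) (hT 0).2) (tan (by decide) (hT 1).2)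
  exact ⟨hW, _, _, _, _, key 0, key 1, key 2, nn 0, nn 1, nn 2, hne (by decide),
    hne (by decide), hne (by decide), hs⟩

lemma Inscribed.mem (hc : Closure E Ec) (h : Inscribed E Ec T l z₁ z₂ z₃) :
    T ∈ ponceletFamily E Ec := by
  have tan : ∀ {z w y}, Sym (parS E Ec) (parC E Ec) l z w y → ‖z‖ = 1 → ‖w‖ = 1 → z ≠ w →
      Ec.IsTangentLine line[ℝ, E.pt z, E.pt w] := fun hs hz hw hne => by
    rw [isTangentLine_chord E Ec hz hw hne, hc]; exact hs.tan
  intro i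
  fin_cases i
  · refine ⟨by simpa [h.pt₀, E.pt_mem_carrier] using h.n₁, ?_⟩
    change Ec.IsTangentLine (side T 0)
    rw [side_zero, h.pt₁, h.pt₂]
    exact tan h.sym.rot h.n₂ h.n₃ h.h₂₃
  · refine ⟨by simpa [h.pt₁, E.pt_mem_carrier] using h.n₂, ?_⟩
    change Ec.IsTangentLine (side T 1)
    rw [side_one, h.pt₂, h.pt₀]
    exact tan h.sym.rot.rot h.n₃ h.n₁ h.h₃₁
  · refine ⟨by simpa [h.pt₂, E.pt_mem_carrier] using h.n₃, ?_⟩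
    change Ec.IsTangentLine (side T 2)
    rw [side_two, h.pt₀, h.pt₁]
    exact tan h.sym h.n₁ h.n₂ h.h₁₂

lemma exists_triangle (n₁ : ‖z₁‖ = 1) (n₂ : ‖z₂‖ = 1) (n₃ : ‖z₃‖ = 1)
    (h₁₂ : z₁ ≠ z₂) (h₂₃ : z₂ ≠ z₃) (h₃₁ : z₃ ≠ z₁)
    (hs : Sym (parS E Ec) (parC E Ec) l z₁ z₂ z₃) :
    ∃ T : Affine.Triangle ℝ ℂ, Inscribed E Ec T l z₁ z₂ z₃ := by
  have hi : AffineIndependent ℝ ![E.pt z₁, E.pt z₂, E.pt z₃] := by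
    rw [affineIndependent_iff_not_collinear_set]
    intro hcol
    have hm : E.pt z₃ ∈ line[ℝ, E.pt z₁, E.pt z₂] :=
      hcol.mem_affineSpan_of_mem_of_ne (by simp) (by simp) (by simp)
        (fun h => h₁₂ (E.pt_injective h))
    rw [E.pt_mem_chord n₁ n₂ h₁₂] at hm
    exact chord_vertex_ne n₃ h₂₃ h₃₁ hm
  exact ⟨⟨_, hi⟩, rfl, rfl, rfl, n₁, n₂, n₃, h₁₂, h₂₃, h₃₁, hs⟩

/-- With `Inscribed.mem` this is Poncelet's porism: once one triangle closes up, every unimodular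
`l` gives a member of the family. -/
lemma exists_triangle_of_param (hnested : Ec.carrier ⊆ E.inside) (hl : ‖l‖ = 1) :
    ∃ T z₁ z₂ z₃, Inscribed E Ec T l z₁ z₂ z₃ := by
  obtain ⟨f, g, hf, hg, hs, hc⟩ := exists_foci E Ec hnested
  obtain ⟨z₁, z₂, z₃, h, n₁, n₂, n₃, h₁₂, h₂₃, h₃₁⟩ := exists_sym hf hg hl
  rw [← hs, ← hc] at h
  obtain ⟨T, hT⟩ := exists_triangle n₁ n₂ n₃ h₁₂ h₂₃ h₃₁ h
  exact ⟨T, _, _, _, hT⟩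

lemma norm_parC_lt (hnested : Ec.carrier ⊆ E.inside) : ‖parC E Ec‖ < 1 := by
  obtain ⟨f, g, hf, hg, -, hc⟩ := exists_foci E Ec hnested
  rw [hc, norm_mul]
  nlinarith [norm_nonneg f, norm_nonneg g]

/-- The inscribed conics of a Poncelet triangle with foci `P = E.pt w` and `Q = E.pt v`. -/
def IsFocal (E : Ellipse) (k : ℝ) (z₁ z₂ z₃ w v : ℂ) : Prop :=
  chord z₂ z₃ w * chord z₂ z₃ v = k * nrm E.p E.q z₂ z₃ ∧
      chord z₃ z₁ w * chord z₃ z₁ v = k * nrm E.p E.q z₃ z₁ ∧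
      chord z₁ z₂ w * chord z₁ z₂ v = k * nrm E.p E.q z₁ z₂

/-- The three vertex conditions say that the ratios of `chord * chord` to `nrm` on the three sides
agree. The value `k = 0` is allowed and covers a point on a side line, whose conjugate is the
opposite vertex. -/
lemma Inscribed.isogonal_iff_focal (h : Inscribed E Ec T l z₁ z₂ z₃) {w v : ℂ} :
    IsIsogonalConjugate T (E.pt w) (E.pt v) ↔
      (w ≠ z₁ ∧ w ≠ z₂ ∧ w ≠ z₃) ∧ ∃ k : ℝ, IsFocal E k z₁ z₂ z₃ w v := by
  have ne_iff : ∀ z, E.pt w ≠ E.pt z ↔ w ≠ z := fun z => E.pt_injective.ne_iff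
  have c1 := E.cross_ne h.n₁ h.n₂ h.n₃ h.h₁₂ h.h₂₃ h.h₃₁
  have c2 := E.cross_ne h.n₂ h.n₃ h.n₁ h.h₂₃ h.h₃₁ h.h₁₂
  have c3 := E.cross_ne h.n₃ h.n₁ h.n₂ h.h₃₁ h.h₁₂ h.h₂₃
  have v1 := E.vertex_iff h.n₁ h.n₂ h.n₃ h.h₁₂ h.h₂₃ h.h₃₁ w v
  have v2 := E.vertex_iff h.n₂ h.n₃ h.n₁ h.h₂₃ h.h₃₁ h.h₁₂ w v
  have v3 := E.vertex_iff h.n₃ h.n₁ h.n₂ h.h₃₁ h.h₁₂ h.h₂₃ w v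
  have m1 := fun hP => mem_line_reflection_iff T 0 (P := E.pt w) (Q := E.pt v) hP
  have m2 := fun hP => mem_line_reflection_iff T 1 (P := E.pt w) (Q := E.pt v) hP
  have m3 := fun hP => mem_line_reflection_iff T 2 (P := E.pt w) (Q := E.pt v) hP
  simp only [Fin.isValue, zero_add, show (1 : Fin 3) + 1 = 2 from rfl,
    show (1 : Fin 3) + 2 = 0 from rfl, show (2 : Fin 3) + 1 = 0 from rfl,
    show (2 : Fin 3) + 2 = 1 from rfl] at m1 m2 m3
  have r1 : (E.pt w ≠ T.points 0 ∧ E.pt v ∈ line[ℝ, T.points 0,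
      EuclideanGeometry.reflection (bisector T 0) (E.pt w)]) ↔ w ≠ z₁ ∧
      chord z₁ z₂ w * chord z₁ z₂ v * nrm E.p E.q z₃ z₁ =
        chord z₃ z₁ w * chord z₃ z₁ v * nrm E.p E.q z₁ z₂ := by
    rw [← v1, ← ne_iff, ← h.pt₀, ← h.pt₁, ← h.pt₂]
    rw [← h.pt₀, ← h.pt₁, ← h.pt₂] at c1
    exact and_congr_right fun hP => m1 hP c1
  have r2 : (E.pt w ≠ T.points 1 ∧ E.pt v ∈ line[ℝ, T.points 1,
      EuclideanGeometry.reflection (bisector T 1) (E.pt w)]) ↔ w ≠ z₂ ∧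
      chord z₂ z₃ w * chord z₂ z₃ v * nrm E.p E.q z₁ z₂ =
        chord z₁ z₂ w * chord z₁ z₂ v * nrm E.p E.q z₂ z₃ := by
    rw [← v2, ← ne_iff, ← h.pt₀, ← h.pt₁, ← h.pt₂]
    rw [← h.pt₀, ← h.pt₁, ← h.pt₂] at c2
    exact and_congr_right fun hP => m2 hP c2
  have r3 : (E.pt w ≠ T.points 2 ∧ E.pt v ∈ line[ℝ, T.points 2,
      EuclideanGeometry.reflection (bisector T 2) (E.pt w)]) ↔ w ≠ z₃ ∧
      chord z₃ z₁ w * chord z₃ z₁ v * nrm E.p E.q z₂ z₃ =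
        chord z₂ z₃ w * chord z₂ z₃ v * nrm E.p E.q z₃ z₁ := by
    rw [← v3, ← ne_iff, ← h.pt₀, ← h.pt₁, ← h.pt₂]
    rw [← h.pt₀, ← h.pt₁, ← h.pt₂] at c3
    exact and_congr_right fun hP => m3 hP c3
  unfold IsIsogonalConjugate
  rw [Fin.forall_fin_succ, Fin.forall_fin_succ, Fin.forall_fin_one]
  change ((E.pt w ≠ T.points 0 ∧ _) ∧ (E.pt w ≠ T.points 1 ∧ _) ∧ (E.pt w ≠ T.points 2 ∧ _)) ↔ _
  erw [r1, r2, r3]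
  have N1 := nrm_ne_zero E.q_nonneg E.q_lt_p h.n₂ h.n₃
  have N2 := nrm_ne_zero E.q_nonneg E.q_lt_p h.n₃ h.n₁
  have N3 := nrm_ne_zero E.q_nonneg E.q_lt_p h.n₁ h.n₂
  constructor
  · rintro ⟨⟨a1, b1⟩, ⟨a2, b2⟩, ⟨a3, b3⟩⟩
    refine ⟨⟨a1, a2, a3⟩, ?_⟩
    -- Numerator and denominator acquire the same phase under conjugation, so the common ratio is
    -- real.
    have hr : conj (chord z₁ z₂ w * chord z₁ z₂ v / nrm E.p E.q z₁ z₂) =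
        chord z₁ z₂ w * chord z₁ z₂ v / nrm E.p E.q z₁ z₂ := by
      have e1 := conj_chord h.n₁ h.n₂ w
      have e2 := conj_chord h.n₁ h.n₂ v
      have e3 := conj_nrm (p := E.p) (q := E.q) h.n₁ h.n₂
      have z0 : (z₁ * z₂) ^ 2 ≠ 0 := pow_ne_zero _
        (mul_ne_zero (ne_zero_of_norm_one h.n₁) (ne_zero_of_norm_one h.n₂))
      rw [map_div₀, map_mul, ← mul_div_mul_left _ _ z0, e3]
      congr 1
      linear_combination (z₁ * z₂ * conj (chord z₁ z₂ v)) * e1 + chord z₁ z₂ w * e2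
    obtain ⟨k, hk⟩ := Complex.conj_eq_iff_real.1 hr
    rw [div_eq_iff N3] at hk
    refine ⟨k, ?_, ?_, hk⟩
    · apply mul_right_cancel₀ N3
      rw [b2, hk]; ring
    · apply mul_right_cancel₀ N3
      rw [← b1, hk]; ring
  · rintro ⟨⟨a1, a2, a3⟩, k, k1, k2, k3⟩
    refine ⟨⟨a1, ?_⟩, ⟨a2, ?_⟩, ⟨a3, ?_⟩⟩
    · rw [k2, k3]; ring
    · rw [k1, k3]; ring
    · rw [k1, k2]; ring

lemma Inscribed.focal_iff (hnested : Ec.carrier ⊆ E.inside) (h : Inscribed E Ec T l z₁ z₂ z₃)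
    {w v : ℂ} {k : ℝ} : IsFocal E k z₁ z₂ z₃ w v ↔
      w + v - parS E Ec + l * conj (w * v - parC E Ec + E.p * E.q * k) = 0 ∧
        k = kap E.p E.q (parS E Ec) (parC E Ec) w v := by
  unfold IsFocal
  rw [inscribed_iff h.sym h.n₁ h.n₂ h.n₃ h.h₁₂ h.h₂₃ h.h₃₁,
    apol_eq_iff (den_pos E.q_nonneg E.q_lt_p (norm_parC_lt hnested)).ne']

lemma Inscribed.isogonal_iff (hnested : Ec.carrier ⊆ E.inside)
    (h : Inscribed E Ec T l z₁ z₂ z₃) {w v : ℂ} :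
    IsIsogonalConjugate T (E.pt w) (E.pt v) ↔ (w ≠ z₁ ∧ w ≠ z₂ ∧ w ≠ z₃) ∧
      w + v - parS E Ec + l * conj (w * v - parC E Ec +
        E.p * E.q * kap E.p E.q (parS E Ec) (parC E Ec) w v) = 0 := by
  rw [h.isogonal_iff_focal]
  simp only [h.focal_iff hnested]
  refine and_congr_right fun _ => ⟨?_, fun h => ⟨_, h, rfl⟩⟩
  rintro ⟨k, h1, rfl⟩
  exact h1

/-! ### Powers in the circumcircles and the swept region -/

lemma Inscribed.power (h : Inscribed E Ec T l z₁ z₂ z₃) (w : ℂ) :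
    dist (E.pt w) T.circumcenter ^ 2 - T.circumradius ^ 2 =
      alpha E.p E.q (parS E Ec) (parC E Ec) w -
        (l * (2 * (E.p * E.q) * beta (parS E Ec) (parC E Ec) w)).re := by
  set m := conj E.u * (T.circumcenter - E.center) with hm
  have e : ∀ z, dist (E.pt z) T.circumcenter = ‖E.p * z + E.q * conj z - m‖ := by
    intro z
    have : E.pt z - T.circumcenter = E.u * (E.p * z + E.q * conj z - m) := by
      rw [hm, Ellipse.pt]
      linear_combination (T.circumcenter - E.center) * mul_conj_one E.norm_u
    rw [dist_eq_norm, this, norm_mul, E.norm_u, one_mul]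
  have c := T.dist_circumcenter_eq_circumradius
  have c1 := c 0
  have c2 := c 1
  have c3 := c 2
  rw [h.pt₀, e] at c1
  rw [h.pt₁, e] at c2
  rw [h.pt₂, e] at c3
  rw [e, power_formula h.sym h.n₁ h.n₂ h.n₃ h.h₁₂ h.h₂₃ h.h₃₁ c1 c2 c3 w]
  have e2 : (l * (2 * (E.p * E.q) * beta (parS E Ec) (parC E Ec) w)).re =
      2 * (E.p * E.q) * (l * beta (parS E Ec) (parC E Ec) w).re := by
    have : l * (2 * (E.p * E.q) * beta (parS E Ec) (parC E Ec) w) =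
      ((2 * (E.p * E.q) : ℝ) : ℂ) * (l * beta (parS E Ec) (parC E Ec) w) := by push_cast; ring
    rw [this, Complex.re_ofReal_mul]
  rw [e2]
  unfold alpha beta
  rw [Complex.sub_re]
  ring

lemma exists_unit_re_eq {x : ℝ} {b : ℂ} (h : |x| ≤ ‖b‖) : ∃ l : ℂ, ‖l‖ = 1 ∧ (l * b).re = x := by
  by_cases hb : b = 0
  · refine ⟨1, by simp, ?_⟩
    rw [hb] at h ⊢
    rw [norm_zero] at h
    simpa using (abs_eq_zero.1 (h.antisymm (abs_nonneg x))).symm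
  have hn : (‖b‖ : ℂ) ≠ 0 := by simpa using hb
  have hn' : ‖b‖ ≠ 0 := by simpa using hb
  have hx : x ^ 2 ≤ ‖b‖ ^ 2 := sq_le_sq' (abs_le.1 h).1 (abs_le.1 h).2
  have hs := Real.sq_sqrt (sub_nonneg.2 hx)
  have hbb := Complex.mul_conj b
  rw [Complex.normSq_eq_norm_sq] at hbb
  push_cast at hbb
  -- The witness rotates `b` to the point of the same modulus with real part `x` and nonnegative
  -- imaginary part.
  have key : (⟨x, √(‖b‖ ^ 2 - x ^ 2)⟩ : ℂ) * conj b / ‖b‖ ^ 2 * b =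
      ⟨x, √(‖b‖ ^ 2 - x ^ 2)⟩ := by
    field_simp
    linear_combination (⟨x, √(‖b‖ ^ 2 - x ^ 2)⟩ : ℂ) * hbb
  refine ⟨⟨x, √(‖b‖ ^ 2 - x ^ 2)⟩ * conj b / ‖b‖ ^ 2, ?_, by rw [key]⟩
  have hnorm := congrArg norm key
  rw [norm_mul] at hnorm
  apply mul_right_cancel₀ hn'
  rw [hnorm, one_mul, ← sq_eq_sq₀ (norm_nonneg _) (norm_nonneg _), ← Complex.normSq_eq_norm_sq,
    Complex.normSq_mk]
  linarith

/-- The coefficient of the parameter in the power function. -/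
def gam (E Ec : Ellipse) (w : ℂ) : ℂ := 2 * (E.p * E.q) * beta (parS E Ec) (parC E Ec) w
def alp (E Ec : Ellipse) (w : ℂ) : ℝ := alpha E.p E.q (parS E Ec) (parC E Ec) w

/-- As `l` runs over the unit circle, `Re (l γ)` takes exactly the values in `[-|γ|, |γ|]`; the
point is swept when one of them equals `alp`, which makes its power zero. -/
lemma mem_swept_iff (hnested : Ec.carrier ⊆ E.inside) (hc : Closure E Ec) (w : ℂ) :
    E.pt w ∈ sweptRegion E Ec ↔ |alp E Ec w| ≤ ‖gam E Ec w‖ := by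
  unfold sweptRegion
  simp only [Set.mem_iUnion, exists_prop]
  constructor
  · rintro ⟨T, hT, hd⟩
    obtain ⟨-, l, z₁, z₂, z₃, h⟩ := exists_inscribed hT
    have hp := h.power w
    have hd' : dist (E.pt w) T.circumcenter = T.circumradius := hd
    rw [hd', sub_self] at hp
    have : alp E Ec w = (l * gam E Ec w).re := by unfold alp gam; linarith
    rw [this]
    refine (Complex.abs_re_le_norm _).trans_eq ?_
    rw [norm_mul, h.norm_param, one_mul]
  · intro hle
    obtain ⟨l, hl, hre⟩ := exists_unit_re_eq hle
    obtain ⟨T, z₁, z₂, z₃, h⟩ := exists_triangle_of_param (E := E) hnested hl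
    refine ⟨T, h.mem hc, ?_⟩
    have hp := h.power w
    have hd : dist (E.pt w) T.circumcenter ^ 2 = T.circumradius ^ 2 := by
      unfold alp gam at hre; linarith
    exact (sq_eq_sq₀ dist_nonneg T.circumradius_nonneg).1 hd

/-- Two uses: on the outer ellipse it gives `|alp| ≤ |gam|`, and it shows that `alp` and `gam` can
vanish together only there. -/
lemma alp_eq (E Ec : Ellipse) (w : ℂ) :
    alp E Ec w = (‖w‖ ^ 2 - 1) * den E.p E.q (parC E Ec) + (w * conj (gam E Ec w)).re := by
  have : w * conj (gam E Ec w) = ((2 * (E.p * E.q) : ℝ) : ℂ) *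
      (w ^ 2 - parS E Ec * w + parC E Ec + parC E Ec * ((‖w‖ ^ 2 - 1 : ℝ) : ℂ)) := by
    have h := Complex.mul_conj w
    rw [Complex.normSq_eq_norm_sq] at h
    push_cast at h ⊢
    unfold gam beta
    simp only [map_sub, map_add, map_mul, map_ofNat, Complex.conj_conj, Complex.conj_ofReal]
    linear_combination (2 * E.p * E.q * parC E Ec) * h
  rw [this, Complex.re_ofReal_mul, Complex.add_re, Complex.re_mul_ofReal]
  unfold alp alpha den
  ring

lemma abs_alp_le_of_norm_one {w : ℂ} (hw : ‖w‖ = 1) : |alp E Ec w| ≤ ‖gam E Ec w‖ := by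
  rw [alp_eq, hw]
  simp only [one_pow, sub_self, zero_mul, zero_add]
  refine (Complex.abs_re_le_norm _).trans_eq ?_
  rw [norm_mul, hw, one_mul, RCLike.norm_conj]

/-- If `Q ≠ Q'`, each reflected cevian contains both and is therefore the line `Q Q'`, which would
contain all three vertices. -/
lemma isogonal_unique {P Q Q' : ℂ} (hQ : IsIsogonalConjugate T P Q)
    (hQ' : IsIsogonalConjugate T P Q') : Q = Q' := by
  by_contra hne
  have hA : ∀ i, T.points i ∈ line[ℝ, Q, Q'] := by
    intro i
    obtain ⟨t, ht⟩ := mem_line_iff.1 (hQ i).2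
    obtain ⟨t', ht'⟩ := mem_line_iff.1 (hQ' i).2
    generalize EuclideanGeometry.reflection (bisector T i) P = R at *
    have htt : (t' : ℂ) - t ≠ 0 := by
      intro h
      apply hne
      rw [ht, ht', sub_eq_zero.1 h]
    rw [mem_line_iff]
    refine ⟨-t / (t' - t), ?_⟩
    push_cast
    rw [ht, ht']
    field_simp
    ring
  have hi := T.independent
  rw [affineIndependent_iff_not_collinear] at hi
  apply hi
  have h3 := collinear_triple_of_mem_affineSpan_pair (hA 0) (hA 1) (hA 2)
  refine h3.subset ?_
  rintro _ ⟨i, rfl⟩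
  fin_cases i <;> simp

lemma linear_coeff_eq_zero {a b c d : ℝ}
    (h : ∀ᶠ x in nhds (0 : ℝ), a * x + b * x ^ 2 + c * x ^ 3 + d * x ^ 4 ≤ 0) : a = 0 := by
  have hd : HasDerivAt (fun x : ℝ => a * x + b * x ^ 2 + c * x ^ 3 + d * x ^ 4) a 0 := by
    have := ((((hasDerivAt_id (0 : ℝ)).const_mul a).add
      (((hasDerivAt_id (0 : ℝ)).pow 2).const_mul b)).add
      (((hasDerivAt_id (0 : ℝ)).pow 3).const_mul c)).add
      (((hasDerivAt_id (0 : ℝ)).pow 4).const_mul d)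
    refine (this.congr_deriv (by simp)).congr_of_eventuallyEq ?_
    filter_upwards with x
    simp
  have hmax : IsLocalMax (fun x : ℝ => a * x + b * x ^ 2 + c * x ^ 3 + d * x ^ 4) 0 := by
    filter_upwards [h] with x hx
    simpa using hx
  exact hmax.hasDerivAt_eq_zero hd

lemma alp_line (E Ec : Ellipse) (w d : ℂ) : ∃ a₁ a₂ : ℝ, ∀ x : ℝ,
    alp E Ec (w + x * d) = alp E Ec w + a₁ * x + a₂ * x ^ 2 := by
  refine ⟨(E.p ^ 2 + E.q ^ 2) * (2 * (conj w * d).re) +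
    2 * (E.p * E.q) * (2 * w * d - parS E Ec * d).re,
    (E.p ^ 2 + E.q ^ 2) * ‖d‖ ^ 2 + 2 * (E.p * E.q) * (d ^ 2).re, fun x => ?_⟩
  unfold alp alpha
  simp only [← Complex.normSq_eq_norm_sq, Complex.normSq_apply]
  simp [pow_two]
  ring

lemma gam_line (E Ec : Ellipse) (w d : ℂ) : ∃ g₁ : ℂ, ∀ x : ℝ,
    gam E Ec (w + x * d) = gam E Ec w + x * g₁ := by
  refine ⟨2 * (E.p * E.q) * (conj d + conj (parC E Ec) * d), fun x => ?_⟩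
  unfold gam beta
  simp only [map_add, map_mul, Complex.conj_ofReal]
  ring

/-- Suppose `|alp| = |gam|` at `w`. Near an interior point `alp² - |gam|²` is nonpositive, so its
derivative at `w` is zero in every direction. For the `l` with `l γ = α` this makes the power in the
corresponding circumcircle, which passes through `P`, stationary towards the circumcentre; a circle
of positive radius has no such point. -/
lemma abs_alp_lt_of_interior (hnested : Ec.carrier ⊆ E.inside) (hc : Closure E Ec) {w : ℂ}
    (hP : E.pt w ∈ interior (sweptRegion E Ec)) (hw : ‖w‖ ≠ 1) :
    |alp E Ec w| < ‖gam E Ec w‖ := by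
  have hle := (mem_swept_iff hnested hc w).1 (interior_subset hP)
  refine lt_of_le_of_ne hle fun heq => ?_
  obtain ⟨l, hl, hre⟩ := exists_unit_re_eq hle
  have hM := den_pos E.q_nonneg E.q_lt_p (norm_parC_lt (E := E) hnested)
  have hl1 := mul_conj_one hl
  have hsq : alp E Ec w ^ 2 = ‖gam E Ec w‖ ^ 2 := by rw [← heq, sq_abs]
  have hlg : l * gam E Ec w = alp E Ec w := by
    have h1 : (l * gam E Ec w).im = 0 := by
      have : ‖l * gam E Ec w‖ ^ 2 = alp E Ec w ^ 2 := by rw [norm_mul, hl, one_mul, hsq]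
      rw [← Complex.normSq_eq_norm_sq, Complex.normSq_apply, hre] at this
      nlinarith [mul_self_nonneg (l * gam E Ec w).im]
    exact Complex.ext hre (by rw [h1]; simp)
  have hα : alp E Ec w ≠ 0 := by
    intro h0
    have hg : gam E Ec w = 0 := by
      rw [h0, abs_zero] at heq; exact norm_eq_zero.1 heq.symm
    have := alp_eq E Ec w
    rw [h0, hg] at this
    simp only [map_zero, mul_zero, Complex.zero_re, add_zero] at this
    have h2 := (mul_eq_zero.1 this.symm).resolve_right hM.ne'
    apply hw
    nlinarith [norm_nonneg w]
  obtain ⟨T, z₁, z₂, z₃, h⟩ := exists_triangle_of_param (E := E) hnested hl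
  set d := E.co T.circumcenter - w with hd
  obtain ⟨a₁, a₂, ha⟩ := alp_line E Ec w d
  obtain ⟨g₁, hg⟩ := gam_line E Ec w d
  have hnear : ∀ᶠ x : ℝ in nhds 0, E.pt (w + x * d) ∈ sweptRegion E Ec := by
    have hcont : Continuous fun x : ℝ => E.pt (w + x * d) := by
      unfold Ellipse.pt; fun_prop
    have : interior (sweptRegion E Ec) ∈ nhds (E.pt (w + ((0 : ℝ) : ℂ) * d)) :=
      isOpen_interior.mem_nhds (by simpa using hP)
    filter_upwards [hcont.continuousAt.preimage_mem_nhds this] with x hx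
    exact interior_subset hx
  have hlin : 2 * alp E Ec w * a₁ - 2 * (conj (gam E Ec w) * g₁).re = 0 := by
    refine linear_coeff_eq_zero (b := a₁ ^ 2 + 2 * alp E Ec w * a₂ - ‖g₁‖ ^ 2) (c := 2 * a₁ * a₂)
      (d := a₂ ^ 2) ?_
    filter_upwards [hnear] with x hx
    rw [mem_swept_iff hnested hc, ha, hg] at hx
    have h1 := sq_le_sq' ((neg_nonpos.2 (norm_nonneg _)).trans (abs_nonneg _)) hx
    rw [sq_abs] at h1
    have e : ‖gam E Ec w + x * g₁‖ ^ 2 = ‖gam E Ec w‖ ^ 2 + 2 * (conj (gam E Ec w) * g₁).re * x +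
        ‖g₁‖ ^ 2 * x ^ 2 := by
      simp only [← Complex.normSq_eq_norm_sq, Complex.normSq_apply]
      simp
      ring
    rw [e] at h1
    nlinarith
  have hg' : conj (gam E Ec w) = l * alp E Ec w := by
    have := congrArg conj hlg
    simp only [map_mul, Complex.conj_ofReal] at this
    rw [← this]; linear_combination (-conj (gam E Ec w)) * hl1
  have ha₁ : a₁ = (l * g₁).re := by
    have e : conj (gam E Ec w) * g₁ = (alp E Ec w : ℂ) * (l * g₁) := by rw [hg']; ring
    rw [e, Complex.re_ofReal_mul] at hlin
    have : 2 * alp E Ec w * (a₁ - (l * g₁).re) = 0 := by linear_combination hlin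
    have := (mul_eq_zero.1 this).resolve_left (mul_ne_zero two_ne_zero hα)
    linarith
  -- The displacements `d` and `-d` lead to the circumcentre, of power `-R²`, and to the antipode of
  -- it in `P`, of power `3 R²`. Without a linear term the two powers would coincide.
  have p1 := h.power (w + (1 : ℝ) * d)
  have p2 := h.power (w + (-1 : ℝ) * d)
  have p0 := h.power w
  change _ = alp E Ec _ - (l * gam E Ec _).re at p0 p1 p2
  rw [ha, hg, mul_add, Complex.add_re] at p1 p2
  have e1 : E.pt (w + ((1 : ℝ) : ℂ) * d) = T.circumcenter := by
    rw [hd]; push_cast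
    rw [show w + 1 * (E.co T.circumcenter - w) = E.co T.circumcenter by ring, E.pt_co]
  have e2 : E.pt (w + ((-1 : ℝ) : ℂ) * d) - T.circumcenter = 2 * (E.pt w - T.circumcenter) := by
    rw [← e1]; unfold Ellipse.pt
    simp only [map_add, map_mul, Complex.conj_ofReal]
    push_cast; ring
  rw [dist_eq_norm, e2, norm_mul, Complex.norm_ofNat, ← dist_eq_norm] at p2
  rw [e1, dist_self] at p1
  have hR := T.circumradius_pos
  rw [mul_left_comm, Complex.re_ofReal_mul] at p1 p2
  nlinarith [sq_pos_of_pos hR]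

/-- The vanishing of `off` makes `w` and its reflection `s - w` in the centre `o` solve the focal
equations for every `l`. For `D = w - o`, the formulas for `D²`, its conjugate and `D D̄` combine so
that `k` cancels, and `(p D + q D̄)²` is the squared focal vector of `Ec`. The closure condition
enters through `D D̄`. -/
lemma off_eq_zero_imp_focus (hnested : Ec.carrier ⊆ E.inside) (hc : Closure E Ec) {w : ℂ}
    (h : off E.p E.q (parS E Ec) (parC E Ec) w = 0) : E.pt w ∈ Ec.foci := by
  have hM := den_pos E.q_nonneg E.q_lt_p (norm_parC_lt (E := E) hnested)
  have hk := (apol_eq_iff (p := E.p) (q := E.q) (s := parS E Ec) (c := parC E Ec) (w := w)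
    (v := parS E Ec - w) hM.ne').2 rfl
  unfold off at h
  generalize kap E.p E.q (parS E Ec) (parC E Ec) w (parS E Ec - w) = k at *
  have hA := pull_rel_A E Ec
  have hB := pull_rel_B E Ec
  have hu := u_mul_rel E Ec
  have hO : E.pt (pullO E Ec) = Ec.center := E.pt_co _
  unfold Closure at hc
  unfold apol at hk
  unfold parS parC at h hk hc
  unfold parW at hc
  have h' := congrArg conj h
  simp only [map_add, map_sub, map_mul, map_pow, map_ofNat, map_zero, Complex.conj_ofReal]
    at h' hk hc
  set o := pullO E Ec
  set m := pullA E Ec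
  set n := pullB E Ec
  set D := w - o with hD
  have hw : w = o + D := by rw [hD]; ring
  have hw' : conj w = conj o + conj D := by rw [hw, map_add]
  rw [hw'] at h' hk
  clear_value D
  subst hw
  have q1 : D ^ 2 = 4 * (m * n) + E.p * E.q * k := by linear_combination -h
  have q2 : conj D ^ 2 = 4 * (conj m * conj n) + E.p * E.q * k := by linear_combination -h'
  have q3 : 2 * (D * conj D) + k * (E.p ^ 2 + E.q ^ 2) = 4 * (m * conj m + n * conj n) := by
    linear_combination -hk + (conj o ^ 2 - 4 * (conj m * conj n)) * h +
      (o ^ 2 - 4 * (m * n)) * h' - hc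
  have q4 : (E.p * D + E.q * conj D) ^ 2 = (√(Ec.a ^ 2 - Ec.b ^ 2) * rel E Ec) ^ 2 := by
    have hs : ((√(Ec.a ^ 2 - Ec.b ^ 2) : ℝ) : ℂ) ^ 2 = 4 * Ec.p * Ec.q := by
      have h0 : 0 ≤ Ec.a ^ 2 - Ec.b ^ 2 := by
        have := Ec.b_le_a; have := Ec.b_pos; nlinarith
      have := Real.sq_sqrt h0
      have h2 : Ec.a ^ 2 - Ec.b ^ 2 = 4 * Ec.p * Ec.q := by unfold Ellipse.p Ellipse.q; ring
      rw [h2] at this ⊢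
      exact_mod_cast this
    rw [mul_pow, hs]
    have e : 4 * Ec.p * Ec.q * rel E Ec ^ 2 = 4 * (rel E Ec * Ec.p) * (rel E Ec * Ec.q) := by ring
    rw [e, ← hA, ← hB]
    linear_combination E.p ^ 2 * q1 + E.q ^ 2 * q2 + E.p * E.q * q3
  have q5 : E.pt (o + D) = Ec.center + E.u * (E.p * D + E.q * conj D) := by
    rw [← hO]; unfold Ellipse.pt; rw [map_add]; ring
  unfold Ellipse.foci
  rw [q5]
  rcases sq_eq_sq_iff_eq_or_eq_neg.1 q4 with h0 | h0
  · left
    rw [h0, ← hu]; ring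
  · right
    rw [h0, ← hu]; simp only [Set.mem_singleton_iff]; ring

lemma Ellipse.co_sub (e : Ellipse) (X y : ℂ) : e.co X - y =
    ⟨(conj e.u * (X - e.pt y)).re / e.a, (conj e.u * (X - e.pt y)).im / e.b⟩ := by
  have h : conj e.u * (X - e.pt y) =
      ⟨e.a * (e.co X - y).re, e.b * (e.co X - y).im⟩ := by
    conv_lhs => rw [← e.pt_co X]
    rw [← e.pq_mk, Ellipse.pt, Ellipse.pt, map_sub]
    linear_combination (e.p * (e.co X - y) + e.q * (conj (e.co X) - conj y)) *
      mul_conj_one e.norm_u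
  have ha := e.a_pos.ne'
  have hb := e.b_pos.ne'
  rw [h]
  simp only [mul_div_cancel_left₀ _ ha, mul_div_cancel_left₀ _ hb, Complex.eta]

/-! ### The type of the locus -/

/-- The offset vector of the locus. -/
def offset (E Ec : Ellipse) (w : ℂ) : ℂ := off E.p E.q (parS E Ec) (parC E Ec) w

/-- Equality of moduli allows the focal equation to be solved for a unimodular `l`. The last clause
feeds `offset_ne_zero`: with zero offset, the same triangle also has `s - w` as a conjugate. -/
lemma exists_isogonal (hnested : Ec.carrier ⊆ E.inside) (hc : Closure E Ec) {w v : ℂ}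
    (hw : ‖w‖ ≠ 1) (hv : w + v - parS E Ec ≠ 0)
    (h : ‖w + v - parS E Ec‖ = ‖w * v - parC E Ec +
      E.p * E.q * kap E.p E.q (parS E Ec) (parC E Ec) w v‖) :
    ∃ T ∈ ponceletFamily E Ec, IsIsogonalConjugate T (E.pt w) (E.pt v) ∧
      (offset E Ec w = 0 → IsIsogonalConjugate T (E.pt w) (E.pt (parS E Ec - w))) := by
  set N := w * v - parC E Ec + E.p * E.q * kap E.p E.q (parS E Ec) (parC E Ec) w v with hN
  have hN0 : conj N ≠ 0 := by
    rw [map_ne_zero, ← norm_ne_zero_iff, ← h]; simpa using hv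
  have hl : ‖-(w + v - parS E Ec) / conj N‖ = 1 := by
    rw [norm_div, norm_neg, RCLike.norm_conj, h]
    exact div_self (by rw [← RCLike.norm_conj]; simpa using hN0)
  obtain ⟨T, z₁, z₂, z₃, hT⟩ := exists_triangle_of_param (E := E) hnested hl
  have hne : w ≠ z₁ ∧ w ≠ z₂ ∧ w ≠ z₃ :=
    ⟨fun h => hw (h ▸ hT.n₁), fun h => hw (h ▸ hT.n₂), fun h => hw (h ▸ hT.n₃)⟩
  refine ⟨T, hT.mem hc, (hT.isogonal_iff hnested).2 ⟨hne, ?_⟩, fun h0 =>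
    (hT.isogonal_iff hnested).2 ⟨hne, ?_⟩⟩
  · rw [← hN]; field_simp; ring
  · unfold offset off at h0
    rw [h0]; simp

lemma isogonalLocus_eq (hnested : Ec.carrier ⊆ E.inside) (hc : Closure E Ec) {w : ℂ}
    (hw : ‖w‖ ≠ 1) (hd : offset E Ec w ≠ 0) :
    isogonalLocus E Ec (E.pt w) = {X | gap (entA E.p E.q (parS E Ec) (parC E Ec) w)
      (entB E.p E.q (parS E Ec) (parC E Ec) w) w.im w.re (offset E Ec w).re (offset E Ec w).im
      ((conj E.u * (X - E.pt (parS E Ec - w))).re / E.a)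
      ((conj E.u * (X - E.pt (parS E Ec - w))).im / E.b) = 0} := by
  have hM := den_pos E.q_nonneg E.q_lt_p (norm_parC_lt (E := E) hnested)
  ext X
  obtain ⟨v, rfl⟩ : ∃ v, X = E.pt v := ⟨_, (E.pt_co X).symm⟩
  have hcs := E.co_sub (E.pt v) (parS E Ec - w)
  rw [E.co_pt] at hcs
  have hre := congrArg Complex.re hcs
  have him := congrArg Complex.im hcs
  simp only at hre him
  rw [Set.mem_ofPred_eq, ← hre, ← him, offset, ← conic_iff hM.ne']
  constructor
  · rintro ⟨T, hT, hi⟩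
    obtain ⟨-, l, z₁, z₂, z₃, h⟩ := exists_inscribed hT
    have h1 := ((h.isogonal_iff hnested).1 hi).2
    rw [eq_neg_of_add_eq_zero_left h1, norm_neg, norm_mul, h.norm_param, one_mul,
      RCLike.norm_conj]
  · intro h
    -- At `v = s - w` the parameter could not be recovered; the nonzero offset keeps that point off
    -- the conic.
    have hv : w + v - parS E Ec ≠ 0 := by
      intro h0
      apply hd
      rw [h0, norm_zero, eq_comm, norm_eq_zero] at h
      have : v = parS E Ec - w := by linear_combination h0
      rwa [this] at h
    obtain ⟨T, hT, hi, -⟩ := exists_isogonal hnested hc hw hv h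
    exact ⟨T, hT, hi⟩

lemma den_sq_mul_gapDet (hnested : Ec.carrier ⊆ E.inside) (w : ℂ) :
    den E.p E.q (parC E Ec) ^ 2 * gapDet (entA E.p E.q (parS E Ec) (parC E Ec) w)
      (entB E.p E.q (parS E Ec) (parC E Ec) w) w.im w.re =
      |alp E Ec w| ^ 2 - ‖gam E Ec w‖ ^ 2 := by
  have hM := den_pos E.q_nonneg E.q_lt_p (norm_parC_lt (E := E) hnested)
  have : (2 * (E.p * E.q) : ℂ) = ((2 * (E.p * E.q) : ℝ) : ℂ) := by push_cast; rfl
  rw [gapDet_ent hM.ne', sq_abs, alp, gam, this, norm_mul, Complex.norm_real, Real.norm_eq_abs,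
    mul_pow |_|, sq_abs]

lemma ne_zero_re_or_im {z : ℂ} (h : z ≠ 0) : z.re ≠ 0 ∨ z.im ≠ 0 := by
  by_contra! h0
  exact h (Complex.ext h0.1 h0.2)

lemma isEllipse_locus (hnested : Ec.carrier ⊆ E.inside) (hc : Closure E Ec) {w : ℂ}
    (h : ‖gam E Ec w‖ < |alp E Ec w|) (hf : E.pt w ∉ Ec.foci) :
    IsEllipse (isogonalLocus E Ec (E.pt w)) := by
  have hM := den_pos E.q_nonneg E.q_lt_p (norm_parC_lt (E := E) hnested)
  have hw : ‖w‖ ≠ 1 := fun hw => (abs_alp_le_of_norm_one hw).not_gt h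
  have hd : offset E Ec w ≠ 0 := fun h0 => hf (off_eq_zero_imp_focus hnested hc h0)
  rw [isogonalLocus_eq hnested hc hw hd]
  refine isEllipse_gap E.a_pos E.b_pos ?_ (ne_zero_re_or_im hd) E.norm_u _
  have := den_sq_mul_gapDet (E := E) hnested w
  have h2 : 0 < |alp E Ec w| ^ 2 - ‖gam E Ec w‖ ^ 2 := by
    nlinarith [norm_nonneg (gam E Ec w)]
  rw [← this] at h2
  exact pos_of_mul_pos_right h2 (by positivity)

lemma exists_isotropic {A B C : ℝ} (h : A * C - B ^ 2 < 0) :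
    ∃ x y : ℝ, (x ≠ 0 ∨ y ≠ 0) ∧ A * x ^ 2 + 2 * B * (x * y) + C * y ^ 2 = 0 := by
  by_cases hA : A = 0
  · exact ⟨1, 0, by simp, by simp [hA]⟩
  · have hs := Real.sq_sqrt (show 0 ≤ B ^ 2 - A * C by linarith)
    exact ⟨-B + √(B ^ 2 - A * C), A, Or.inr hA, by linear_combination A * hs⟩

/-- With zero offset the equation is a homogeneous indefinite form in `v - (s - w)`, so it has a
nonzero isotropic vector. The resulting `v` and the point `s - w` would be two distinct conjugates
for one triangle. -/
lemma offset_ne_zero (hnested : Ec.carrier ⊆ E.inside) (hc : Closure E Ec) {w : ℂ}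
    (hw : ‖w‖ ≠ 1) (h : |alp E Ec w| < ‖gam E Ec w‖) : offset E Ec w ≠ 0 := by
  intro h0
  have hM := den_pos E.q_nonneg E.q_lt_p (norm_parC_lt (E := E) hnested)
  have hdet : gapDet (entA E.p E.q (parS E Ec) (parC E Ec) w)
      (entB E.p E.q (parS E Ec) (parC E Ec) w) w.im w.re < 0 := by
    have := den_sq_mul_gapDet (E := E) hnested w
    by_contra hcon
    nlinarith [mul_nonneg (sq_nonneg (den E.p E.q (parC E Ec))) (not_lt.1 hcon),
      abs_nonneg (alp E Ec w)]
  obtain ⟨x, y, hxy, hq⟩ := exists_isotropic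
    (A := 1 - entA E.p E.q (parS E Ec) (parC E Ec) w ^ 2 - w.im ^ 2)
    (C := 1 - entB E.p E.q (parS E Ec) (parC E Ec) w ^ 2 - w.re ^ 2)
    (B := -(entA E.p E.q (parS E Ec) (parC E Ec) w * entB E.p E.q (parS E Ec) (parC E Ec) w +
      w.im * w.re)) (by
    unfold gapDet at hdet
    linear_combination hdet)
  set v : ℂ := parS E Ec - w + ⟨x, y⟩ with hv
  have hd : v - (parS E Ec - w) = ⟨x, y⟩ := by rw [hv]; ring
  have hgap := (conic_iff (p := E.p) (q := E.q) (s := parS E Ec) (c := parC E Ec) (w := w)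
    (v := v) hM.ne').2 (by
      change gap _ _ _ _ (offset E Ec w).re (offset E Ec w).im _ _ = 0
      rw [h0, hd]
      simp only [gap, Complex.zero_re, Complex.zero_im]
      linear_combination hq)
  have hv0 : w + v - parS E Ec ≠ 0 := by
    have : w + v - parS E Ec = ⟨x, y⟩ := by rw [hv]; ring
    rw [this]
    intro h1
    have hx := congrArg Complex.re h1
    have hy := congrArg Complex.im h1
    simp only [Complex.zero_re, Complex.zero_im] at hx hy
    rcases hxy with hxy | hxy
    · exact hxy hx
    · exact hxy hy
  obtain ⟨T, -, h1, h2⟩ := exists_isogonal hnested hc hw hv0 hgap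
  have := E.pt_injective (isogonal_unique h1 (h2 h0))
  exact hv0 (by rw [this]; ring)

lemma isHyperbola_locus (hnested : Ec.carrier ⊆ E.inside) (hc : Closure E Ec) {w : ℂ}
    (hw : ‖w‖ ≠ 1) (h : |alp E Ec w| < ‖gam E Ec w‖) :
    IsHyperbola (isogonalLocus E Ec (E.pt w)) := by
  have hM := den_pos E.q_nonneg E.q_lt_p (norm_parC_lt (E := E) hnested)
  have hd := offset_ne_zero hnested hc hw h
  rw [isogonalLocus_eq hnested hc hw hd]
  refine isHyperbola_gap E.a_pos E.b_pos ?_ (ne_zero_re_or_im hd)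
    (gap_nondeg E.q_nonneg E.q_lt_p (norm_parC_lt hnested) hw hd) E.norm_u _
  have := den_sq_mul_gapDet (E := E) hnested w
  by_contra hcon
  nlinarith [mul_nonneg (sq_nonneg (den E.p E.q (parC E Ec))) (not_lt.1 hcon),
    abs_nonneg (alp E Ec w)]

/-! ### Tangent lines and the apexes over them -/

lemma eq_line_of_finrank {L : AffineSubspace ℝ ℂ} (h : Module.finrank ℝ L.direction = 1) {X Y : ℂ}
    (hX : X ∈ L) (hY : Y ∈ L) (hne : X ≠ Y) : L = line[ℝ, X, Y] := by
  have hle : line[ℝ, X, Y] ≤ L := affineSpan_pair_le_of_mem_of_mem hX hY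
  refine (AffineSubspace.eq_of_direction_eq_of_nonempty_of_le ?_
    ⟨X, left_mem_affineSpan_pair ℝ X Y⟩ hle).symm
  apply Submodule.eq_of_le_of_finrank_eq (AffineSubspace.direction_le hle)
  rw [h, finrank_direction_line hne]

lemma exists_mem_ne {L : AffineSubspace ℝ ℂ} (h : Module.finrank ℝ L.direction = 1) {X : ℂ}
    (hX : X ∈ L) : ∃ Y ∈ L, Y ≠ X := by
  obtain ⟨v, hv, -⟩ := finrank_eq_one_iff'.1 h
  refine ⟨(v : ℂ) +ᵥ X, AffineSubspace.vadd_mem_of_mem_direction v.2 hX, ?_⟩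
  simpa using hv

/-- There are exactly two tangents from a point outside an ellipse. -/
lemma Ellipse.exists_tangents (e : Ellipse) {P : ℂ} (hP : P ∈ e.outside) :
    ∃ l₁ l₂ : AffineSubspace ℝ ℂ, l₁ ≠ l₂ ∧ e.tangentsFrom P = {l₁, l₂} := by
  obtain ⟨w, rfl⟩ : ∃ w, P = e.pt w := ⟨_, (e.pt_co P).symm⟩
  rw [Ellipse.outside, Set.mem_ofPred_eq, e.form_eq, e.co_pt] at hP
  have hn0 : (‖w‖ : ℂ) ^ 2 ≠ 0 := by
    have : ‖w‖ ^ 2 ≠ 0 := by linarith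
    exact_mod_cast this
  have hww := Complex.mul_conj w
  rw [Complex.normSq_eq_norm_sq] at hww
  push_cast at hww
  have hs := Real.sq_sqrt (show 0 ≤ ‖w‖ ^ 2 - 1 by linarith)
  have hs0 : 0 < √(‖w‖ ^ 2 - 1) := Real.sqrt_pos.2 (by linarith)
  set r := √(‖w‖ ^ 2 - 1) with hr
  have norm_conj_mul : ∀ x : ℂ, (conj w * x).re ^ 2 + (conj w * x).im ^ 2 = ‖w‖ ^ 2 * ‖x‖ ^ 2 := by
    intro x
    rw [← mul_pow, ← RCLike.norm_conj w, ← norm_mul, ← Complex.normSq_eq_norm_sq,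
      Complex.normSq_apply]
    ring
  have norm_sub : ∀ x : ℂ, ‖w - x‖ ^ 2 = ‖w‖ ^ 2 + ‖x‖ ^ 2 - 2 * (conj w * x).re := by
    intro x
    simp only [← Complex.normSq_eq_norm_sq, Complex.normSq_apply]
    simp
    ring
  have hwx : ∀ x : ℂ, ‖x‖ = 1 → w ≠ x := by
    rintro x hx rfl
    rw [hx] at hP; norm_num at hP
  have tan_iff : ∀ x : ℂ, ‖x‖ = 1 → (e.IsTangentLine line[ℝ, e.pt w, e.pt x] ↔
      (conj w * x).re = 1) := by
    intro x hx
    rw [e.isTangentLine_iff (hwx x hx), norm_sub]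
    have := norm_conj_mul x
    rw [hx] at this ⊢
    constructor
    · intro h
      have : ((conj w * x).re - 1) ^ 2 = 0 := by linarith
      linarith [pow_eq_zero_iff two_ne_zero |>.1 this]
    · intro h
      rw [h] at this ⊢
      linarith
  have pts : ∀ t : ℝ, t ^ 2 = ‖w‖ ^ 2 - 1 → ‖w * (1 + t * Complex.I) / ‖w‖ ^ 2‖ = 1 ∧
      conj w * (w * (1 + t * Complex.I) / ‖w‖ ^ 2) = 1 + t * Complex.I := by
    intro t ht
    have h2 : conj w * (w * (1 + t * Complex.I) / ‖w‖ ^ 2) = 1 + t * Complex.I := by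
      rw [mul_div_assoc', div_eq_iff hn0]
      linear_combination (1 + t * Complex.I) * hww
    refine ⟨?_, h2⟩
    have h3 := norm_conj_mul (w * (1 + t * Complex.I) / ‖w‖ ^ 2)
    rw [h2] at h3
    simp at h3
    have h4 : ‖w * (1 + t * Complex.I) / ‖w‖ ^ 2‖ ^ 2 = 1 := by
      apply mul_left_cancel₀ (show ‖w‖ ^ 2 ≠ 0 by linarith)
      simp
      linarith
    nlinarith [norm_nonneg (w * (1 + t * Complex.I) / ‖w‖ ^ 2)]
  obtain ⟨n₁, k₁⟩ := pts r hs
  obtain ⟨n₂, k₂⟩ := pts (-r) (by rw [neg_sq, hs])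
  set x₁ := w * (1 + r * Complex.I) / ‖w‖ ^ 2 with hx₁
  set x₂ := w * (1 + (-r : ℝ) * Complex.I) / ‖w‖ ^ 2 with hx₂
  have t₁ := (tan_iff x₁ n₁).2 (by rw [k₁]; simp)
  have t₂ := (tan_iff x₂ n₂).2 (by rw [k₂]; simp)
  refine ⟨line[ℝ, e.pt w, e.pt x₁], line[ℝ, e.pt w, e.pt x₂], ?_, ?_⟩
  · intro heq
    obtain ⟨X, hX⟩ := t₁.2
    have m₁ : e.pt x₁ ∈ (line[ℝ, e.pt w, e.pt x₁] : Set ℂ) ∩ e.carrier :=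
      ⟨right_mem_affineSpan_pair ℝ _ _, e.pt_mem_carrier.2 n₁⟩
    have m₂ : e.pt x₂ ∈ (line[ℝ, e.pt w, e.pt x₁] : Set ℂ) ∩ e.carrier :=
      ⟨by rw [heq]; exact right_mem_affineSpan_pair ℝ _ _, e.pt_mem_carrier.2 n₂⟩
    rw [hX] at m₁ m₂
    have hx : x₁ = x₂ := e.pt_injective (m₁.trans m₂.symm)
    rw [hx, k₂] at k₁
    have := congrArg Complex.im k₁
    simp at this
    linarith
  · ext L
    constructor
    · rintro ⟨⟨hL, X, hX⟩, hPL⟩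
      obtain ⟨hXL, hXc⟩ : X ∈ (L : Set ℂ) ∩ e.carrier := by rw [hX]; rfl
      obtain ⟨x, rfl⟩ : ∃ x, X = e.pt x := ⟨_, (e.pt_co X).symm⟩
      have nx := e.pt_mem_carrier.1 hXc
      have hLe := eq_line_of_finrank hL hPL hXL (fun h => hwx x nx (e.pt_injective h))
      have hT : e.IsTangentLine line[ℝ, e.pt w, e.pt x] := by rw [← hLe]; exact ⟨hL, _, hX⟩
      have hre := (tan_iff x nx).1 hT
      have him := norm_conj_mul x
      rw [hre, nx] at him
      have hx : ∀ t : ℝ, (conj w * x).im = t → x = w * (1 + t * Complex.I) / ‖w‖ ^ 2 := by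
        intro t ht
        have h1 : conj w * x = 1 + t * Complex.I := by
          apply Complex.ext
          · simp [hre]
          · simp [ht]
        rw [eq_div_iff hn0, ← hww, ← h1]; ring
      have h0 : ((conj w * x).im - r) * ((conj w * x).im + r) = 0 := by linear_combination him - hs
      rcases mul_eq_zero.1 h0 with h0 | h0
      · left
        rw [hLe, hx r (by linarith)]
      · right
        rw [hLe, hx (-r) (by linarith)]
        rfl
    · rintro (rfl | rfl)
      · exact ⟨t₁, left_mem_affineSpan_pair ℝ _ _⟩
      · exact ⟨t₂, left_mem_affineSpan_pair ℝ _ _⟩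

lemma exists_chord (hnested : Ec.carrier ⊆ E.inside) {L : AffineSubspace ℝ ℂ}
    (hL : Ec.IsTangentLine L) : ∃ a b : ℂ, ‖a‖ = 1 ∧ ‖b‖ = 1 ∧ a ≠ b ∧
      L = line[ℝ, E.pt a, E.pt b] := by
  obtain ⟨hfin, X, hX⟩ := hL
  obtain ⟨hXL, hXc⟩ : X ∈ (L : Set ℂ) ∩ Ec.carrier := by rw [hX]; rfl
  obtain ⟨Y, hYL, hYX⟩ := exists_mem_ne hfin hXL
  have hin := hnested hXc
  obtain ⟨x, rfl⟩ : ∃ x, X = E.pt x := ⟨_, (E.pt_co X).symm⟩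
  obtain ⟨y, rfl⟩ : ∃ y, Y = E.pt y := ⟨_, (E.pt_co Y).symm⟩
  rw [Ellipse.inside, Set.mem_ofPred_eq, E.form_eq, E.co_pt] at hin
  have hyx : y - x ≠ 0 := sub_ne_zero.2 fun h => hYX (by rw [h])
  have hα : 0 < ‖y - x‖ ^ 2 := by have := norm_pos_iff.2 hyx; positivity
  set β := (conj x * (y - x)).re with hβ
  -- The point of tangency is inside the unit circle, so the quadratic for the intersections has
  -- constant term `|x|² - 1 < 0` and two distinct real roots.
  have hdisc : 0 < β ^ 2 - ‖y - x‖ ^ 2 * (‖x‖ ^ 2 - 1) := by nlinarith [sq_nonneg β]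
  have hs := Real.sq_sqrt hdisc.le
  have hs0 := Real.sqrt_pos.2 hdisc
  set r := √(β ^ 2 - ‖y - x‖ ^ 2 * (‖x‖ ^ 2 - 1)) with hr
  have key : ∀ t : ℝ, (‖y - x‖ ^ 2 * t + β) ^ 2 = r ^ 2 → ‖x + t * (y - x)‖ = 1 := by
    intro t ht
    have e1 : ‖x + t * (y - x)‖ ^ 2 = ‖y - x‖ ^ 2 * t ^ 2 + 2 * β * t + ‖x‖ ^ 2 := by
      rw [hβ]
      simp only [← Complex.normSq_eq_norm_sq, Complex.normSq_apply]
      simp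
      ring
    rw [hs] at ht
    have e2 : ‖x + t * (y - x)‖ ^ 2 = 1 := by
      apply mul_left_cancel₀ hα.ne'
      rw [e1]; linarith
    nlinarith [norm_nonneg (x + t * (y - x))]
  have mem : ∀ t : ℝ, E.pt (x + t * (y - x)) ∈ L := by
    intro t
    refine (affineSpan_pair_le_of_mem_of_mem hXL hYL : line[ℝ, E.pt x, E.pt y] ≤ L) ?_
    exact E.pt_mem_line.2 ⟨t, rfl⟩
  have hne : x + (((-β + r) / ‖y - x‖ ^ 2 : ℝ) : ℂ) * (y - x) ≠
      x + (((-β - r) / ‖y - x‖ ^ 2 : ℝ) : ℂ) * (y - x) := by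
    intro h
    have h1 : (-β + r) / ‖y - x‖ ^ 2 = (-β - r) / ‖y - x‖ ^ 2 := by
      exact_mod_cast mul_right_cancel₀ hyx (add_left_cancel h)
    rw [div_left_inj' hα.ne'] at h1
    linarith
  refine ⟨_, _, key ((-β + r) / ‖y - x‖ ^ 2) ?_, key ((-β - r) / ‖y - x‖ ^ 2) ?_, hne,
    eq_line_of_finrank hfin (mem _) (mem _) fun h => hne (E.pt_injective h)⟩
  · rw [mul_div_cancel₀ _ hα.ne']; ring
  · rw [mul_div_cancel₀ _ hα.ne']; ring

lemma Sym.swap {s c : ℂ} (h : Sym s c l z₁ z₂ z₃) : Sym s c l z₁ z₃ z₂ :=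
  ⟨by linear_combination h.one, by linear_combination h.two, by linear_combination h.three⟩

lemma param_den_ne_zero (hnested : Ec.carrier ⊆ E.inside) {a : ℂ} (ha : ‖a‖ = 1) :
    1 - conj (parS E Ec) * a + conj (parC E Ec) * a ^ 2 ≠ 0 := by
  obtain ⟨f, g, hf, hg, hs, hc⟩ := exists_foci E Ec hnested
  have : 1 - conj (parS E Ec) * a + conj (parC E Ec) * a ^ 2 =
      (1 - conj f * a) * (1 - conj g * a) := by
    rw [hs, hc]; simp only [map_add, map_mul]; ring
  rw [this]
  exact mul_ne_zero (one_sub_conj_mul_ne hf ha) (one_sub_conj_mul_ne hg ha)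

/-- A tangent chord is the base of a Poncelet triangle. -/
lemma exists_apex (hnested : Ec.carrier ⊆ E.inside) (hc : Closure E Ec) {a b : ℂ} (ha : ‖a‖ = 1)
    (hT : Tan (parS E Ec) (parC E Ec) (parW E Ec) a b) :
    ∃ l y, ‖y‖ = 1 ∧ y ≠ a ∧ b ≠ y ∧ Sym (parS E Ec) (parC E Ec) l y a b := by
  obtain ⟨f, g, hf, hg, hs, hcc⟩ := exists_foci E Ec hnested
  have hL := param_den_ne_zero (E := E) hnested ha
  set L := 1 - conj (parS E Ec) * a + conj (parC E Ec) * a ^ 2 with hLdef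
  have a1 := mul_conj_one ha
  -- This makes the Blaschke value `l` at `a` unimodular, so `a` is a vertex of the triangle with
  -- parameter `l`.
  have hN : a ^ 2 - parS E Ec * a + parC E Ec = a ^ 2 * conj L := by
    rw [hLdef]
    simp only [map_add, map_sub, map_mul, map_pow, map_one, Complex.conj_conj]
    linear_combination (parS E Ec * a - parC E Ec * (a * conj a + 1)) * a1
  obtain ⟨l, hl⟩ : ∃ l, l = a * (a ^ 2 - parS E Ec * a + parC E Ec) / L := ⟨_, rfl⟩
  have hl1 : ‖l‖ = 1 := by
    rw [hl, hN, norm_div, norm_mul, norm_mul, norm_pow, ha, RCLike.norm_conj, one_pow, one_mul,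
      one_mul, div_self (norm_ne_zero_iff.2 hL)]
  rw [eq_div_iff hL] at hl
  have main : ∀ z₁ z₂ z₃, Sym (parS E Ec) (parC E Ec) l z₁ z₂ z₃ → ‖z₂‖ = 1 → ‖z₃‖ = 1 →
      z₁ ≠ z₂ → z₂ ≠ z₃ → z₃ ≠ z₁ → a = z₁ → ∃ l y, ‖y‖ = 1 ∧ y ≠ a ∧ b ≠ y ∧
        Sym (parS E Ec) (parC E Ec) l y a b := by
    rintro z₁ z₂ z₃ h n₂ n₃ h₁₂ h₂₃ h₃₁ rfl
    obtain ⟨e1, e2⟩ := tan_pair h₂₃ h.tan h.swap.tan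
    rw [Closure] at hc
    rw [hc] at hT
    unfold Tan at hT
    -- The endpoints of the tangent chords from `a` are the roots of one quadratic, with roots `z₂`
    -- and `z₃`; hence `b` is one of them.
    have : L * ((b - z₂) * (b - z₃)) = 0 := by
      linear_combination e1 - b * e2 + hT + (b ^ 2) * hLdef
    rcases mul_eq_zero.1 ((mul_eq_zero.1 this).resolve_left hL) with h0 | h0
    · obtain rfl : b = z₂ := sub_eq_zero.1 h0
      exact ⟨l, z₃, n₃, h₃₁, h₂₃, h.rot.rot⟩
    · obtain rfl : b = z₃ := sub_eq_zero.1 h0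
      exact ⟨l, z₂, n₂, h₁₂.symm, h₂₃.symm, h.swap.rot.rot⟩
  obtain ⟨T, z₁, z₂, z₃, h⟩ := exists_triangle_of_param (E := E) hnested hl1
  have hroot : (a - z₁) * ((a - z₂) * (a - z₃)) = 0 := by
    linear_combination -hl - a ^ 2 * h.sym.one + a * h.sym.two - h.sym.three + l * hLdef
  rcases mul_eq_zero.1 hroot with h0 | h0
  · exact main _ _ _ h.sym h.n₂ h.n₃ h.h₁₂ h.h₂₃ h.h₃₁ (sub_eq_zero.1 h0)
  rcases mul_eq_zero.1 h0 with h0 | h0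
  · exact main _ _ _ h.sym.rot h.n₃ h.n₁ h.h₂₃ h.h₃₁ h.h₁₂ (sub_eq_zero.1 h0)
  · exact main _ _ _ h.sym.rot.rot h.n₁ h.n₂ h.h₃₁ h.h₁₂ h.h₂₃ (sub_eq_zero.1 h0)

lemma isApexOver_iff (hc : Closure E Ec) {L : AffineSubspace ℝ ℂ} {Z : ℂ} :
    IsApexOver E Ec L Z ↔ ∃ l y a b, ‖y‖ = 1 ∧ ‖a‖ = 1 ∧ ‖b‖ = 1 ∧ y ≠ a ∧ a ≠ b ∧ b ≠ y ∧
      Sym (parS E Ec) (parC E Ec) l y a b ∧ E.pt y = Z ∧ line[ℝ, E.pt a, E.pt b] = L := by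
  constructor
  · rintro ⟨T, hT, i, hZ, hL⟩
    obtain ⟨-, l, z₁, z₂, z₃, h⟩ := exists_inscribed hT
    fin_cases i
    · exact ⟨l, z₁, z₂, z₃, h.n₁, h.n₂, h.n₃, h.h₁₂, h.h₂₃, h.h₃₁, h.sym,
        by rw [← h.pt₀]; exact hZ, by rw [← h.pt₁, ← h.pt₂]; exact hL⟩
    · exact ⟨l, z₂, z₃, z₁, h.n₂, h.n₃, h.n₁, h.h₂₃, h.h₃₁, h.h₁₂, h.sym.rot,
        by rw [← h.pt₁]; exact hZ, by rw [← h.pt₂, ← h.pt₀]; exact hL⟩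
    · exact ⟨l, z₃, z₁, z₂, h.n₃, h.n₁, h.n₂, h.h₃₁, h.h₁₂, h.h₂₃, h.sym.rot.rot,
        by rw [← h.pt₂]; exact hZ, by rw [← h.pt₀, ← h.pt₁]; exact hL⟩
  · rintro ⟨l, y, a, b, ny, na, nb, h1, h2, h3, hs, rfl, rfl⟩
    obtain ⟨T, h⟩ := exists_triangle ny na nb h1 h2 h3 hs
    exact ⟨T, h.mem hc, 0, h.pt₀, by rw [side_zero, h.pt₁, h.pt₂]⟩

lemma chord_factor {a b v : ℂ} (hv : ‖v‖ = 1) (h : chord a b v = 0) : v = a ∨ v = b := by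
  have := chord_vertex (z₁ := a) (z₂ := b) hv
  rw [h, mul_zero, eq_comm, neg_eq_zero] at this
  rcases mul_eq_zero.1 this with h | h
  · exact Or.inl (sub_eq_zero.1 h)
  · exact Or.inr (sub_eq_zero.1 h)

lemma param_unique (hnested : Ec.carrier ⊆ E.inside) {l' x y z x' y' : ℂ} (hx : ‖x‖ = 1)
    (h : Sym (parS E Ec) (parC E Ec) l x y z) (h' : Sym (parS E Ec) (parC E Ec) l' x x' y') :
    l = l' :=
  mul_right_cancel₀ (param_den_ne_zero (E := E) hnested hx) (h.param.trans h'.param.symm)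

/-- The tangent line cuts `E` in two points, either of which determines `l`; the third vertex is
then given by the sum of the vertices. -/
lemma existsUnique_apex (hnested : Ec.carrier ⊆ E.inside) (hc : Closure E Ec)
    {L : AffineSubspace ℝ ℂ} (hL : Ec.IsTangentLine L) :
    ∃ Z, ∀ Z', IsApexOver E Ec L Z' ↔ Z' = Z := by
  obtain ⟨a, b, na, nb, hab, rfl⟩ := exists_chord (E := E) hnested hL
  obtain ⟨l, y, ny, hya, hby, hs⟩ := exists_apex hnested hc na
    ((isTangentLine_chord E Ec na nb hab).1 hL)
  refine ⟨E.pt y, fun Z' => ?_⟩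
  rw [isApexOver_iff hc]
  constructor
  · rintro ⟨l', y', a', b', ny', na', nb', h1, h2, h3, hs', rfl, hline⟩
    have ma : chord a b a' = 0 := (E.pt_mem_chord na nb hab).1
      (by rw [← hline]; exact left_mem_affineSpan_pair ℝ _ _)
    have mb : chord a b b' = 0 := (E.pt_mem_chord na nb hab).1
      (by rw [← hline]; exact right_mem_affineSpan_pair ℝ _ _)
    congr 1
    have fin : ∀ {l' y' a' b' : ℂ}, Sym (parS E Ec) (parC E Ec) l' y' a' b' → a' = a → b' = b →
        y' = y := by
      rintro l' y' _ _ h' rfl rfl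
      have := param_unique hnested na hs.rot h'.rot
      subst this
      linear_combination h'.one - hs.one
    rcases chord_factor na' ma with ha | ha <;> rcases chord_factor nb' mb with hb | hb
    · exact absurd (ha.trans hb.symm) h2
    · exact fin hs' ha hb
    · exact fin hs'.swap hb ha
    · exact absurd (ha.trans hb.symm) h2
  · rintro rfl
    exact ⟨l, y, a, b, ny, na, nb, hya, hab, hby, hs, rfl, rfl⟩

/-- The degenerate case `k = 0`: the base line contains `P`, and the two other side lines contain
the apex. -/
lemma apex_mem_locus (hc : Closure E Ec) {w Z : ℂ} {L : AffineSubspace ℝ ℂ} (hw : ‖w‖ ≠ 1)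
    (hL : E.pt w ∈ L) (h : IsApexOver E Ec L Z) :
    Z ∈ isogonalLocus E Ec (E.pt w) ∩ E.carrier := by
  obtain ⟨l, y, a, b, ny, na, nb, h1, h2, h3, hs, rfl, rfl⟩ := (isApexOver_iff hc).1 h
  obtain ⟨T, hT⟩ := exists_triangle ny na nb h1 h2 h3 hs
  refine ⟨⟨T, hT.mem hc, hT.isogonal_iff_focal.2 ⟨⟨?_, ?_, ?_⟩, 0, ?_, ?_, ?_⟩⟩,
    E.pt_mem_carrier.2 ny⟩
  · rintro rfl; exact hw ny
  · rintro rfl; exact hw na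
  · rintro rfl; exact hw nb
  · rw [(E.pt_mem_chord na nb h2).1 hL]; simp
  · have : chord b y y = 0 := by unfold chord; linear_combination -b * mul_conj_one ny
    rw [this]; simp
  · have : chord y a y = 0 := by unfold chord; linear_combination -a * mul_conj_one ny
    rw [this]; simp

/-- The apex determines `l`, hence the sum and the product of the other two vertices. -/
lemma apex_injective (hnested : Ec.carrier ⊆ E.inside) (hc : Closure E Ec) {Z : ℂ}
    {L L' : AffineSubspace ℝ ℂ} (h : IsApexOver E Ec L Z) (h' : IsApexOver E Ec L' Z) :
    L = L' := by
  obtain ⟨l, y, a, b, ny, na, nb, h1, h2, h3, hs, rfl, rfl⟩ := (isApexOver_iff hc).1 h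
  obtain ⟨l', y', a', b', ny', na', nb', h1', h2', h3', hs', hy, rfl⟩ := (isApexOver_iff hc).1 h'
  obtain rfl := E.pt_injective hy
  obtain rfl := param_unique hnested ny hs hs'
  have e1 : a + b = a' + b' := by linear_combination hs.one - hs'.one
  have e2 : a * b = a' * b' :=
    mul_left_cancel₀ (ne_zero_of_norm_one ny) (by linear_combination hs.three - hs'.three)
  have e3 : (a - a') * (a - b') = 0 := by linear_combination a * e1 - e2
  rcases mul_eq_zero.1 e3 with h0 | h0
  · obtain rfl := sub_eq_zero.1 h0
    obtain rfl := add_left_cancel e1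
    rfl
  · obtain rfl := sub_eq_zero.1 h0
    obtain rfl : b = a' := by linear_combination e1
    rw [Set.pair_comm]

/-! ### The intersection of the locus with the outer ellipse -/

lemma two_chords {a b c w : ℂ} (hb : ‖b‖ = 1) (hac : a ≠ c) (h1 : chord a b w = 0)
    (h2 : chord b c w = 0) : ‖w‖ = 1 := by
  unfold chord at h1 h2
  have h3 : b * conj w = 1 := mul_left_cancel₀ (sub_ne_zero.2 hac) (by linear_combination h2 - h1)
  have := congrArg norm h3
  simpa [hb] using this

/-- If a conic inscribed in a Poncelet triangle has a focus `E.pt v` on `E` and is not degenerate,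
then its other focus does not lie inside the circumcircle. -/
lemma power_nonneg_of_focal {p q k : ℝ} {s c w v : ℂ} (hl : ‖l‖ = 1) (hv : ‖v‖ = 1) (hk : k ≠ 0)
    (h1 : w + v - s + l * conj (w * v - c + p * q * k) = 0)
    (h2 : apol s c w v = k * (p ^ 2 + q ^ 2 - p * q * (c + conj c))) (hpq : 0 ≤ p * q) :
    0 ≤ alpha p q s c w - (l * (2 * (p * q) * beta s c w)).re := by
  have l1 := mul_conj_one hl
  have v1 := mul_conj_one hv
  have hw1 := Complex.mul_conj w
  rw [Complex.normSq_eq_norm_sq] at hw1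
  push_cast at hw1
  have h1' := congrArg conj h1
  simp only [map_add, map_sub, map_mul, map_zero, Complex.conj_ofReal, Complex.conj_conj]
    at h1 h1'
  -- Taking moduli in `h1` and subtracting from `h2`, with `|v| = 1`, leaves an identity divisible
  -- by `k`; this is where `k ≠ 0` enters.
  have key : (p : ℂ) ^ 2 * q ^ 2 * k =
      p ^ 2 + q ^ 2 - p * q * (w * v + conj w * conj v) := by
    have hk' : (k : ℂ) ≠ 0 := by exact_mod_cast hk
    unfold apol at h2
    apply mul_left_cancel₀ hk'
    have hnorm : (w + v - s) * (conj w + conj v - conj s) =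
        (w * v - c + p * q * k) * (conj w * conj v - conj c + p * q * k) := by
      linear_combination (conj w + conj v - conj s) * h1 -
        l * (conj w * conj v - conj c + p * q * k) * h1' +
        (conj w * conj v - conj c + p * q * k) * (w * v - c + p * q * k) * l1
    linear_combination h2 - hnorm + (1 - w * conj w) * v1
  have cx : (w ^ 2 - s * w + c) - l * beta s c w =
      l * conj v * (1 - w * conj w) - p * q * k * (l * w) + p * q * k := by
    unfold beta
    linear_combination w * h1 - l * h1' + (w * v - c + p * q * k) * l1
  set x := l * w with hx
  set y := l * conj v with hy
  have ny : ‖y‖ = 1 := by simp [hy, hl, hv]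
  have hwv : w * v = x * conj y := by
    rw [hx, hy]; simp only [map_mul, Complex.conj_conj]
    linear_combination (-w * v) * l1
  have nx : ‖w‖ = ‖x‖ := by simp [hx, hl]
  have e2 : (l * (2 * (p * q) * beta s c w)).re = 2 * (p * q) * (l * beta s c w).re := by
    have : l * (2 * (p * q) * beta s c w) =
      ((2 * (p * q) : ℝ) : ℂ) * (l * beta s c w) := by push_cast; ring
    rw [this, Complex.re_ofReal_mul]
  have hkey : p ^ 2 * q ^ 2 * k = p ^ 2 + q ^ 2 - 2 * (p * q) * (x * conj y).re := by
    have hc2 : conj w * conj v = conj (x * conj y) := by rw [← hwv, map_mul]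
    rw [hc2, hwv] at key
    have := congrArg Complex.re key
    have e3 : x * conj y + conj (x * conj y) = ((2 * (x * conj y).re : ℝ) : ℂ) := by
      rw [Complex.add_conj]
    rw [e3] at this
    norm_cast at this
    linarith
  have hcx := congrArg Complex.re cx
  have e4 : y * (1 - w * conj w) - p * q * k * x + p * q * k =
      ((1 - ‖x‖ ^ 2 : ℝ) : ℂ) * y - ((p * q * k : ℝ) : ℂ) * x + ((p * q * k : ℝ) : ℂ) := by
    push_cast; rw [hw1, nx, mul_comm y]
  rw [e4, Complex.sub_re] at hcx
  simp only [Complex.add_re, Complex.sub_re, Complex.re_ofReal_mul, Complex.ofReal_re] at hcx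
  -- In terms of `x = l w` and the unimodular `y = l v̄`, the power is at least `(p - q)² |1 - x|²`.
  have goal_eq : alpha p q s c w - (l * (2 * (p * q) * beta s c w)).re =
      (p ^ 2 + q ^ 2) * ‖1 - x‖ ^ 2 + 2 * (p * q) * (y * conj ((1 - x) ^ 2)).re := by
    rw [e2]
    unfold alpha
    have e5 : (p ^ 2 + q ^ 2) * (‖w‖ ^ 2 - 1) + 2 * (p * q) * (w ^ 2 - s * w + c).re -
        2 * (p * q) * (l * beta s c w).re = (p ^ 2 + q ^ 2) * (‖x‖ ^ 2 - 1) +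
        2 * (p * q) * ((1 - ‖x‖ ^ 2) * y.re) + 2 * (1 - x.re) * (p ^ 2 * q ^ 2 * k) := by
      rw [nx]; simp only [Complex.add_re, Complex.sub_re] at hcx ⊢
      linear_combination 2 * (p * q) * hcx
    rw [e5, hkey]
    simp only [← Complex.normSq_eq_norm_sq, Complex.normSq_apply]
    simp [pow_two]
    ring
  rw [goal_eq]
  have hb : -‖1 - x‖ ^ 2 ≤ (y * conj ((1 - x) ^ 2)).re := by
    have := (abs_le.1 (Complex.abs_re_le_norm (y * conj ((1 - x) ^ 2)))).1
    rwa [norm_mul, ny, one_mul, RCLike.norm_conj, norm_pow] at this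
  nlinarith [mul_nonneg (sq_nonneg (p - q)) (sq_nonneg ‖1 - x‖), mul_nonneg hpq
    (sub_nonneg.2 hb)]

/-- By `power_nonneg_of_focal`, being strictly inside the circumcircle forces `k = 0`, so each side
line contains `P` or `Q`. Since `P` is not on `E`, it lies on at most one of them; `Q`, being on
`E`, is then the vertex common to two others, and `P` lies on the opposite side. -/
lemma locus_inter_subset (hnested : Ec.carrier ⊆ E.inside) {w Q : ℂ}
    (hw : ‖w‖ ≠ 1)
    (hin : ∀ T ∈ ponceletFamily E Ec, dist (E.pt w) T.circumcenter < T.circumradius)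
    (hQ : Q ∈ isogonalLocus E Ec (E.pt w) ∩ E.carrier) :
    ∃ L ∈ Ec.tangentsFrom (E.pt w), IsApexOver E Ec L Q := by
  obtain ⟨⟨T, hT, hi⟩, hQE⟩ := hQ
  obtain ⟨-, l, z₁, z₂, z₃, h⟩ := exists_inscribed hT
  obtain ⟨v, rfl⟩ : ∃ v, Q = E.pt v := ⟨_, (E.pt_co Q).symm⟩
  have nv := E.pt_mem_carrier.1 hQE
  have hM := den_pos E.q_nonneg E.q_lt_p (norm_parC_lt (E := E) hnested)
  obtain ⟨-, k, hk⟩ := h.isogonal_iff_focal.1 hi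
  have hk0 : k = 0 := by
    by_contra hk0
    obtain ⟨h1, h2⟩ := (h.focal_iff hnested).1 hk
    have hp := power_nonneg_of_focal h.norm_param nv hk0 h1 ((apol_eq_iff hM.ne').2 h2)
      (mul_nonneg (E.q_nonneg.trans E.q_lt_p.le) E.q_nonneg)
    rw [← h.power w] at hp
    have h3 := hin T hT
    have h4 : dist (E.pt w) T.circumcenter ^ 2 < T.circumradius ^ 2 :=
      pow_lt_pow_left₀ h3 dist_nonneg two_ne_zero
    linarith
  rw [hk0] at hk
  unfold IsFocal at hk
  simp only [Complex.ofReal_zero, zero_mul, mul_eq_zero] at hk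
  have main : ∀ (i : Fin 3) (a b : ℂ), ‖a‖ = 1 → ‖b‖ = 1 → a ≠ b → chord a b w = 0 →
      side T i = line[ℝ, E.pt a, E.pt b] → T.points i = E.pt v →
      ∃ L ∈ Ec.tangentsFrom (E.pt w), IsApexOver E Ec L (E.pt v) := by
    intro i a b na nb hab hch hs hp
    refine ⟨side T i, ⟨(hT i).2, ?_⟩, T, hT, i, hp, rfl⟩
    rw [hs]; exact (E.pt_mem_chord na nb hab).2 hch
  obtain ⟨k1, k2, k3⟩ := hk
  have c1 : chord z₂ z₃ v = 0 → v ≠ z₁ := by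
    rintro h0 rfl
    exact chord_vertex_ne nv h.h₃₁ h.h₁₂ h0
  rcases k1 with k1 | k1 <;> rcases k2 with k2 | k2
  · exact absurd (two_chords h.n₃ h.h₁₂.symm k1 k2) hw
  · rcases k3 with k3 | k3
    · exact absurd (two_chords h.n₂ h.h₃₁.symm k3 k1) hw
    · have hv : v = z₁ := by
        rcases chord_factor nv k3 with h0 | h0
        · exact h0
        · rcases chord_factor nv k2 with h1 | h1
          · exact absurd (h0.symm.trans h1) h.h₂₃
          · exact h1
      exact main 0 z₂ z₃ h.n₂ h.n₃ h.h₂₃ k1 (by rw [side_zero, h.pt₁, h.pt₂])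
        (by rw [h.pt₀, hv])
  · rcases k3 with k3 | k3
    · exact absurd (two_chords h.n₁ h.h₂₃.symm k2 k3) hw
    · have hv : v = z₂ := by
        rcases chord_factor nv k3 with h0 | h0
        · exact absurd h0 (c1 k1)
        · exact h0
      exact main 1 z₃ z₁ h.n₃ h.n₁ h.h₃₁ k2 (by rw [side_one, h.pt₂, h.pt₀])
        (by rw [h.pt₁, hv])
  · have hv : v = z₃ := by
      rcases chord_factor nv k2 with h0 | h0
      · exact h0
      · exact absurd h0 (c1 k1)
    rcases k3 with k3 | k3
    · exact main 2 z₁ z₂ h.n₁ h.n₂ h.h₁₂ k3 (by rw [side_two, h.pt₀, h.pt₁])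
        (by rw [h.pt₂, hv])
    · rcases chord_factor nv k3 with h0 | h0
      · exact absurd h0 (c1 k1)
      · exact absurd (h0.symm.trans hv) h.h₂₃

end PonceletIsogonal

end

theorem mainTheorem9 (E Ec : PonceletIsogonal.Ellipse)
    (hnested : Ec.carrier ⊆ E.inside)
    (hponcelet : (PonceletIsogonal.ponceletFamily E Ec).Nonempty)
    (P : ℂ) :
    -- the type of the locus
    (P ∉ PonceletIsogonal.sweptRegion E Ec → P ∉ Ec.foci →
      PonceletIsogonal.IsEllipse (PonceletIsogonal.isogonalLocus E Ec P)) ∧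
    (P ∈ interior (PonceletIsogonal.sweptRegion E Ec) → P ∉ E.carrier →
      PonceletIsogonal.IsHyperbola (PonceletIsogonal.isogonalLocus E Ec P)) ∧
    -- the points `Z₁`, `Z₂` in which it meets `E`
    ((P ∉ PonceletIsogonal.sweptRegion E Ec ∨
        (P ∈ interior (PonceletIsogonal.sweptRegion E Ec) ∧ P ∉ E.carrier)) →
      P ∈ Ec.outside →
      ∃ (l₁ l₂ : AffineSubspace ℝ ℂ) (Z₁ Z₂ : ℂ),
        l₁ ≠ l₂ ∧ Ec.tangentsFrom P = {l₁, l₂} ∧ Z₁ ≠ Z₂ ∧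
        Z₁ ∈ PonceletIsogonal.isogonalLocus E Ec P ∩ E.carrier ∧
        Z₂ ∈ PonceletIsogonal.isogonalLocus E Ec P ∩ E.carrier ∧
        (∀ Z, PonceletIsogonal.IsApexOver E Ec l₁ Z ↔ Z = Z₁) ∧
        (∀ Z, PonceletIsogonal.IsApexOver E Ec l₂ Z ↔ Z = Z₂) ∧
        ((∀ T ∈ PonceletIsogonal.ponceletFamily E Ec,
            dist P T.circumcenter < T.circumradius) →
          PonceletIsogonal.isogonalLocus E Ec P ∩ E.carrier = {Z₁, Z₂})) := by
  open PonceletIsogonal in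
  obtain ⟨T₀, hT₀⟩ := hponcelet
  have hc : Closure E Ec := (exists_inscribed hT₀).1
  obtain ⟨w, rfl⟩ : ∃ w, P = E.pt w := ⟨_, (E.pt_co P).symm⟩
  refine ⟨fun hP hf => ?_, fun hP hE => ?_, fun hP hout => ?_⟩
  · rw [mem_swept_iff hnested hc, not_le] at hP
    exact isEllipse_locus hnested hc hP hf
  · have hw : ‖w‖ ≠ 1 := fun h => hE (E.pt_mem_carrier.2 h)
    exact isHyperbola_locus hnested hc hw (abs_alp_lt_of_interior hnested hc hP hw)
  · have hw : ‖w‖ ≠ 1 := by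
      rcases hP with hP | ⟨-, hE⟩
      · exact fun h => hP ((mem_swept_iff hnested hc w).2 (abs_alp_le_of_norm_one h))
      · exact fun h => hE (E.pt_mem_carrier.2 h)
    obtain ⟨l₁, l₂, hne, htan⟩ := Ec.exists_tangents hout
    have m₁ : l₁ ∈ Ec.tangentsFrom (E.pt w) := by rw [htan]; simp
    have m₂ : l₂ ∈ Ec.tangentsFrom (E.pt w) := by rw [htan]; simp
    obtain ⟨Z₁, h₁⟩ := existsUnique_apex (E := E) hnested hc m₁.1
    obtain ⟨Z₂, h₂⟩ := existsUnique_apex (E := E) hnested hc m₂.1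
    have a₁ := (h₁ Z₁).2 rfl
    have a₂ := (h₂ Z₂).2 rfl
    have i₁ := apex_mem_locus hc hw m₁.2 a₁
    have i₂ := apex_mem_locus hc hw m₂.2 a₂
    refine ⟨l₁, l₂, Z₁, Z₂, hne, htan, ?_, i₁, i₂, h₁, h₂, fun hin => ?_⟩
    · rintro rfl
      exact hne (apex_injective hnested hc a₁ a₂)
    · refine Set.Subset.antisymm (fun Q hQ => ?_) ?_
      · obtain ⟨L, hL, hap⟩ := locus_inter_subset hnested hw hin hQ
        rw [htan] at hL
        rcases hL with rfl | rfl
        · exact Or.inl ((h₁ Q).1 hap)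
        · exact Or.inr ((h₂ Q).1 hap)
      · rintro _ (rfl | rfl)
        · exact i₁
        · exact i₂
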